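/- Let $G$ be a (finite-dimensional real) Lie group with Lie algebra $\mathfrak g$, let $H$ be a closed subgroup of $G$ with Lie algebra $\mathfrak h=\{X\in\mathfrak g : \exp(tX)\in H \text{ for all } t\in\mathbb R\}$, let $\mathfrak m$ be a linear subspace of $\mathfrak g$ complementary to $\mathfrak h$ (no invariance of $\mathfrak m$ is assumed), and let $\chi\colon H\to\mathbb C\setminus\{0\}$ be a continuous homomorphism. The differential of $\chi$, extended complex linearly to $\mathfrak h^{\mathbb C}=\mathfrak h\otimes_{\mathbb R}\mathbb C$, is also denoted by $\chi$. For $X\in\mathfrak g$ let $\tilde X$ be the corresponding left invariant vector field, $(\tilde Xf)(g)=\frac{d}{dt}f(g\exp tX)\big|_{t=0}$, acting on the space $C^\infty(G)$ of complex-valued smooth functions, and extend $X\mapsto\tilde X$ complex linearly to $\mathfrak g^{\mathbb C}$. Let $\mathbb D(G)$ be the algebra of left invariant differential operators on $G$ with complex coefficients. For a subspace $V$ of $\mathfrak g$ let $S(V)$ be its symmetric algebra with complex coefficients and, for an integer $m$, let $S_m(V)\subset S(V)$ be the subspace of elements of degree $\le m$ (so $S_{-1}(V)=0$); $S(V)$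 is regarded as a subalgebra of $S(\mathfrak g)$. Let $\lambda\colon S(\mathfrak g)\to\mathbb D(G)$ be the symmetrization map, i.e. the complex linear map with $$\lambda(Y_1\cdots Y_k)=\frac1{k!}\sum_{\sigma\in \mathfrak S_k}\tilde Y_{\sigma(1)}\cdots\tilde Y_{\sigma(k)}\qquad(k\ge 0,\ Y_1,\dots,Y_k\in\mathfrak g).$$ Put $$\mathfrak h^\chi=\{\tilde X+\chi(X) : X\in\mathfrak h^{\mathbb C}\}\subset\mathbb D(G),$$ and for a subspace $A\subset\mathbb D(G)$ let $A\,\mathfrak h^\chi$ be the complex linear span of all products $vw$ with $v\in A$, $w\in\mathfrak h^\chi$. Then for every integer $m\ge 0$ there is the direct sum decomposition $$\lambda(S_m(\mathfrak g))=\lambda(S_{m-1}(\mathfrak g))\,\mathfrak h^\chi\oplus\lambda(S_m(\mathfrak m)),$$ and there is the direct sum decomposition $$\mathbb D(G)=\mathbb D(G)\,\mathfrak h^\chi\oplus\lambda(S(\mathfrak m)).$$ -/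

import Mathlib

open scoped Manifold ContDiff TensorProduct

noncomputable section

/-! ### The symmetric algebra and symmetrization -/

section Symmetrization

variable {V : Type*} [AddCommGroup V] [Module ℂ V] {A : Type*} [Ring A] [Algebra ℂ A]

/-- The multilinear map `(y₁, …, y_k) ↦ (1 / k!) ∑_σ f y_{σ 1} ⋯ f y_{σ k}`. -/
def symMultilinear (f : V →ₗ[ℂ] A) (k : ℕ) : MultilinearMap ℂ (fun _ : Fin k => V) A :=
  ((k.factorial : ℂ)⁻¹) • ∑ σ : Equiv.Perm (Fin k),
    ((MultilinearMap.mkPiAlgebraFin ℂ k A).compLinearMap (fun _ => f)).domDomCongr σ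

theorem symMultilinear_apply (f : V →ₗ[ℂ] A) (k : ℕ) (y : Fin k → V) :
    symMultilinear f k y = ((k.factorial : ℂ)⁻¹) • ∑ σ : Equiv.Perm (Fin k),
      (List.ofFn fun i => f (y (σ i))).prod := by
  simp [symMultilinear]

theorem symMultilinear_perm (f : V →ₗ[ℂ] A) (k : ℕ) (y : Fin k → V) (τ : Equiv.Perm (Fin k)) :
    symMultilinear f k (y ∘ τ) = symMultilinear f k y := by
  rw [symMultilinear_apply, symMultilinear_apply]
  congr 1
  exact Fintype.sum_equiv (Equiv.mulLeft τ) _ _ (fun σ => by simp [Equiv.Perm.mul_apply])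

/-- Symmetrization on the level of the tensor algebra. -/
def tensorSymmetrization (f : V →ₗ[ℂ] A) : TensorAlgebra ℂ V →ₗ[ℂ] A :=
  (DirectSum.toModule ℂ ℕ A fun k => PiTensorProduct.lift (symMultilinear f k)) ∘ₗ
    (TensorAlgebra.toDirectSum (R := ℂ) (M := V)).toLinearMap

theorem tensorSymmetrization_tprod (f : V →ₗ[ℂ] A) (k : ℕ) (y : Fin k → V) :
    tensorSymmetrization f (TensorAlgebra.tprod ℂ V k y) = symMultilinear f k y := by
  simp only [tensorSymmetrization, LinearMap.comp_apply, AlgHom.toLinearMap_apply]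
  rw [TensorAlgebra.toDirectSum_tensorPower_tprod, ← DirectSum.lof_eq_of ℂ,
    DirectSum.toModule_lof]
  simp

theorem tensorSymmetrization_list (f : V →ₗ[ℂ] A) (l : List V) :
    tensorSymmetrization f (l.map (TensorAlgebra.ι ℂ)).prod =
      symMultilinear f l.length l.get := by
  rw [← tensorSymmetrization_tprod, TensorAlgebra.tprod_apply]
  congr 2
  apply List.ext_get <;> simp

theorem symMultilinear_list_swap (f : V →ₗ[ℂ] A) (l l' : List V) (a b : V) :
    symMultilinear f (l ++ a :: b :: l').length (l ++ a :: b :: l').get =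
      symMultilinear f (l ++ b :: a :: l').length (l ++ b :: a :: l').get := by
  have key : ∀ {n n' : ℕ} (hn : n = n') (y : Fin n → V) (y' : Fin n' → V)
      (e : Equiv.Perm (Fin n)), (∀ i, y' (Fin.cast hn i) = y (e i)) →
      symMultilinear f n y = symMultilinear f n' y' := by
    intro n n' hn y y' e h
    subst hn
    rw [← symMultilinear_perm f n y e]
    congr 1
    funext i
    exact (h i).symm
  refine key (by simp) _ _
    (Equiv.swap ⟨l.length, by simp⟩ ⟨l.length + 1, by simp⟩) fun i => ?_
  obtain ⟨i, hi⟩ := i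
  rcases lt_trichotomy i l.length with h | h | h
  · rw [Equiv.swap_apply_of_ne_of_ne (by simp; omega) (by simp; omega)]
    simp [List.getElem_append_left, h]
  · subst h
    rw [Equiv.swap_apply_left]
    simp [List.getElem_append_right]
  · rcases Nat.lt_or_ge (l.length + 1) i with h' | h'
    · rw [Equiv.swap_apply_of_ne_of_ne (by simp; omega) (by simp; omega)]
      obtain ⟨j, rfl⟩ : ∃ j, i = l.length + (j + 2) := ⟨i - l.length - 2, by omega⟩
      simp [List.getElem_append_right]
    · obtain rfl : i = l.length + 1 := by omega
      rw [Equiv.swap_apply_right]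
      simp [List.getElem_append_right]

theorem tensorAlgebra_mem_span_list (x : TensorAlgebra ℂ V) :
    x ∈ Submodule.span ℂ (Set.range fun l : List V => (l.map (TensorAlgebra.ι ℂ)).prod) := by
  induction x using TensorAlgebra.induction with
  | algebraMap r =>
    rw [Algebra.algebraMap_eq_smul_one]
    exact Submodule.smul_mem _ _ (Submodule.subset_span ⟨[], by simp⟩)
  | ι x => exact Submodule.subset_span ⟨[x], by simp⟩
  | mul a b ha hb =>
    have := Submodule.mul_mem_mul ha hb
    rw [Submodule.span_mul_span] at this
    refine Submodule.span_mono ?_ this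
    rintro _ ⟨_, ⟨l, rfl⟩, _, ⟨l', rfl⟩, rfl⟩
    exact ⟨l ++ l', by simp⟩
  | add a b ha hb => exact Submodule.add_mem _ ha hb

/-- Tensors `a`, `b` such that `x a y` and `x b y` always have the same symmetrization. -/
def symmetrizationCon (f : V →ₗ[ℂ] A) : RingCon (TensorAlgebra ℂ V) where
  r a b := ∀ x y, tensorSymmetrization f (x * a * y) = tensorSymmetrization f (x * b * y)
  iseqv := ⟨fun _ _ _ => rfl, fun h x y => (h x y).symm, fun h h' x y => (h x y).trans (h' x y)⟩
  add' h h' x y := by simp only [mul_add, add_mul, map_add, h x y, h' x y]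
  mul' {a b c d} h h' x y := by
    have h1 := h x (c * y)
    have h2 := h' (x * b) y
    simp only [mul_assoc] at h1 h2 ⊢
    rw [h1, h2]

theorem symRingCon_le (f : V →ₗ[ℂ] A) :
    TensorAlgebra.symRingCon ℂ V ≤ symmetrizationCon f := by
  refine RingCon.ringConGen_le.2 ?_
  rintro _ _ ⟨u, v⟩ x y
  induction tensorAlgebra_mem_span_list x using Submodule.span_induction with
  | zero => simp
  | add a b _ _ ha hb => simp only [add_mul, map_add, ha, hb]
  | smul c a _ ha => simp only [smul_mul_assoc, map_smul, ha]
  | mem x hx =>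
    obtain ⟨l, rfl⟩ := hx
    induction tensorAlgebra_mem_span_list y using Submodule.span_induction with
    | zero => simp
    | add a b _ _ ha hb => simp only [mul_add, map_add, ha, hb]
    | smul c a _ ha => simp only [mul_smul_comm, map_smul, ha]
    | mem y hy =>
      obtain ⟨l', rfl⟩ := hy
      have h1 : ∀ a b : V, (l.map (TensorAlgebra.ι ℂ)).prod *
          (TensorAlgebra.ι ℂ a * TensorAlgebra.ι ℂ b) * (l'.map (TensorAlgebra.ι ℂ)).prod =
          ((l ++ a :: b :: l').map (TensorAlgebra.ι ℂ)).prod := by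
        intro a b
        simp [mul_assoc]
      simp only [h1]
      rw [tensorSymmetrization_list, tensorSymmetrization_list]
      exact symMultilinear_list_swap f l l' u v

/-- The symmetrization `λ : S(V) → A` attached to a linear map `f` from `V` to an associative
algebra `A`: the linear map with `λ(y₁ ⋯ y_k) = (1 / k!) ∑_σ f y_{σ 1} ⋯ f y_{σ k}`
(see `symmetrization_prod`). -/
def symmetrization (f : V →ₗ[ℂ] A) : SymmetricAlgebra ℂ V →ₗ[ℂ] A where
  toFun := Quotient.lift (tensorSymmetrization f) fun a b h => by
    simpa using symRingCon_le f h 1 1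
  map_add' a b := by
    obtain ⟨a, rfl⟩ := SymmetricAlgebra.algHom_surjective ℂ V a
    obtain ⟨b, rfl⟩ := SymmetricAlgebra.algHom_surjective ℂ V b
    exact map_add (tensorSymmetrization f) a b
  map_smul' c a := by
    obtain ⟨a, rfl⟩ := SymmetricAlgebra.algHom_surjective ℂ V a
    exact map_smul (tensorSymmetrization f) c a

theorem symmetrization_prod (f : V →ₗ[ℂ] A) (k : ℕ) (y : Fin k → V) :
    symmetrization f (∏ i, SymmetricAlgebra.ι ℂ V (y i)) =
      ((k.factorial : ℂ)⁻¹) • ∑ σ : Equiv.Perm (Fin k),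
        (List.ofFn fun i => f (y (σ i))).prod := by
  have h : ∏ i, SymmetricAlgebra.ι ℂ V (y i) =
      SymmetricAlgebra.algHom ℂ V (TensorAlgebra.tprod ℂ V k y) := by
    rw [TensorAlgebra.tprod_apply, map_list_prod, List.map_ofFn, List.prod_ofFn]
    rfl
  rw [h, ← symMultilinear_apply, ← tensorSymmetrization_tprod]
  rfl

end Symmetrization

section SymmetricAlgebraFiltration

variable {V : Type*} [AddCommGroup V] [Module ℝ V]

/-- The complexified symmetric algebra of a real vector space `V`, i.e. the algebra of polynomial
functions with complex coefficients on the dual of `V`. -/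
abbrev ComplexSym (V : Type*) [AddCommGroup V] [Module ℝ V] : Type _ :=
  SymmetricAlgebra ℂ (ℂ ⊗[ℝ] V)

/-- For a real subspace `W` of `V`, the space `S^k(W)` of homogeneous elements of degree `k` of
`S(W)`, inside `S(V)`: the complex span of the `k`-fold products of elements of `W`. -/
def symHomogeneous (W : Submodule ℝ V) (k : ℕ) : Submodule ℂ (ComplexSym V) :=
  ((W.baseChange ℂ).map (SymmetricAlgebra.ι ℂ (ℂ ⊗[ℝ] V))) ^ k

/-- The space `S_d(W)` of elements of degree at most `d` of `S(W)`, inside `S(V)`.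
It is zero for `d < 0`. -/
def symDegreeLE (W : Submodule ℝ V) (d : ℤ) : Submodule ℂ (ComplexSym V) :=
  ⨆ (k : ℕ) (_ : (k : ℤ) ≤ d), symHomogeneous W k

/-- The symmetric algebra `S(W)`, inside `S(V)`. -/
def symAll (W : Submodule ℝ V) : Submodule ℂ (ComplexSym V) :=
  ⨆ k : ℕ, symHomogeneous W k

end SymmetricAlgebraFiltration

/-! ### Differential operators -/

section DiffOp

variable {A : Type*} [CommRing A] [Algebra ℂ A]

/-- Linear differential operators of order at most `k` on a commutative algebra `A`: those of
order at most `0` are the multiplication operators, and `D` has order at most `k + 1` if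
all commutators `[D, f]` with multiplication operators have order at most `k`. For the algebra of
smooth functions on a manifold these are the usual differential operators with smooth
coefficients of order at most `k`. -/
def IsDiffOp : ℕ → Module.End ℂ A → Prop
  | 0, D => ∃ a : A, D = LinearMap.mulLeft ℂ a
  | k + 1, D => ∀ f : A, IsDiffOp k (D * LinearMap.mulLeft ℂ f - LinearMap.mulLeft ℂ f * D)

theorem IsDiffOp.succ {k : ℕ} {D : Module.End ℂ A} (h : IsDiffOp k D) : IsDiffOp (k + 1) D := by
  induction k generalizing D with
  | zero =>
    obtain ⟨a, rfl⟩ := h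
    intro f
    refine ⟨0, ?_⟩
    ext x
    simp [mul_left_comm]
  | succ k ih => exact fun f => ih (h f)

theorem IsDiffOp.mono {k l : ℕ} (hkl : k ≤ l) {D : Module.End ℂ A} (h : IsDiffOp k D) :
    IsDiffOp l D := by
  induction hkl with
  | refl => exact h
  | step _ ih => exact ih.succ

theorem IsDiffOp.add {k : ℕ} {D D' : Module.End ℂ A} (h : IsDiffOp k D) (h' : IsDiffOp k D') :
    IsDiffOp k (D + D') := by
  induction k generalizing D D' with
  | zero =>
    obtain ⟨a, rfl⟩ := h
    obtain ⟨b, rfl⟩ := h'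
    exact ⟨a + b, by ext x; simp [add_mul]⟩
  | succ k ih =>
    intro f
    have := ih (h f) (h' f)
    rwa [show (D + D') * LinearMap.mulLeft ℂ f - LinearMap.mulLeft ℂ f * (D + D') =
      (D * LinearMap.mulLeft ℂ f - LinearMap.mulLeft ℂ f * D) +
        (D' * LinearMap.mulLeft ℂ f - LinearMap.mulLeft ℂ f * D') by noncomm_ring]

theorem IsDiffOp.mul {k l : ℕ} {D D' : Module.End ℂ A} (h : IsDiffOp k D) (h' : IsDiffOp l D') :
    IsDiffOp (k + l) (D * D') := by
  induction k generalizing l D D' with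
  | zero =>
    obtain ⟨a, rfl⟩ := h
    rw [zero_add]
    induction l generalizing D' with
    | zero =>
      obtain ⟨b, rfl⟩ := h'
      exact ⟨a * b, by ext x; simp⟩
    | succ l ih =>
      intro f
      have := ih (h' f)
      rwa [show LinearMap.mulLeft ℂ a * D' * LinearMap.mulLeft ℂ f -
          LinearMap.mulLeft ℂ f * (LinearMap.mulLeft ℂ a * D') = LinearMap.mulLeft ℂ a *
          (D' * LinearMap.mulLeft ℂ f - LinearMap.mulLeft ℂ f * D') by
        ext x; simp [mul_sub, mul_left_comm]]
  | succ k ih =>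
    induction l generalizing D' with
    | zero =>
      intro f
      obtain ⟨b, rfl⟩ := h'
      have := ih (h f) (l := 0) ⟨b, rfl⟩
      rwa [show D * LinearMap.mulLeft ℂ b * LinearMap.mulLeft ℂ f -
          LinearMap.mulLeft ℂ f * (D * LinearMap.mulLeft ℂ b) =
          (D * LinearMap.mulLeft ℂ f - LinearMap.mulLeft ℂ f * D) * LinearMap.mulLeft ℂ b by
        ext x; simp [mul_left_comm]]
    | succ l ihl =>
      intro f
      have h1 := ihl (h' f)
      have h2 := ih (h f) h'
      rw [show k + (l + 1) = k + 1 + l by ring] at h2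
      have h3 := h1.add h2
      rwa [show D * D' * LinearMap.mulLeft ℂ f - LinearMap.mulLeft ℂ f * (D * D') =
          D * (D' * LinearMap.mulLeft ℂ f - LinearMap.mulLeft ℂ f * D') +
          (D * LinearMap.mulLeft ℂ f - LinearMap.mulLeft ℂ f * D) * D' by
        rw [mul_sub, sub_mul]; simp only [mul_assoc]; abel]

end DiffOp

/-! ### Lie groups -/

section LieGroup

variable {E : Type*} [NormedAddCommGroup E] [NormedSpace ℝ E]
  {G : Type*} [TopologicalSpace G] [ChartedSpace E G]

variable (E G) in
/-- The algebra `C^∞(G)` of smooth complex valued functions on `G`. -/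
def smoothFunctions : Subalgebra ℂ (G → ℂ) where
  carrier := {f | ContMDiff 𝓘(ℝ, E) 𝓘(ℝ, ℂ) ∞ f}
  mul_mem' {f g} hf hg := by
    have h : ContDiff ℝ ∞ (fun p : ℂ × ℂ => p.1 * p.2) := contDiff_mul
    exact h.contMDiff.comp (ContMDiff.prodMk_space hf hg)
  add_mem' hf hg := hf.add hg
  algebraMap_mem' _ := contMDiff_const

theorem smoothFunctions_mdifferentiableAt (f : smoothFunctions E G) (g : G) :
    MDifferentiableAt 𝓘(ℝ, E) 𝓘(ℝ, ℂ) f.1 g :=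
  ContMDiff.mdifferentiableAt f.2 (by simp)

variable [Group G]

/-- `γ` is the one-parameter subgroup `t ↦ exp (t X)`, i.e. the integral curve through `1` of the
left invariant vector field defined by `X`. -/
def IsOneParameterSubgroup (X : GroupLieAlgebra 𝓘(ℝ, E) G) (γ : ℝ → G) : Prop :=
  γ 0 = 1 ∧ IsMIntegralCurve γ (mulInvariantVectorField X)

variable (E) in
/-- The Lie algebra `𝔥 = {X | exp (t X) ∈ H for all t}` of a closed subgroup `H` of `G`.
For a closed subgroup this set is a linear subspace, so that taking its span changes nothing. -/
def subgroupLieAlgebra (H : Subgroup G) : Submodule ℝ (GroupLieAlgebra 𝓘(ℝ, E) G) :=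
  Submodule.span ℝ {X | ∃ γ : ℝ → G, IsOneParameterSubgroup X γ ∧ ∀ t, γ t ∈ H}

/-- For a character `χ` of `H`: `X` is in the Lie algebra of `H`, and the differential of `χ` takes
the value `c` at `X`, i.e. `exp (t X) ∈ H` for all `t` and `d/dt χ(exp (t X)) = c` at `t = 0`. -/
def IsCharacterDifferential {H : Subgroup G} (χ : H →* ℂˣ) (X : GroupLieAlgebra 𝓘(ℝ, E) G)
    (c : ℂ) : Prop :=
  ∃ (γ : ℝ → G) (hγ : ∀ t, γ t ∈ H), IsOneParameterSubgroup X γ ∧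
    HasDerivAt (fun t => (χ ⟨γ t, hγ t⟩ : ℂ)) c 0

/-- Left translation `f ↦ f(g ·)` on `C^∞(G)`. -/
def leftTranslate [LieGroup 𝓘(ℝ, E) ∞ G] (g : G) : Module.End ℂ (smoothFunctions E G) where
  toFun f := ⟨fun x => f.1 (g * x), ContMDiff.comp f.2 contMDiff_mul_left⟩
  map_add' _ _ := rfl
  map_smul' _ _ := rfl

variable (E G) in
/-- The algebra `𝔻(G)` of left invariant differential operators on `G` with complex
coefficients. -/
def invariantDiffOps [LieGroup 𝓘(ℝ, E) ∞ G] :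
    Subalgebra ℂ (Module.End ℂ (smoothFunctions E G)) where
  carrier := {D | (∃ k, IsDiffOp k D) ∧ ∀ g : G, D * leftTranslate g = leftTranslate g * D}
  mul_mem' := by
    rintro D D' ⟨⟨k, hk⟩, h⟩ ⟨⟨l, hl⟩, h'⟩
    refine ⟨⟨k + l, hk.mul hl⟩, fun g => ?_⟩
    rw [mul_assoc, h' g, ← mul_assoc, h g, mul_assoc]
  add_mem' := by
    rintro D D' ⟨⟨k, hk⟩, h⟩ ⟨⟨l, hl⟩, h'⟩
    refine ⟨⟨max k l, (hk.mono (le_max_left k l)).add (hl.mono (le_max_right k l))⟩, fun g => ?_⟩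
    rw [add_mul, mul_add, h g, h' g]
  algebraMap_mem' c := by
    refine ⟨⟨0, algebraMap ℂ _ c, ?_⟩, fun g => Algebra.commutes c _⟩
    ext f x
    simp [Algebra.smul_def]

theorem contMDiff_mulInvariantField [LieGroup 𝓘(ℝ, E) ∞ G] (X : GroupLieAlgebra 𝓘(ℝ, E) G) :
    ContMDiff 𝓘(ℝ, E) 𝓘(ℝ, E).tangent ∞
      (fun g : G => (⟨g, mulInvariantVectorField X g⟩ : TangentBundle 𝓘(ℝ, E) G)) := by
  have : IsManifold 𝓘(ℝ, E) (∞ + 1) G := inferInstanceAs (IsManifold 𝓘(ℝ, E) ∞ G)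
  have : IsManifold 𝓘(ℝ, E) 1 G := IsManifold.of_le (n := ∞) (by simp)
  let fg : G → TangentBundle 𝓘(ℝ, E) G := fun g => Bundle.TotalSpace.mk' E g 0
  have sfg : ContMDiff 𝓘(ℝ, E) 𝓘(ℝ, E).tangent ∞ fg := Bundle.contMDiff_zeroSection _ _
  let fv : G → TangentBundle 𝓘(ℝ, E) G := fun _ => Bundle.TotalSpace.mk' E 1 X
  have sfv : ContMDiff 𝓘(ℝ, E) 𝓘(ℝ, E).tangent ∞ fv := contMDiff_const
  have S₃ : ContMDiff (𝓘(ℝ, E).prod 𝓘(ℝ, E)).tangent 𝓘(ℝ, E).tangent ∞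
      (tangentMap (𝓘(ℝ, E).prod 𝓘(ℝ, E)) 𝓘(ℝ, E) (fun p : G × G => p.1 * p.2)) :=
    ContMDiff.contMDiff_tangentMap (contMDiff_mul 𝓘(ℝ, E) ∞) (by simp)
  have S := (S₃.comp contMDiff_equivTangentBundleProd_symm).comp (sfg.prodMk sfv)
  convert! S with g
  · simp [fg, fv]
  · simp only [Function.comp_apply, tangentMap, fg, fv]
    rw [mfderiv_prod_eq_add_apply ((contMDiff_mul 𝓘(ℝ, E) ∞).mdifferentiableAt (by simp))]
    refine Eq.symm (Eq.trans (congrArg₂ (· + ·) (map_zero _) ?_) (zero_add _))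
    rfl

theorem contMDiff_leftInvariantDeriv [LieGroup 𝓘(ℝ, E) ∞ G] (X : GroupLieAlgebra 𝓘(ℝ, E) G)
    {f : G → ℂ} (hf : ContMDiff 𝓘(ℝ, E) 𝓘(ℝ, ℂ) ∞ f) :
    ContMDiff 𝓘(ℝ, E) 𝓘(ℝ, ℂ) ∞
      (fun g : G => (mfderiv 𝓘(ℝ, E) 𝓘(ℝ, ℂ) f g (mulInvariantVectorField X g) : ℂ)) := by
  have h1 : ContMDiff 𝓘(ℝ, E).tangent 𝓘(ℝ, ℂ).tangent ∞ (tangentMap 𝓘(ℝ, E) 𝓘(ℝ, ℂ) f) :=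
    hf.contMDiff_tangentMap (by simp)
  have h2 := h1.comp (contMDiff_mulInvariantField X)
  exact (contMDiff_snd_tangentBundle_modelSpace ℂ 𝓘(ℝ, ℂ)).comp h2

/-- The left invariant vector field `X̃` attached to `X`, as an operator on `C^∞(G)`. -/
def leftInvariantDeriv [LieGroup 𝓘(ℝ, E) ∞ G] (X : GroupLieAlgebra 𝓘(ℝ, E) G) :
    Module.End ℂ (smoothFunctions E G) where
  toFun f := ⟨fun g => (mfderiv 𝓘(ℝ, E) 𝓘(ℝ, ℂ) f.1 g (mulInvariantVectorField X g) : ℂ),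
    contMDiff_leftInvariantDeriv X f.2⟩
  map_add' f f' := by
    ext g
    have := mfderiv_add (smoothFunctions_mdifferentiableAt f g)
      (smoothFunctions_mdifferentiableAt f' g)
    exact congrArg (fun L => (L (mulInvariantVectorField X g) : ℂ)) this
  map_smul' c f := by
    ext g
    have h := (smoothFunctions_mdifferentiableAt f g).hasMFDerivAt
    have h2 := ((c • ContinuousLinearMap.id ℝ ℂ).hasMFDerivAt (x := f.1 g)).comp g h
    exact congrArg (fun L => (L (mulInvariantVectorField X g) : ℂ)) h2.mfderiv

variable (E G) in
/-- The real linear embedding `X ↦ X̃` of the Lie algebra of `G` into the operators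
on `C^∞(G)`. -/
def leftInvariantDerivLinear [LieGroup 𝓘(ℝ, E) ∞ G] :
    GroupLieAlgebra 𝓘(ℝ, E) G →ₗ[ℝ] Module.End ℂ (smoothFunctions E G) where
  toFun := leftInvariantDeriv
  map_add' X Y := by
    ext f g
    have h : mulInvariantVectorField (X + Y) g =
      mulInvariantVectorField X g + mulInvariantVectorField Y g := map_add _ X Y
    exact (congrArg (mfderiv 𝓘(ℝ, E) 𝓘(ℝ, ℂ) f.1 g) h).trans (map_add _ _ _)
  map_smul' c X := by
    ext f g
    have h : mulInvariantVectorField (c • X) g =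
      c • mulInvariantVectorField X g := map_smul _ c X
    exact (congrArg (mfderiv 𝓘(ℝ, E) 𝓘(ℝ, ℂ) f.1 g) h).trans (map_smul _ _ _)

variable (E G) in
/-- The symmetrization `λ` from the complexified symmetric algebra of the Lie algebra of `G` to the
operators on `C^∞(G)`, attached to `X ↦ X̃`. -/
def lieSymmetrization [LieGroup 𝓘(ℝ, E) ∞ G] :
    ComplexSym (GroupLieAlgebra 𝓘(ℝ, E) G) →ₗ[ℂ] Module.End ℂ (smoothFunctions E G) :=
  symmetrization (A := Module.End ℂ (smoothFunctions E G))
    ((leftInvariantDerivLinear E G).liftBaseChange ℂ)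

variable (E) in
/-- The space `𝔥^χ = {X + χ(X) | X ∈ 𝔥^ℂ}` of operators on `C^∞(G)`, where the differential `χ` is
extended complex linearly to the complexification of `𝔥`: the complex span of the
operators `X̃ + χ(X)` for `X` in `𝔥`. -/
def characterShift [LieGroup 𝓘(ℝ, E) ∞ G] {H : Subgroup G} (χ : H →* ℂˣ) :
    Submodule ℂ (Module.End ℂ (smoothFunctions E G)) :=
  Submodule.span ℂ {D | ∃ (X : GroupLieAlgebra 𝓘(ℝ, E) G) (c : ℂ),
    IsCharacterDifferential χ X c ∧ D = leftInvariantDeriv X + c • 1}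

end LieGroup

end

noncomputable section

/-! ### Symbols of operators -/

section Symbol

variable {A : Type*} [CommRing A] [Algebra ℂ A] (ev : A →ₐ[ℂ] ℂ) (f : A)

/-! The decomposition comes from a second symmetrization adapted to 𝔤 = 𝔪 ⊕ 𝔥. Let λ^χ be the
symmetrization built from X ↦ X̃ + χ(X), and let Θ send ab, with a ∈ S(𝔪) and b ∈ S(𝔥), to λ(a)
λ^χ(b) (`orderedSymmetrization`). Both λ and Θ assign to a homogeneous polynomial of degree k an
operator whose symbol of degree k is that polynomial: symbols are multiplicative, and the constants
χ(X) have lower order. Polynomials over ℂ are determined by their values, so Θ is injective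
(`injective_of_preservesSymbol`).

Every invariant operator of order at most k is λ(P) with deg P ≤ k (`exists_symmetrization_eq`).
Indeed, a function f killed at 1 by all λ(P) with deg P ≤ k lies in the (k+1)st power of the ideal
of 1, by a Taylor expansion resting on Hadamard's lemma (`mem_pow_of_symmetrization_eq_zero`). Every
operator of order k kills that power at 1, so its functional at 1 is one of finitely many
dimensions' worth of functionals f ↦ (λ(P)f)(1), and an invariant operator is determined by its
functional at 1. Comparing symbols, Θ and λ have the same image on each S_n(𝔤) (`map_degreeLT_eq`).

Since 𝔥^χ is closed under commutators, a nonempty product of its elements is λ^χ of a polynomial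
without constant term (`map_pow_succ_le_map_symmetrization`). Hence 𝔻(G)𝔥^χ lies in the image under
Θ of the ideal generated by 𝔥, which meets S(𝔪) in zero; injectivity of Θ makes the sums direct.
That they exhaust everything is a degree count (`filtered_decomposition`).

The Lie theory needed is that 𝔥 is a subspace on which the differential of χ is linear, by the
product formula (`IsCharacterDifferential.add`), and that 𝔥^χ is closed under commutators. For the
latter, t ↦ exp(sX) exp(tY) exp(-sX) has a generator Z(s) with χ(Z(s)) = χ(Y), because χ is
invariant under conjugation in H. So the quotients (Z̃(s) - Ỹ)/s lie in 𝔥^χ, and they converge to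
the commutator of X̃ and Ỹ (`commutator_mem_characterShift`). -/

/-- The operator `u` has, in the direction of the function `f`, the symbol `c` of degree `j`:
`u` lowers the vanishing order along `f` by at most `j`, with leading coefficient `c`. -/
def HasSymbol (u : Module.End ℂ A) (j : ℕ) (c : ℂ) : Prop :=
  ∀ (k : ℕ) (g : A), ∃ g', u (f ^ (k + j) * g) = f ^ k * g' ∧
    (k.factorial : ℂ) * ev g' = ((k + j).factorial : ℂ) * c * ev g

variable {ev f}

/-- Taking k = 0 and g = 1 recovers the symbol from a single value, whence its uniqueness. -/
theorem HasSymbol.ev_apply {u : Module.End ℂ A} {j : ℕ} {c : ℂ} (h : HasSymbol ev f u j c) :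
    ev (u (f ^ j)) = (j.factorial : ℂ) * c := by
  obtain ⟨g', h1, h2⟩ := h 0 1
  simp only [zero_add, mul_one, pow_zero, one_mul, Nat.factorial_zero, Nat.cast_one, map_one]
    at h1 h2
  rw [h1, h2]

theorem HasSymbol.unique {u : Module.End ℂ A} {j : ℕ} {c d : ℂ} (h : HasSymbol ev f u j c)
    (h' : HasSymbol ev f u j d) : c = d := by
  have h1 := h.ev_apply.symm.trans h'.ev_apply
  exact mul_left_cancel₀ (by exact_mod_cast j.factorial_ne_zero) h1

theorem HasSymbol.zero (j : ℕ) : HasSymbol ev f 0 j 0 := fun k g => ⟨0, by simp, by simp⟩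

theorem HasSymbol.one : HasSymbol ev f 1 0 1 := fun k g => ⟨g, by simp, by simp⟩

theorem HasSymbol.add {u v : Module.End ℂ A} {j : ℕ} {c d : ℂ} (hu : HasSymbol ev f u j c)
    (hv : HasSymbol ev f v j d) : HasSymbol ev f (u + v) j (c + d) := fun k g => by
  obtain ⟨a, ha, ha'⟩ := hu k g
  obtain ⟨b, hb, hb'⟩ := hv k g
  refine ⟨a + b, by rw [LinearMap.add_apply, ha, hb, mul_add], ?_⟩
  rw [map_add, mul_add, ha', hb']
  ring

theorem HasSymbol.smul {u : Module.End ℂ A} {j : ℕ} {c : ℂ} (hu : HasSymbol ev f u j c) (r : ℂ) :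
    HasSymbol ev f (r • u) j (r * c) := fun k g => by
  obtain ⟨a, ha, ha'⟩ := hu k g
  refine ⟨r • a, by rw [LinearMap.smul_apply, ha, mul_smul_comm], ?_⟩
  rw [map_smul, smul_eq_mul, mul_left_comm, ha']
  ring

theorem HasSymbol.sub {u v : Module.End ℂ A} {j : ℕ} {c d : ℂ} (hu : HasSymbol ev f u j c)
    (hv : HasSymbol ev f v j d) : HasSymbol ev f (u - v) j (c - d) := by
  have h := hu.add (hv.smul (-1))
  rwa [show u + (-1 : ℂ) • v = u - v by module, neg_one_mul, ← sub_eq_add_neg] at h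

theorem HasSymbol.sum {ι : Type*} (s : Finset ι) {u : ι → Module.End ℂ A} {j : ℕ} {c : ι → ℂ}
    (hu : ∀ i ∈ s, HasSymbol ev f (u i) j (c i)) :
    HasSymbol ev f (∑ i ∈ s, u i) j (∑ i ∈ s, c i) := by
  induction s using Finset.cons_induction with
  | empty => exact HasSymbol.zero j
  | cons a s ha ih =>
    rw [Finset.sum_cons, Finset.sum_cons]
    exact (hu a (by simp)).add (ih fun i hi => hu i (by simp [hi]))

/-- The ratios (k + j)! / k! in the normalization telescope, as for iterated derivatives of powers
of a coordinate. -/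
theorem HasSymbol.mul {u v : Module.End ℂ A} {j l : ℕ} {c d : ℂ} (hu : HasSymbol ev f u j c)
    (hv : HasSymbol ev f v l d) : HasSymbol ev f (u * v) (j + l) (c * d) := fun k g => by
  obtain ⟨a, ha, ha'⟩ := hv (k + j) g
  obtain ⟨b, hb, hb'⟩ := hu k a
  refine ⟨b, by rw [← add_assoc, Module.End.mul_apply, ha, hb], ?_⟩
  rw [hb', mul_right_comm, ha', ← add_assoc]
  ring

theorem HasSymbol.succ (hf : ev f = 0) {u : Module.End ℂ A} {j : ℕ} {c : ℂ}
    (hu : HasSymbol ev f u j c) : HasSymbol ev f u (j + 1) 0 := fun k g => by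
  obtain ⟨a, ha, -⟩ := hu (k + 1) g
  refine ⟨f * a, ?_, by simp [hf]⟩
  rw [show k + (j + 1) = k + 1 + j by ring, ha]
  ring

theorem HasSymbol.of_lt (hf : ev f = 0) {u : Module.End ℂ A} {j l : ℕ} {c : ℂ}
    (hu : HasSymbol ev f u j c) (h : j < l) : HasSymbol ev f u l 0 := by
  induction h with
  | refl => exact hu.succ hf
  | step _ ih => exact ih.succ hf

theorem HasSymbol.of_leibniz {u : Module.End ℂ A}
    (hu : ∀ a b, u (a * b) = a * u b + b * u a) (hf : ev f = 0) :
    HasSymbol ev f u 1 (ev (u f)) := fun k g => by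
  have h1 : u 1 = 0 := by simpa using hu 1 1
  have hpow : ∀ n : ℕ, u (f ^ (n + 1)) = (n + 1 : ℂ) • (f ^ n * u f) := by
    intro n
    induction n with
    | zero => simp
    | succ n ih =>
      have h2 : f * (f ^ n * u f) = f ^ (n + 1) * u f := by ring
      rw [pow_succ, hu, ih, mul_smul_comm, h2]
      push_cast
      module
  -- This is the cofactor of f ^ k in u (f ^ (k + 1) * g); its first term vanishes under `ev`.
  refine ⟨f * u g + (k + 1 : ℂ) • (u f * g), ?_, ?_⟩
  · rw [hu, hpow, mul_add, pow_succ, mul_smul_comm, mul_smul_comm]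
    congr 1
    · ring
    · congr 1; ring
  · simp only [map_add, map_mul, map_smul, hf, zero_mul, zero_add, smul_eq_mul, Nat.factorial_succ,
      Nat.cast_mul, Nat.cast_add, Nat.cast_one]
    ring

theorem HasSymbol.prod_ofFn (n : ℕ) (u : Fin n → Module.End ℂ A) (c : Fin n → ℂ)
    (hu : ∀ i, HasSymbol ev f (u i) 1 (c i)) :
    HasSymbol ev f (List.ofFn u).prod n (∏ i, c i) := by
  induction n with
  | zero => simpa using HasSymbol.one
  | succ n ih =>
    rw [List.ofFn_succ, List.prod_cons, Fin.prod_univ_succ]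
    have h := (hu 0).mul (ih _ _ fun i => hu i.succ)
    rwa [add_comm 1 n] at h

end Symbol

/-! ### The filtration by degree -/

theorem Submodule.map_pow_le {V S : Type*} [AddCommGroup V] [Module ℂ V] [CommRing S] [Algebra ℂ S]
    (φ : V →ₗ[ℂ] S) (M : Submodule ℂ V) (k : ℕ) (Z : Submodule ℂ S)
    (h : ∀ y : Fin k → V, (∀ i, y i ∈ M) → ∏ i, φ (y i) ∈ Z) : (M.map φ) ^ k ≤ Z := by
  rw [← Submodule.span_eq (M.map φ), Submodule.span_pow, Submodule.span_le]
  intro x hx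
  obtain ⟨y, rfl⟩ := Set.mem_pow.1 hx
  choose z hz hz' using fun i => (y i).2
  rw [List.prod_ofFn]
  simp only [← hz']
  exact h z hz

/-- The polynomials in the elements of `X` of degree less than `n`. -/
def degreeLT {S : Type*} [CommRing S] [Algebra ℂ S] (X : Submodule ℂ S) (n : ℕ) : Submodule ℂ S :=
  ⨆ (k : ℕ) (_ : k < n), X ^ k

section Filtration

variable {S : Type*} [CommRing S] [Algebra ℂ S] {X Y : Submodule ℂ S}

theorem degreeLT_zero : degreeLT X 0 = ⊥ := by simp [degreeLT]

theorem pow_le_degreeLT {k n : ℕ} (h : k < n) : X ^ k ≤ degreeLT X n :=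
  le_iSup₂_of_le k h le_rfl

theorem degreeLT_mono {m n : ℕ} (h : m ≤ n) : degreeLT X m ≤ degreeLT X n :=
  iSup₂_le fun _ hk => pow_le_degreeLT (hk.trans_le h)

theorem degreeLT_le_of_le (h : X ≤ Y) (n : ℕ) : degreeLT X n ≤ degreeLT Y n :=
  iSup₂_le fun k hk => (pow_le_pow_left' h k).trans (pow_le_degreeLT hk)

theorem degreeLT_succ (n : ℕ) : degreeLT X (n + 1) = degreeLT X n ⊔ X ^ n := by
  refine le_antisymm (iSup₂_le fun k hk => ?_)
    (sup_le (degreeLT_mono n.le_succ) (pow_le_degreeLT n.lt_succ_self))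
  rcases Nat.lt_succ_iff_lt_or_eq.1 hk with h | rfl
  · exact (pow_le_degreeLT h).trans le_sup_left
  · exact le_sup_right

theorem degreeLT_fg (hX : X.FG) (n : ℕ) : (degreeLT X n).FG := by
  induction n with
  | zero => rw [degreeLT_zero]; exact Submodule.fg_bot
  | succ n ih => rw [degreeLT_succ]; exact ih.sup (hX.pow n)

theorem sup_pow_le (X Y : Submodule ℂ S) (k : ℕ) :
    (X ⊔ Y) ^ k ≤ ⨆ (i : ℕ) (j : ℕ) (_ : i + j = k), X ^ i * Y ^ j := by
  induction k with
  | zero =>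
    refine le_iSup_of_le 0 (le_iSup₂_of_le 0 rfl ?_)
    simp
  | succ k ih =>
    rw [pow_succ]
    refine (mul_le_mul' ih le_rfl).trans ?_
    simp only [Submodule.iSup_mul]
    refine iSup_le fun i => iSup₂_le fun j hij => ?_
    rw [Submodule.mul_sup]
    refine sup_le ?_ ?_
    · refine le_iSup_of_le (i + 1) (le_iSup₂_of_le j (by omega) (le_of_eq ?_))
      rw [pow_succ]; ring
    · refine le_iSup_of_le i (le_iSup₂_of_le (j + 1) (by omega) (le_of_eq ?_))
      rw [pow_succ]; ring

end Filtration

/-- The strict bound in `degreeLT` turns the integer bounds m and m - 1 into the natural numbers m +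
1 and m, so that m = 0 is not exceptional. -/
theorem symDegreeLE_eq_degreeLT {V : Type*} [AddCommGroup V] [Module ℝ V] (W : Submodule ℝ V)
    (m : ℕ) : symDegreeLE W m =
      degreeLT ((W.baseChange ℂ).map (SymmetricAlgebra.ι ℂ (ℂ ⊗[ℝ] V))) (m + 1) := by
  simp [symDegreeLE, degreeLT, symHomogeneous]

theorem symDegreeLE_sub_one_eq_degreeLT {V : Type*} [AddCommGroup V] [Module ℝ V]
    (W : Submodule ℝ V) (m : ℕ) : symDegreeLE W ((m : ℤ) - 1) =
      degreeLT ((W.baseChange ℂ).map (SymmetricAlgebra.ι ℂ (ℂ ⊗[ℝ] V))) m := by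
  simp [symDegreeLE, degreeLT, symHomogeneous]

/-! ### Polynomial functions and symmetrization -/

section SymmetricAlgebra

variable {V : Type*} [AddCommGroup V] [Module ℂ V]

theorem SymmetricAlgebra.map_ι_top_pow_iSup :
    ⨆ k : ℕ, ((⊤ : Submodule ℂ V).map (SymmetricAlgebra.ι ℂ V)) ^ k = ⊤ := by
  refine eq_top_iff.2 fun x _ => ?_
  have hle : ∀ k, ((⊤ : Submodule ℂ V).map (SymmetricAlgebra.ι ℂ V)) ^ k ≤
    ⨆ k : ℕ, ((⊤ : Submodule ℂ V).map (SymmetricAlgebra.ι ℂ V)) ^ k := fun k => le_iSup _ k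
  induction x using SymmetricAlgebra.induction with
  | algebraMap r =>
    refine hle 0 ?_
    rw [pow_zero]
    exact Submodule.algebraMap_mem r
  | ι x => exact hle 1 (by rw [pow_one]; exact Submodule.mem_map_of_mem trivial)
  | mul a b ha hb =>
    have h := Submodule.mul_mem_mul (ha trivial) (hb trivial)
    refine (?_ : (_ : Submodule ℂ (SymmetricAlgebra ℂ V)) ≤ _) h
    simp only [Submodule.iSup_mul, Submodule.mul_iSup]
    refine iSup_le fun i => iSup_le fun j => ?_
    rw [← pow_add]
    exact hle _
  | add a b ha hb => exact Submodule.add_mem _ (ha trivial) (hb trivial)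

theorem SymmetricAlgebra.exists_mem_degreeLT (x : SymmetricAlgebra ℂ V) :
    ∃ n, x ∈ degreeLT ((⊤ : Submodule ℂ V).map (SymmetricAlgebra.ι ℂ V)) n := by
  have hx : x ∈ ⨆ k : ℕ, ((⊤ : Submodule ℂ V).map (SymmetricAlgebra.ι ℂ V)) ^ k := by
    rw [SymmetricAlgebra.map_ι_top_pow_iSup]; trivial
  refine Submodule.iSup_induction _ (motive := fun x => ∃ n, x ∈ degreeLT _ n) hx
    (fun i x hx => ⟨i + 1, pow_le_degreeLT i.lt_succ_self hx⟩) ⟨0, Submodule.zero_mem _⟩ ?_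
  rintro x y ⟨m, hm⟩ ⟨n, hn⟩
  exact ⟨max m n, Submodule.add_mem _ (degreeLT_mono (le_max_left m n) hm)
    (degreeLT_mono (le_max_right m n) hn)⟩

/-- `lift ξ` is evaluation at the point ξ of the dual; in a basis this is the vanishing of a
polynomial over an infinite field all of whose values are zero. -/
theorem SymmetricAlgebra.eq_zero_of_lift_eq_zero (P : SymmetricAlgebra ℂ V)
    (h : ∀ ξ : V →ₗ[ℂ] ℂ, SymmetricAlgebra.lift ξ P = 0) : P = 0 := by
  let b := Module.Free.chooseBasis ℂ V
  let e := SymmetricAlgebra.equivMvPolynomial b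
  have key : ∀ ξ : V →ₗ[ℂ] ℂ, (MvPolynomial.aeval fun i => ξ (b i)).comp e.toAlgHom =
      SymmetricAlgebra.lift ξ := by
    intro ξ
    have : (MvPolynomial.aeval fun i => ξ (b i)) =
        (SymmetricAlgebra.lift ξ).comp e.symm.toAlgHom := by
      ext i
      simp [e]
    rw [this]
    ext x
    simp
  rw [← e.map_eq_zero_iff]
  refine MvPolynomial.funext fun a => ?_
  have h1 := DFunLike.congr_fun (key (b.constr ℂ a)) P
  rw [h] at h1
  simpa [MvPolynomial.aeval_def, MvPolynomial.eval₂_eq_eval_map] using h1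

variable {A : Type*} [CommRing A] [Algebra ℂ A] {ev : A →ₐ[ℂ] ℂ} {f : A}

/-- Scalars commute, so the k! reordered products all have the same symbol, and averaging returns
it. -/
theorem hasSymbol_symmetrization {φ : V →ₗ[ℂ] Module.End ℂ A} {ξ : V →ₗ[ℂ] ℂ} {M : Submodule ℂ V}
    (h : ∀ v, HasSymbol ev f (φ v) 1 (ξ v)) {k : ℕ} {P : SymmetricAlgebra ℂ V}
    (hP : P ∈ (M.map (SymmetricAlgebra.ι ℂ V)) ^ k) :
    HasSymbol ev f (symmetrization φ P) k (SymmetricAlgebra.lift ξ P) := by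
  let Z : Submodule ℂ (SymmetricAlgebra ℂ V) :=
    { carrier := {P | HasSymbol ev f (symmetrization φ P) k (SymmetricAlgebra.lift ξ P)}
      add_mem' := fun {a b} ha hb => by
        simpa only [Set.mem_ofPred_eq, map_add] using ha.add hb
      zero_mem' := by simpa only [Set.mem_ofPred_eq, map_zero] using HasSymbol.zero k
      smul_mem' := fun c a ha => by
        simpa only [Set.mem_ofPred_eq, map_smul, smul_eq_mul] using ha.smul c }
  refine Submodule.map_pow_le _ M k Z (fun y _ => ?_) hP
  change HasSymbol _ _ _ _ _
  rw [symmetrization_prod, map_prod]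
  simp only [SymmetricAlgebra.lift_ι_apply]
  have h1 := (HasSymbol.sum Finset.univ fun (σ : Equiv.Perm (Fin k)) _ =>
    HasSymbol.prod_ofFn k (fun i => φ (y (σ i))) (fun i => ξ (y (σ i))) fun i => h _).smul
      ((k.factorial : ℂ)⁻¹)
  convert h1 using 1
  simp only [Equiv.prod_comp _ (fun i => ξ (y i)), Finset.sum_const, Finset.card_univ,
    Fintype.card_perm, Fintype.card_fin, nsmul_eq_mul]
  rw [inv_mul_cancel_left₀ (by exact_mod_cast k.factorial_ne_zero)]

theorem symmetrization_pow (φ : V →ₗ[ℂ] Module.End ℂ A) (v : V) (k : ℕ) :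
    symmetrization φ (SymmetricAlgebra.ι ℂ V v ^ k) = φ v ^ k := by
  have h := symmetrization_prod φ k fun _ => v
  simp only [Finset.prod_const, Finset.card_univ, Fintype.card_fin, List.ofFn_const,
    List.prod_replicate, Finset.sum_const, Fintype.card_perm] at h
  rw [h, ← Nat.cast_smul_eq_nsmul ℂ, smul_smul, inv_mul_cancel₀, one_smul]
  exact_mod_cast k.factorial_ne_zero

end SymmetricAlgebra

/-! ### Differential operators and derivations on powers of a maximal ideal -/

section DiffOpLemmas

variable {A : Type*} [CommRing A] [Algebra ℂ A]

theorem IsDiffOp.smul {k : ℕ} {D : Module.End ℂ A} (h : IsDiffOp k D) (c : ℂ) :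
    IsDiffOp k (c • D) := by
  have h0 : IsDiffOp 0 (LinearMap.mulLeft ℂ (algebraMap ℂ A c)) := ⟨_, rfl⟩
  have h1 := h0.mul h
  rwa [zero_add, show LinearMap.mulLeft ℂ (algebraMap ℂ A c) * D = c • D by
    ext x; simp [Algebra.smul_def]] at h1

theorem IsDiffOp.zero (k : ℕ) : IsDiffOp k (0 : Module.End ℂ A) :=
  IsDiffOp.mono k.zero_le ⟨0, by ext; simp⟩

variable (A) in
/-- The space of differential operators of order at most `k`. -/
def diffOpsLE (k : ℕ) : Submodule ℂ (Module.End ℂ A) where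
  carrier := {D | IsDiffOp k D}
  add_mem' h h' := h.add h'
  zero_mem' := IsDiffOp.zero k
  smul_mem' c _ h := h.smul c

theorem IsDiffOp.of_leibniz {u : Module.End ℂ A} (hu : ∀ a b, u (a * b) = a * u b + b * u a) :
    IsDiffOp 1 u := fun f => ⟨u f, by ext x; simp [hu, mul_comm x]⟩

theorem IsDiffOp.prod_ofFn (n : ℕ) (u : Fin n → Module.End ℂ A) (hu : ∀ i, IsDiffOp 1 (u i)) :
    IsDiffOp n (List.ofFn u).prod := by
  induction n with
  | zero => exact ⟨1, by ext; simp⟩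
  | succ n ih =>
    rw [List.ofFn_succ, List.prod_cons]
    have h := (hu 0).mul (ih _ fun i => hu i.succ)
    rwa [add_comm 1 n] at h

variable {ev : A →ₐ[ℂ] ℂ}

/-- Write D(ab) = [D, a]b + a D(b) with a in the kernel of `ev`: the last term dies, and [D, a] has
smaller order. -/
theorem IsDiffOp.ev_eq_zero {k : ℕ} {D : Module.End ℂ A} (h : IsDiffOp k D) {f : A}
    (hf : f ∈ (RingHom.ker ev) ^ (k + 1)) : ev (D f) = 0 := by
  induction k generalizing D f with
  | zero =>
    obtain ⟨a, rfl⟩ := h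
    rw [zero_add, pow_one, RingHom.mem_ker] at hf
    simp [hf]
  | succ k ih =>
    rw [pow_succ'] at hf
    refine Submodule.mul_induction_on hf (fun a ha b hb => ?_) fun x y hx hy => ?_
    · have h1 := ih (h a) hb
      rw [RingHom.mem_ker] at ha
      simpa [ha] using h1
    · rw [map_add, map_add, hx, hy, add_zero]

section Leibniz

variable {u : Module.End ℂ A} (hu : ∀ a b, u (a * b) = a * u b + b * u a)
include hu

theorem leibniz_mem_pow {k : ℕ} {f : A} (hf : f ∈ (RingHom.ker ev) ^ (k + 1)) :
    u f ∈ (RingHom.ker ev) ^ k := by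
  induction k generalizing f with
  | zero => simp
  | succ k ih =>
    rw [pow_succ'] at hf
    refine Submodule.mul_induction_on hf (fun a ha b hb => ?_) fun x y hx hy => ?_
    · rw [hu]
      refine Ideal.add_mem _ ?_ (Ideal.mul_mem_right _ _ hb)
      rw [pow_succ']
      exact Ideal.mul_mem_mul ha (ih hb)
    · rw [map_add]
      exact Ideal.add_mem _ hx hy

theorem ev_pow_eq_zero {k : ℕ} {f : A} (hf : f ∈ (RingHom.ker ev) ^ (k + 1)) :
    ev ((u ^ k) f) = 0 := by
  induction k generalizing f with
  | zero => simpa using hf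
  | succ k ih =>
    rw [pow_succ, Module.End.mul_apply]
    exact ih (leibniz_mem_pow hu hf)

theorem ev_pow_mul {k : ℕ} {g : A} (hg : g ∈ (RingHom.ker ev) ^ k) (h : A) :
    ev ((u ^ k) (g * h)) = ev ((u ^ k) g) * ev h := by
  induction k generalizing g h with
  | zero => simp
  | succ k ih =>
    rw [pow_succ, Module.End.mul_apply, Module.End.mul_apply, hu, map_add, map_add, mul_comm h,
      ih (leibniz_mem_pow hu hg),
      ev_pow_eq_zero hu (Ideal.mul_mem_right (u h) _ hg), zero_add]

/-- In the Leibniz expansion only the k + 1 terms with exactly one derivation falling on f survive.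
Iterated, this gives the k! in the evaluation of a product of k coordinates. -/
theorem ev_pow_succ_mul {k : ℕ} {f g : A} (hf : ev f = 0) (hg : g ∈ (RingHom.ker ev) ^ k) :
    ev ((u ^ (k + 1)) (f * g)) = (k + 1) * (ev (u f) * ev ((u ^ k) g)) := by
  induction k generalizing g with
  | zero => simp [hu, hf, mul_comm]
  | succ k ih =>
    rw [pow_succ, Module.End.mul_apply, hu, map_add, map_add, ih (leibniz_mem_pow hu hg),
      ev_pow_mul hu hg, ← Module.End.mul_apply, ← pow_succ]
    push_cast
    ring

end Leibniz

end DiffOpLemmas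

/-! ### Invariant operators as symmetrizations: the abstract setting -/

/-- An abstract version of the algebra of left invariant differential operators: `A` plays the
role of the algebra of smooth functions, `ev` of the evaluation at the unit element, `L v` of the
left invariant vector field attached to `v`, and `C` of the algebra of left
invariant operators. -/
structure IsInvariantFrame {A V : Type*} [CommRing A] [Algebra ℂ A] [AddCommGroup V] [Module ℂ V]
    (ev : A →ₐ[ℂ] ℂ) (L : V →ₗ[ℂ] Module.End ℂ A) (C : Subalgebra ℂ (Module.End ℂ A)) :
    Prop where
  leibniz : ∀ v a b, L v (a * b) = a * L v b + b * L v a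
  mem : ∀ v, L v ∈ C
  eq_zero : ∀ D ∈ C, (∀ f, ev (D f) = 0) → D = 0
  exists_dual : ∀ ξ : Module.Dual ℂ V, ∃ f, ev f = 0 ∧ ∀ v, ev (L v f) = ξ v
  hadamard : ∀ f, ev f = 0 → (∀ v, ev (L v f) = 0) → f ∈ (RingHom.ker ev) ^ 2

namespace IsInvariantFrame

open SymmetricAlgebra (ι)

variable {A V : Type*} [CommRing A] [Algebra ℂ A] [AddCommGroup V] [Module ℂ V]
  {ev : A →ₐ[ℂ] ℂ} {L : V →ₗ[ℂ] Module.End ℂ A} {C : Subalgebra ℂ (Module.End ℂ A)}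

theorem symmetrization_mem {φ : V →ₗ[ℂ] Module.End ℂ A} {M : Submodule ℂ V}
    (hφ : ∀ v, IsDiffOp 1 (φ v) ∧ φ v ∈ C) {k : ℕ} {P : SymmetricAlgebra ℂ V}
    (hP : P ∈ (M.map (ι ℂ V)) ^ k) :
    symmetrization φ P ∈ diffOpsLE A k ⊓ Subalgebra.toSubmodule C := by
  refine Submodule.map_pow_le _ M k ((diffOpsLE A k ⊓ Subalgebra.toSubmodule C).comap
    (symmetrization φ)) (fun y _ => ?_) hP
  rw [Submodule.mem_comap, symmetrization_prod]
  refine Submodule.smul_mem _ _ (Submodule.sum_mem _ fun σ _ => ⟨?_, ?_⟩)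
  · exact IsDiffOp.prod_ofFn k _ fun i => (hφ _).1
  · refine Subalgebra.list_prod_mem _ fun x hx => ?_
    obtain ⟨i, rfl⟩ := (List.mem_ofFn' _ _).1 hx
    exact (hφ _).2

variable (F : IsInvariantFrame ev L C)
include F

theorem isDiffOp (v : V) : IsDiffOp 1 (L v) := IsDiffOp.of_leibniz (F.leibniz v)

theorem hasSymbol {f : A} (hf : ev f = 0) (v : V) : HasSymbol ev f (L v) 1 (ev (L v f)) :=
  HasSymbol.of_leibniz (F.leibniz v) hf

variable [FiniteDimensional ℂ V]

/-- Choosing functions on a basis of the dual makes the choice linear; the x ξ play the role of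
coordinates at the point `ev`. -/
theorem exists_section : ∃ x : Module.Dual ℂ V →ₗ[ℂ] A,
    ∀ ξ, ev (x ξ) = 0 ∧ ∀ v, ev (L v (x ξ)) = ξ v := by
  let b := Module.finBasis ℂ (Module.Dual ℂ V)
  choose f hf hf' using fun i => F.exists_dual (b i)
  have h1 : ev.toLinearMap ∘ₗ b.constr ℂ f = 0 := b.ext fun i => by simp [hf]
  have h2 : ∀ v, ev.toLinearMap ∘ₗ L v ∘ₗ b.constr ℂ f = Module.Dual.eval ℂ V v :=
    fun v => b.ext fun i => by simp [hf']
  exact ⟨b.constr ℂ f, fun ξ => ⟨LinearMap.congr_fun h1 ξ, fun v => LinearMap.congr_fun (h2 v) ξ⟩⟩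

/-- Induction on k by Taylor expansion: an f in the k-th power of the ideal equals, modulo the next
power, a homogeneous polynomial Q in the coordinates. Testing against the operators L v ^ k yields
k! Q(v) = 0 for all v, so Q = 0. -/
theorem mem_pow_of_symmetrization_eq_zero {k : ℕ} {f : A}
    (h : ∀ P ∈ degreeLT ((⊤ : Submodule ℂ V).map (ι ℂ V)) k, ev (symmetrization L P f) = 0) :
    f ∈ (RingHom.ker ev) ^ k := by
  obtain ⟨x, hx⟩ := F.exists_section
  have hmem : ∀ (k : ℕ) (Q : SymmetricAlgebra ℂ (Module.Dual ℂ V)),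
      Q ∈ ((⊤ : Submodule ℂ (Module.Dual ℂ V)).map (ι ℂ _)) ^ k →
      SymmetricAlgebra.lift x Q ∈ (RingHom.ker ev) ^ k := by
    intro k Q hQ
    refine Submodule.map_pow_le _ _ k ((((RingHom.ker ev) ^ k).restrictScalars ℂ).comap
      (SymmetricAlgebra.lift x).toLinearMap) (fun y _ => ?_) hQ
    simp only [Submodule.mem_comap, AlgHom.toLinearMap_apply, map_prod,
      SymmetricAlgebra.lift_ι_apply, Submodule.restrictScalars_mem]
    have := Ideal.prod_mem_prod (s := Finset.univ) (I := fun _ : Fin k => RingHom.ker ev)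
      (x := fun i => x (y i)) fun i _ => (hx (y i)).1
    simpa using this
  have happrox : ∀ (k : ℕ) (f : A), f ∈ (RingHom.ker ev) ^ k →
      ∃ Q ∈ ((⊤ : Submodule ℂ (Module.Dual ℂ V)).map (ι ℂ _)) ^ k,
        f - SymmetricAlgebra.lift x Q ∈ (RingHom.ker ev) ^ (k + 1) := by
    intro k
    induction k with
    | zero =>
      intro f _
      refine ⟨algebraMap ℂ _ (ev f), ?_, ?_⟩
      · rw [pow_zero]; exact Submodule.algebraMap_mem _
      · simp [RingHom.mem_ker]
    | succ k ih =>
      intro f hf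
      rw [pow_succ'] at hf
      refine Submodule.mul_induction_on hf (fun a ha b hb => ?_) ?_
      · obtain ⟨Q, hQ, hQ'⟩ := ih b hb
        let ξ : Module.Dual ℂ V :=
          { toFun := fun v => ev (L v a)
            map_add' := fun v w => by simp
            map_smul' := fun c v => by simp }
        -- A first factor a may be replaced by the coordinate with the same differential; Hadamard's
        -- lemma puts the error in the square of the ideal.
        have h1 : a - x ξ ∈ (RingHom.ker ev) ^ 2 := by
          rw [RingHom.mem_ker] at ha
          refine F.hadamard _ (by simp [ha, (hx ξ).1]) fun v => ?_
          rw [map_sub, map_sub, (hx ξ).2]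
          exact sub_self _
        refine ⟨ι ℂ _ ξ * Q, ?_, ?_⟩
        · rw [pow_succ']
          exact Submodule.mul_mem_mul (Submodule.mem_map_of_mem trivial) hQ
        · rw [map_mul, SymmetricAlgebra.lift_ι_apply, show a * b - x ξ * SymmetricAlgebra.lift x Q =
            (a - x ξ) * b + x ξ * (b - SymmetricAlgebra.lift x Q) by ring]
          refine Ideal.add_mem _ ?_ ?_
          · have := Ideal.mul_mem_mul h1 hb
            rwa [← pow_add, add_comm 2 k] at this
          · rw [pow_succ']
            exact Ideal.mul_mem_mul (hx ξ).1 hQ'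
      · rintro a b ⟨Q, hQ, hQ'⟩ ⟨R, hR, hR'⟩
        refine ⟨Q + R, Submodule.add_mem _ hQ hR, ?_⟩
        rw [map_add, add_sub_add_comm]
        exact Ideal.add_mem _ hQ' hR'
  have heval : ∀ (v : V) (k : ℕ) (Q : SymmetricAlgebra ℂ (Module.Dual ℂ V)),
      Q ∈ ((⊤ : Submodule ℂ (Module.Dual ℂ V)).map (ι ℂ _)) ^ k →
      ev ((L v ^ k) (SymmetricAlgebra.lift x Q)) =
        (k.factorial : ℂ) * SymmetricAlgebra.lift (Module.Dual.eval ℂ V v) Q := by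
    intro v k Q hQ
    refine Submodule.map_pow_le _ _ k (LinearMap.eqLocus
      (ev.toLinearMap ∘ₗ (L v ^ k) ∘ₗ (SymmetricAlgebra.lift x).toLinearMap)
      ((k.factorial : ℂ) • (SymmetricAlgebra.lift (Module.Dual.eval ℂ V v)).toLinearMap))
      (fun y _ => ?_) hQ
    simp only [LinearMap.mem_eqLocus, LinearMap.comp_apply, AlgHom.toLinearMap_apply, map_prod,
      SymmetricAlgebra.lift_ι_apply, LinearMap.smul_apply, smul_eq_mul, Module.Dual.eval_apply]
    clear hQ
    induction k with
    | zero => simp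
    | succ k ih =>
      rw [Fin.prod_univ_succ, Fin.prod_univ_succ, ev_pow_succ_mul (F.leibniz v) (hx _).1, (hx _).2,
        ih (fun i => y i.succ) fun _ => trivial]
      · rw [Nat.factorial_succ]
        push_cast
        ring
      · have := Ideal.prod_mem_prod (s := Finset.univ) (I := fun _ : Fin k => RingHom.ker ev)
          (x := fun i => x (y i.succ)) fun i _ => (hx (y i.succ)).1
        simpa using this
  induction k with
  | zero => simp
  | succ k ih =>
    -- Every linear form on the dual is evaluation at some v, so pure powers of vectors are enough
    -- to detect Q.
    have h1 := ih fun P hP => h P (degreeLT_mono k.le_succ hP)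
    obtain ⟨Q, hQ, hQ'⟩ := happrox k f h1
    have h2 : Q = 0 := by
      refine SymmetricAlgebra.eq_zero_of_lift_eq_zero Q fun η => ?_
      obtain ⟨v, rfl⟩ := (Module.evalEquiv ℂ V).surjective η
      have h3 := h (ι ℂ V v ^ k) (pow_le_degreeLT k.lt_succ_self
        (Submodule.pow_mem_pow _ (Submodule.mem_map_of_mem Submodule.mem_top) k))
      rw [symmetrization_pow] at h3
      have h4 := ev_pow_eq_zero (F.leibniz v) hQ'
      rw [map_sub, map_sub, h3, heval v k Q hQ, zero_sub, neg_eq_zero] at h4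
      exact (mul_eq_zero.1 h4).resolve_left (by exact_mod_cast k.factorial_ne_zero)
    rwa [h2, map_zero, sub_zero] at hQ'

/-- Invariant differential operators are symmetrizations. -/
theorem exists_symmetrization_eq {k : ℕ} {u : Module.End ℂ A} (hu : u ∈ C) (hk : IsDiffOp k u) :
    ∃ P ∈ degreeLT ((⊤ : Submodule ℂ V).map (ι ℂ V)) (k + 1), symmetrization L P = u := by
  let evL : Module.End ℂ A →ₗ[ℂ] Module.Dual ℂ A :=
    { toFun := fun u => ev.toLinearMap ∘ₗ u
      map_add' := fun u v => by ext; simp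
      map_smul' := fun c u => by ext; simp }
  let W : Submodule ℂ (Module.Dual ℂ A) :=
    (degreeLT ((⊤ : Submodule ℂ V).map (ι ℂ V)) (k + 1)).map (evL ∘ₗ symmetrization L)
  have hfin : FiniteDimensional ℂ W := by
    refine Module.Finite.of_fg (Submodule.FG.map _ (degreeLT_fg ?_ _))
    exact Submodule.FG.map _ Module.Finite.fg_top
  -- A finite-dimensional space of functionals is the annihilator of its common kernel, so it
  -- suffices that u kills that kernel at `ev`.
  have hmem : evL u ∈ W := by
    rw [← Subspace.dualCoannihilator_dualAnnihilator_eq (W := W), Submodule.mem_dualAnnihilator]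
    intro f hf
    rw [Submodule.mem_dualCoannihilator] at hf
    exact hk.ev_eq_zero (F.mem_pow_of_symmetrization_eq_zero fun P hP =>
      hf _ (Submodule.mem_map_of_mem hP))
  obtain ⟨P, hP, hP'⟩ := hmem
  refine ⟨P, hP, sub_eq_zero.1 (F.eq_zero _ (sub_mem ?_ hu) fun f => ?_)⟩
  · obtain ⟨n, hn⟩ := SymmetricAlgebra.exists_mem_degreeLT P
    refine (?_ : degreeLT _ n ≤ (Subalgebra.toSubmodule C).comap (symmetrization L)) hn
    exact iSup₂_le fun j _ Q hQ => (symmetrization_mem (fun v => ⟨F.isDiffOp v, F.mem v⟩) hQ).2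
  · have h := LinearMap.congr_fun hP' f
    have h' : ev (symmetrization L P f) = ev (u f) := h
    rw [LinearMap.sub_apply, map_sub, h', sub_self]

end IsInvariantFrame

/-! ### Spaces of operators closed under commutators -/

section CommutatorClosed

variable {R : Type*} [Ring R] [Algebra ℂ R] {W : Submodule ℂ R}

/-- An adjacent transposition costs a product in which two factors are replaced by their commutator,
again in W. Only exponents from 1 to length - 1 occur; the absence of exponent 0 is what later
excludes constant terms. -/
theorem List.Perm.prod_sub_prod_mem (hW : ∀ a ∈ W, ∀ b ∈ W, a * b - b * a ∈ W) {l l' : List R}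
    (h : l.Perm l') (hl : ∀ x ∈ l, x ∈ W) :
    l.prod - l'.prod ∈ ⨆ (k : ℕ) (_ : k < l.length - 1), W ^ (k + 1) := by
  have hprod : ∀ l : List R, (∀ x ∈ l, x ∈ W) → l.prod ∈ W ^ l.length := by
    intro l
    induction l with
    | nil =>
      intro _
      rw [List.length_nil, pow_zero]
      exact Submodule.mem_one.2 ⟨1, by simp⟩
    | cons a l ih =>
      intro h
      rw [List.prod_cons, List.length_cons, pow_succ']
      exact Submodule.mul_mem_mul (h a (by simp)) (ih fun x hx => h x (by simp [hx]))
  induction h with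
  | nil => simp
  | @cons a l₁ l₂ h ih =>
    rw [List.prod_cons, List.prod_cons, ← mul_sub]
    have h1 := Submodule.mul_mem_mul (hl a (by simp)) (ih fun x hx => hl x (by simp [hx]))
    refine (?_ : (_ : Submodule ℂ R) ≤ _) h1
    simp only [Submodule.mul_iSup, ← pow_succ', List.length_cons]
    exact iSup₂_le fun k hk => le_iSup₂_of_le (k + 1) (by omega) le_rfl
  | swap a b l =>
    rw [List.prod_cons, List.prod_cons, List.prod_cons, List.prod_cons, ← mul_assoc, ← mul_assoc,
      ← sub_mul]
    have h1 := Submodule.mul_mem_mul (hW b (hl b (by simp)) a (hl a (by simp)))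
      (hprod l fun x hx => hl x (by simp [hx]))
    rw [← pow_succ'] at h1
    refine (?_ : (_ : Submodule ℂ R) ≤ _) h1
    exact le_iSup₂_of_le l.length (by simp) le_rfl
  | @trans l₁ l₂ l₃ h1 h2 ih1 ih2 =>
    have h3 := ih1 hl
    have h4 := ih2 fun x hx => hl x (h1.mem_iff.2 hx)
    rw [← h1.length_eq] at h4
    rw [← sub_add_sub_cancel]
    exact Submodule.add_mem _ h3 h4

variable {V : Type*} [AddCommGroup V] [Module ℂ V] (φ : V →ₗ[ℂ] R) (N : Submodule ℂ V)

theorem Submodule.map_pow_le_of_prod_ofFn (k : ℕ) (Z : Submodule ℂ R)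
    (h : ∀ y : Fin k → V, (∀ i, y i ∈ N) → (List.ofFn fun i => φ (y i)).prod ∈ Z) :
    (N.map φ) ^ k ≤ Z := by
  rw [← Submodule.span_eq (N.map φ), Submodule.span_pow, Submodule.span_le]
  intro x hx
  obtain ⟨y, rfl⟩ := Set.mem_pow.1 hx
  choose z hz hz' using fun i => (y i).2
  simp only [← hz']
  exact h z hz

theorem prod_ofFn_mem_map_pow {k : ℕ} {y : Fin k → V} (hy : ∀ i, y i ∈ N) :
    (List.ofFn fun i => φ (y i)).prod ∈ (N.map φ) ^ k := by
  rw [← Submodule.span_eq (N.map φ), Submodule.span_pow]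
  exact Submodule.subset_span
    (Set.mem_pow.2 ⟨fun i => ⟨φ (y i), Submodule.mem_map_of_mem (hy i)⟩, rfl⟩)

theorem symmetrization_mem_map_pow {k : ℕ} {P : SymmetricAlgebra ℂ V}
    (hP : P ∈ (N.map (SymmetricAlgebra.ι ℂ V)) ^ k) : symmetrization φ P ∈ (N.map φ) ^ k := by
  refine Submodule.map_pow_le _ N k (((N.map φ) ^ k).comap (symmetrization φ)) (fun y hy => ?_) hP
  rw [Submodule.mem_comap, symmetrization_prod]
  exact Submodule.smul_mem _ _ (Submodule.sum_mem _ fun σ _ =>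
    prod_ofFn_mem_map_pow φ N fun i => hy (σ i))

/-- A product is its symmetrization plus the average of its differences with the permuted products,
and these are combinations of shorter nonempty products. -/
theorem map_pow_succ_le_map_symmetrization
    (hN : ∀ a ∈ N.map φ, ∀ b ∈ N.map φ, a * b - b * a ∈ N.map φ) (n : ℕ) :
    (N.map φ) ^ (n + 1) ≤
      (⨆ i : ℕ, (N.map (SymmetricAlgebra.ι ℂ V)) ^ (i + 1)).map (symmetrization φ) := by
  induction n using Nat.strong_induction_on with
  | _ n ih =>
  refine Submodule.map_pow_le_of_prod_ofFn φ N _ _ fun y hy => ?_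
  have hfac : ((n + 1).factorial : ℂ) ≠ 0 := by exact_mod_cast (n + 1).factorial_ne_zero
  have h1 : (List.ofFn fun i => φ (y i)).prod =
      symmetrization φ (∏ i, SymmetricAlgebra.ι ℂ V (y i)) +
        ((n + 1).factorial : ℂ)⁻¹ • ∑ σ : Equiv.Perm (Fin (n + 1)),
          ((List.ofFn fun i => φ (y i)).prod - (List.ofFn fun i => φ (y (σ i))).prod) := by
    rw [symmetrization_prod, ← smul_add, ← Finset.sum_add_distrib]
    simp only [add_sub_cancel, Finset.sum_const, Finset.card_univ, Fintype.card_perm,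
      Fintype.card_fin]
    rw [← Nat.cast_smul_eq_nsmul ℂ, smul_smul, inv_mul_cancel₀ hfac, one_smul]
  rw [h1]
  refine Submodule.add_mem _ (Submodule.mem_map_of_mem (Submodule.mem_iSup_of_mem n ?_))
    (Submodule.smul_mem _ _ (Submodule.sum_mem _ fun σ _ => ?_))
  · rw [← List.prod_ofFn]
    exact prod_ofFn_mem_map_pow (SymmetricAlgebra.ι ℂ V) N hy
  · have h2 : (List.ofFn fun i => φ (y i)).Perm (List.ofFn fun i => φ (y (σ i))) :=
      (Equiv.Perm.ofFn_comp_perm σ fun i => φ (y i)).symm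
    have h3 := h2.prod_sub_prod_mem hN fun x hx => by
      obtain ⟨i, rfl⟩ := (List.mem_ofFn' _ _).1 hx
      exact Submodule.mem_map_of_mem (hy i)
    refine (?_ : (_ : Submodule ℂ R) ≤ _) h3
    refine iSup₂_le fun k hk => ih k ?_
    simpa using hk

end CommutatorClosed

section SubmodulePow

variable {R : Type*} [Ring R] [Algebra ℂ R] {W Z : Submodule ℂ R} {k : ℕ}

theorem Submodule.pow_zero_le (h : 1 ∈ Z) : W ^ 0 ≤ Z := by
  rwa [pow_zero, Submodule.one_le]

theorem Submodule.pow_succ_le (h : ∀ a ∈ W ^ k, ∀ b ∈ W, a * b ∈ Z) : W ^ (k + 1) ≤ Z := by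
  rwa [pow_succ, Submodule.mul_le]

theorem Submodule.mul_mem_pow_succ {a b : R} (ha : a ∈ W ^ k) (hb : b ∈ W) :
    a * b ∈ W ^ (k + 1) := by
  rw [pow_succ]
  exact Submodule.mul_mem_mul ha hb

end SubmodulePow

theorem Subalgebra.pow_le_of_le {R : Type*} [Ring R] [Algebra ℂ R] {S : Subalgebra ℂ R}
    {X : Submodule ℂ R} (h : X ≤ Subalgebra.toSubmodule S) (k : ℕ) :
    X ^ k ≤ Subalgebra.toSubmodule S := by
  induction k with
  | zero =>
    rw [pow_zero, Submodule.one_le]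
    exact S.one_mem
  | succ k ih =>
    rw [pow_succ, Submodule.mul_le]
    exact fun a ha b hb => S.mul_mem (ih ha) (h hb)

/-! ### Symmetrization adapted to a decomposition -/

section Ordered

open SymmetricAlgebra (ι)

variable {V : Type*} [AddCommGroup V] [Module ℂ V] {R : Type*} [Ring R] [Algebra ℂ R]

/-- The algebra homomorphism `S(V) → S(V) ⊗ S(V)` with `v ↦ p v ⊗ 1 + 1 ⊗ q v`. -/
def symCoproduct (p q : V →ₗ[ℂ] V) :
    SymmetricAlgebra ℂ V →ₐ[ℂ] SymmetricAlgebra ℂ V ⊗[ℂ] SymmetricAlgebra ℂ V :=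
  SymmetricAlgebra.lift
    ((Algebra.TensorProduct.includeLeft : SymmetricAlgebra ℂ V →ₐ[ℂ]
        SymmetricAlgebra ℂ V ⊗[ℂ] SymmetricAlgebra ℂ V).toLinearMap ∘ₗ ι ℂ V ∘ₗ p +
      (Algebra.TensorProduct.includeRight : SymmetricAlgebra ℂ V →ₐ[ℂ]
        SymmetricAlgebra ℂ V ⊗[ℂ] SymmetricAlgebra ℂ V).toLinearMap ∘ₗ ι ℂ V ∘ₗ q)

/-- For projections `p` and `q` onto complementary subspaces `M` and `N`, the linear map
on `S(V)` whose value at `a * b`, with `a` in `S(M)` and `b` in `S(N)`, is the product of the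
symmetrizations of `a` (with respect to `L`) and `b` (with respect to `φ`). -/
def orderedSymmetrization (L φ : V →ₗ[ℂ] R) (p q : V →ₗ[ℂ] V) : SymmetricAlgebra ℂ V →ₗ[ℂ] R :=
  LinearMap.mul' ℂ R ∘ₗ TensorProduct.map (symmetrization L) (symmetrization φ) ∘ₗ
    (symCoproduct p q).toLinearMap

variable {L φ : V →ₗ[ℂ] R} {p q : V →ₗ[ℂ] V} {M N : Submodule ℂ V}

/-- The homomorphism `symCoproduct p q` agrees with a ↦ a ⊗ 1 on the generators of S(M) and with b ↦
1 ⊗ b on those of S(N), hence on both subalgebras. -/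
theorem orderedSymmetrization_mul (hpM : ∀ v ∈ M, p v = v) (hqM : ∀ v ∈ M, q v = 0)
    (hpN : ∀ v ∈ N, p v = 0) (hqN : ∀ v ∈ N, q v = v) {a b : SymmetricAlgebra ℂ V}
    (ha : a ∈ ⨆ k : ℕ, (M.map (ι ℂ V)) ^ k) (hb : b ∈ ⨆ k : ℕ, (N.map (ι ℂ V)) ^ k) :
    orderedSymmetrization L φ p q (a * b) = symmetrization L a * symmetrization φ b := by
  have h1 : symCoproduct p q a = a ⊗ₜ 1 := by
    refine (?_ : _ ≤ Subalgebra.toSubmodule (AlgHom.equalizer (symCoproduct p q)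
      Algebra.TensorProduct.includeLeft)) ha
    refine iSup_le fun k => Subalgebra.pow_le_of_le ?_ k
    rintro _ ⟨v, hv, rfl⟩
    simp [AlgHom.mem_equalizer, symCoproduct, hpM v hv, hqM v hv]
  have h2 : symCoproduct p q b = 1 ⊗ₜ b := by
    refine (?_ : _ ≤ Subalgebra.toSubmodule (AlgHom.equalizer (symCoproduct p q)
      Algebra.TensorProduct.includeRight)) hb
    refine iSup_le fun k => Subalgebra.pow_le_of_le ?_ k
    rintro _ ⟨v, hv, rfl⟩
    simp [AlgHom.mem_equalizer, symCoproduct, hpN v hv, hqN v hv]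
  simp [orderedSymmetrization, h1, h2]

theorem symmetrization_one : symmetrization φ (1 : SymmetricAlgebra ℂ V) = 1 := by
  simpa using symmetrization_prod φ 0 finZeroElim

end Ordered

/-! ### The decomposition of a filtered algebra -/

section FilteredDecomposition

open SymmetricAlgebra (ι)

variable {V : Type*} [AddCommGroup V] [Module ℂ V] {R : Type*} [Ring R] [Algebra ℂ R]
  {L φ : V →ₗ[ℂ] R} {p q : V →ₗ[ℂ] V} {M N : Submodule ℂ V}

theorem map_ι_top_pow_le (hMN : M ⊔ N = ⊤) (k : ℕ) (Z : Submodule ℂ (SymmetricAlgebra ℂ V))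
    (h : ∀ i j, i + j = k → ∀ a ∈ (M.map (ι ℂ V)) ^ i, ∀ b ∈ (N.map (ι ℂ V)) ^ j, a * b ∈ Z) :
    ((⊤ : Submodule ℂ V).map (ι ℂ V)) ^ k ≤ Z := by
  rw [← hMN, Submodule.map_sup]
  refine (sup_pow_le _ _ k).trans (iSup_le fun i => iSup₂_le fun j hij => ?_)
  exact Submodule.mul_le.2 (h i j hij)

/-- A filtered algebra all of whose elements are symmetrizations decomposes with respect to the
left ideal generated by the image of `N`, if this image is closed under commutators and if the
symmetrization adapted to `V = M ⊕ N` is injective. -/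
theorem filtered_decomposition (hMN : M ⊔ N = ⊤) (hpM : ∀ v ∈ M, p v = v) (hqM : ∀ v ∈ M, q v = 0)
    (hpN : ∀ v ∈ N, p v = 0) (hqN : ∀ v ∈ N, q v = v)
    (Ord : ℕ → Submodule ℂ R)
    (hone : 1 ∈ Ord 0) (hmul : ∀ i j, ∀ u ∈ Ord i, ∀ v ∈ Ord j, u * v ∈ Ord (i + j))
    (hL : ∀ k, ∀ P ∈ ((⊤ : Submodule ℂ V).map (ι ℂ V)) ^ k, symmetrization L P ∈ Ord k)
    (hφ : ∀ v, φ v ∈ Ord 1)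
    (hgen : ∀ k, Ord k ≤ (degreeLT ((⊤ : Submodule ℂ V).map (ι ℂ V)) (k + 1)).map
      (symmetrization L))
    (hinj : Function.Injective (orderedSymmetrization L φ p q))
    (hmap : ∀ n, (degreeLT ((⊤ : Submodule ℂ V).map (ι ℂ V)) n).map
      (orderedSymmetrization L φ p q) =
        (degreeLT ((⊤ : Submodule ℂ V).map (ι ℂ V)) n).map (symmetrization L))
    {W : Submodule ℂ R} (hW : W = N.map φ) (hWW : ∀ a ∈ W, ∀ b ∈ W, a * b - b * a ∈ W)
    {D : Submodule ℂ R} (hD : ∀ u, u ∈ D ↔ ∃ k, u ∈ Ord k) :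
    (∀ m : ℕ,
      (degreeLT ((⊤ : Submodule ℂ V).map (ι ℂ V)) (m + 1)).map (symmetrization L) =
        (degreeLT ((⊤ : Submodule ℂ V).map (ι ℂ V)) m).map (symmetrization L) * W ⊔
          (degreeLT (M.map (ι ℂ V)) (m + 1)).map (symmetrization L) ∧
      Disjoint ((degreeLT ((⊤ : Submodule ℂ V).map (ι ℂ V)) m).map (symmetrization L) * W)
        ((degreeLT (M.map (ι ℂ V)) (m + 1)).map (symmetrization L))) ∧
    (D = D * W ⊔ (⨆ k : ℕ, (M.map (ι ℂ V)) ^ k).map (symmetrization L) ∧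
      Disjoint (D * W) ((⨆ k : ℕ, (M.map (ι ℂ V)) ^ k).map (symmetrization L))) := by
  set T := (⊤ : Submodule ℂ V).map (ι ℂ V)
  set Θ := orderedSymmetrization L φ p q
  have hMle : ∀ k, (M.map (ι ℂ V)) ^ k ≤ ⨆ k : ℕ, (M.map (ι ℂ V)) ^ k := fun k => le_iSup _ k
  have hNle : ∀ k, (N.map (ι ℂ V)) ^ k ≤ ⨆ k : ℕ, (N.map (ι ℂ V)) ^ k := fun k => le_iSup _ k
  have hΘ : ∀ {a b}, a ∈ ⨆ k : ℕ, (M.map (ι ℂ V)) ^ k → b ∈ ⨆ k : ℕ, (N.map (ι ℂ V)) ^ k →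
      Θ (a * b) = symmetrization L a * symmetrization φ b :=
    fun ha hb => orderedSymmetrization_mul hpM hqM hpN hqN ha hb
  have hΘM : ∀ a ∈ ⨆ k : ℕ, (M.map (ι ℂ V)) ^ k, Θ a = symmetrization L a := fun a ha => by
    have h := hΘ ha (hNle 0 (by simp : (1 : SymmetricAlgebra ℂ V) ∈ _))
    rwa [mul_one, symmetrization_one, mul_one] at h
  have hTk : ∀ (k : ℕ) (Z : Submodule ℂ (SymmetricAlgebra ℂ V)),
      (∀ i j, i + j = k → ∀ a ∈ (M.map (ι ℂ V)) ^ i, ∀ b ∈ (N.map (ι ℂ V)) ^ j, a * b ∈ Z) →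
      T ^ k ≤ Z := map_ι_top_pow_le hMN
  have hMT : M.map (ι ℂ V) ≤ T := Submodule.map_mono le_top
  have hW1 : ∀ w ∈ W, w ∈ Ord 1 := by
    rw [hW]
    rintro _ ⟨v, -, rfl⟩
    exact hφ v
  have hWk : ∀ k, W ^ k ≤ Ord k := by
    intro k
    induction k with
    | zero => exact Submodule.pow_zero_le hone
    | succ k ih => exact Submodule.pow_succ_le fun a ha b hb => hmul _ _ _ (ih ha) _ (hW1 b hb)
  have hsD : ∀ n, (degreeLT T n).map (symmetrization L) ≤ D := fun n => by
    rw [Submodule.map_le_iff_le_comap]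
    exact iSup₂_le fun k _ P hP => (hD _).2 ⟨k, hL k P hP⟩
  have hDtop : ∀ u ∈ D, ∃ P, Θ P = u := by
    intro u hu
    obtain ⟨k, hk⟩ := (hD u).1 hu
    have h1 := hgen k hk
    rw [← hmap] at h1
    obtain ⟨P, -, hP⟩ := h1
    exact ⟨P, hP⟩
  -- π restricts polynomials to the M-variables: it fixes S(M) and kills every product with a factor
  -- in N. Directness follows once D * W lies in Θ (ker π).
  let π : SymmetricAlgebra ℂ V →ₐ[ℂ] SymmetricAlgebra ℂ V := SymmetricAlgebra.lift (ι ℂ V ∘ₗ p)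
  have hπM : ∀ a ∈ ⨆ k : ℕ, (M.map (ι ℂ V)) ^ k, π a = a := by
    intro a ha
    refine (?_ : _ ≤ Subalgebra.toSubmodule (AlgHom.equalizer π (AlgHom.id ℂ _))) ha
    refine iSup_le fun k => Subalgebra.pow_le_of_le ?_ k
    rintro _ ⟨v, hv, rfl⟩
    simp [AlgHom.mem_equalizer, π, hpM v hv]
  have hπN : ∀ b ∈ ⨆ k : ℕ, (N.map (ι ℂ V)) ^ (k + 1), π b = 0 := by
    intro b hb
    refine (?_ : _ ≤ LinearMap.ker π.toLinearMap) hb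
    refine iSup_le fun k => ?_
    rw [pow_succ, Submodule.mul_le]
    rintro a - _ ⟨v, hv, rfl⟩
    simp [π, hpN v hv]
  have hDW : D * W ≤ (LinearMap.ker π.toLinearMap).map Θ := by
    rw [Submodule.mul_le]
    intro d hd w hw
    obtain ⟨P, rfl⟩ := hDtop d hd
    obtain ⟨n, hn⟩ := SymmetricAlgebra.exists_mem_degreeLT P
    refine (?_ : degreeLT T n ≤ (((LinearMap.ker π.toLinearMap).map Θ).comap
      (LinearMap.mulRight ℂ w)).comap Θ) hn
    refine iSup₂_le fun k _ => hTk k _ fun i j _ a ha b hb => ?_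
    rw [Submodule.mem_comap, Submodule.mem_comap, LinearMap.mulRight_apply,
      hΘ (hMle i ha) (hNle j hb), mul_assoc]
    -- The factor w raises the exponent to at least 1, so closure under commutators rewrites this
    -- product as the symmetrization of a polynomial over N without constant term, which π kills.
    have h1 : symmetrization φ b * w ∈ (N.map φ) ^ (j + 1) :=
      Submodule.mul_mem_pow_succ (symmetrization_mem_map_pow φ N hb) (hW ▸ hw)
    obtain ⟨b', hb', h2⟩ := map_pow_succ_le_map_symmetrization φ N (hW ▸ hWW) j h1
    rw [← h2, ← hΘ (hMle i ha) ((iSup_le fun k => hNle (k + 1)) hb')]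
    refine Submodule.mem_map_of_mem ?_
    simp [hπN b' hb']
  have hdisj : Disjoint (D * W) ((⨆ k : ℕ, (M.map (ι ℂ V)) ^ k).map (symmetrization L)) := by
    rw [Submodule.disjoint_def]
    rintro _ hx ⟨Q, hQ, rfl⟩
    obtain ⟨P, hP, hPQ⟩ := hDW hx
    rw [← hΘM Q hQ] at hPQ
    have h1 := hinj hPQ
    have h2 : Q = 0 := by
      rw [← hπM Q hQ, ← h1]
      exact hP
    rw [h2, map_zero]
  have hMlt : ∀ n, degreeLT (M.map (ι ℂ V)) n ≤ ⨆ k : ℕ, (M.map (ι ℂ V)) ^ k := fun n =>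
    iSup₂_le fun k _ => hMle k
  have hsum : ∀ m : ℕ, (degreeLT T (m + 1)).map (symmetrization L) =
      (degreeLT T m).map (symmetrization L) * W ⊔
        (degreeLT (M.map (ι ℂ V)) (m + 1)).map (symmetrization L) := by
    intro m
    refine le_antisymm ?_ (sup_le ?_ (Submodule.map_mono (degreeLT_le_of_le hMT _)))
    · rw [← hmap, Submodule.map_le_iff_le_comap]
      refine iSup₂_le fun k hk => hTk k _ fun i j hij a ha b hb => ?_
      rw [Submodule.mem_comap]
      -- Degree 0 in N gives the S(M) summand. In degree j + 1 one factor of W is split off on the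
      -- right; what remains has order at most i + j < m.
      cases j with
      | zero =>
        obtain ⟨c, rfl⟩ := Submodule.mem_one.1 ((pow_zero (N.map (ι ℂ V))) ▸ hb)
        rw [mul_comm, ← Algebra.smul_def, map_smul, hΘM a (hMle i ha)]
        exact Submodule.smul_mem _ _ (Submodule.mem_sup_right
          (Submodule.mem_map_of_mem (pow_le_degreeLT (by omega) ha)))
      | succ j =>
        rw [hΘ (hMle i ha) (hNle _ hb)]
        refine Submodule.mem_sup_left ?_
        have h1 := symmetrization_mem_map_pow φ N hb
        rw [← hW] at h1
        refine (?_ : W ^ (j + 1) ≤ ((degreeLT T m).map (symmetrization L) * W).comap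
          (LinearMap.mulLeft ℂ (symmetrization L a))) h1
        refine Submodule.pow_succ_le fun y hy w hw => ?_
        rw [Submodule.mem_comap, LinearMap.mulLeft_apply, ← mul_assoc]
        refine Submodule.mul_mem_mul ?_ hw
        exact Submodule.map_mono (degreeLT_mono (by omega))
          (hgen (i + j) (hmul _ _ _ (hL i a (pow_le_pow_left' hMT i ha)) _ (hWk j hy)))
    · rw [Submodule.mul_le]
      rintro _ ⟨P, hP, rfl⟩ w hw
      refine (?_ : degreeLT T m ≤ (((degreeLT T (m + 1)).map (symmetrization L)).comap
        (LinearMap.mulRight ℂ w)).comap (symmetrization L)) hP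
      refine iSup₂_le fun k hk Q hQ => ?_
      exact Submodule.map_mono (degreeLT_mono (by omega))
        (hgen (k + 1) (hmul _ _ _ (hL k Q hQ) _ (hW1 w hw)))
  refine ⟨fun m => ⟨hsum m, ?_⟩, ?_, hdisj⟩
  · exact hdisj.mono (mul_le_mul' (hsD m) le_rfl) (Submodule.map_mono (hMlt _))
  · refine le_antisymm (fun u hu => ?_) (sup_le ?_ ?_)
    · obtain ⟨k, hk⟩ := (hD u).1 hu
      have h1 := hgen k hk
      rw [hsum k] at h1
      exact sup_le_sup (mul_le_mul' (hsD k) le_rfl) (Submodule.map_mono (hMlt _)) h1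
    · rw [Submodule.mul_le]
      intro d hd w hw
      obtain ⟨k, hk⟩ := (hD d).1 hd
      exact (hD _).2 ⟨k + 1, hmul _ _ _ hk _ (hW1 w hw)⟩
    · rw [Submodule.map_le_iff_le_comap]
      refine iSup_le fun k => ?_
      rw [← Submodule.map_le_iff_le_comap]
      exact (Submodule.map_mono ((pow_le_pow_left' hMT k).trans
        (pow_le_degreeLT k.lt_succ_self))).trans (hsD (k + 1))

end FilteredDecomposition

/-! ### Comparing symmetrizations through their symbols -/

section SymbolKernel

variable {A : Type*} [CommRing A] [Algebra ℂ A] (ev : A →ₐ[ℂ] ℂ) (f : A)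

/-- The operators with vanishing symbol of degree `n`. -/
def symbolKernel (n : ℕ) : Submodule ℂ (Module.End ℂ A) where
  carrier := {u | HasSymbol ev f u n 0}
  add_mem' ha hb := by simpa only [Set.mem_ofPred_eq, add_zero] using ha.add hb
  zero_mem' := HasSymbol.zero n
  smul_mem' c a ha := by simpa only [Set.mem_ofPred_eq, mul_zero] using ha.smul c

end SymbolKernel

/-- The linear map `Ψ` assigns to each polynomial an operator with this polynomial as symbol. -/
def PreservesSymbol {A V : Type*} [CommRing A] [Algebra ℂ A] [AddCommGroup V] [Module ℂ V]
    (ev : A →ₐ[ℂ] ℂ) (L : V →ₗ[ℂ] Module.End ℂ A)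
    (Ψ : SymmetricAlgebra ℂ V →ₗ[ℂ] Module.End ℂ A) : Prop :=
  ∀ f, ev f = 0 → ∀ ξ : Module.Dual ℂ V, (∀ v, ev (L v f) = ξ v) → ∀ (k : ℕ),
    ∀ P ∈ ((⊤ : Submodule ℂ V).map (SymmetricAlgebra.ι ℂ V)) ^ k,
      HasSymbol ev f (Ψ P) k (SymmetricAlgebra.lift ξ P)

namespace IsInvariantFrame

open SymmetricAlgebra (ι)

variable {A V : Type*} [CommRing A] [Algebra ℂ A] [AddCommGroup V] [Module ℂ V]
  {ev : A →ₐ[ℂ] ℂ} {L : V →ₗ[ℂ] Module.End ℂ A} {C : Subalgebra ℂ (Module.End ℂ A)}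
  (F : IsInvariantFrame ev L C)
include F

theorem preservesSymbol_symmetrization : PreservesSymbol ev L (symmetrization L) := by
  intro f hf ξ hξ k P hP
  exact hasSymbol_symmetrization (fun v => hξ v ▸ F.hasSymbol hf v) hP

/-- The shift by χ v has order 0 and so does not affect the symbol of degree 1; the rest is
multiplicativity of symbols. -/
theorem preservesSymbol_orderedSymmetrization {p q : V →ₗ[ℂ] V} {M N : Submodule ℂ V}
    (χ : V →ₗ[ℂ] ℂ) (hMN : M ⊔ N = ⊤) (hpM : ∀ v ∈ M, p v = v) (hqM : ∀ v ∈ M, q v = 0)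
    (hpN : ∀ v ∈ N, p v = 0) (hqN : ∀ v ∈ N, q v = v) :
    PreservesSymbol ev L (orderedSymmetrization L (L + χ.smulRight 1) p q) := by
  intro f hf ξ hξ k P hP
  have h1 : ∀ v, HasSymbol ev f (L v) 1 (ξ v) := fun v => hξ v ▸ F.hasSymbol hf v
  have h2 : ∀ v, HasSymbol ev f ((L + χ.smulRight 1 : V →ₗ[ℂ] Module.End ℂ A) v) 1 (ξ v) := fun v => by
    simpa using (h1 v).add ((HasSymbol.one.succ hf).smul (χ v))
  refine map_ι_top_pow_le hMN k
    { carrier := {P | HasSymbol ev f (orderedSymmetrization L (L + χ.smulRight 1) p q P) k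
        (SymmetricAlgebra.lift ξ P)}
      add_mem' := fun {a b} ha hb => by
        simpa only [Set.mem_ofPred_eq, map_add] using ha.add hb
      zero_mem' := by simpa only [Set.mem_ofPred_eq, map_zero] using HasSymbol.zero k
      smul_mem' := fun c a ha => by
        simpa only [Set.mem_ofPred_eq, map_smul, smul_eq_mul] using ha.smul c }
    (fun i j hij a ha b hb => ?_) hP
  change HasSymbol ev f (orderedSymmetrization _ _ p q (a * b)) k (SymmetricAlgebra.lift ξ (a * b))
  rw [orderedSymmetrization_mul hpM hqM hpN hqN (Submodule.mem_iSup_of_mem i ha)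
    (Submodule.mem_iSup_of_mem j hb), map_mul, ← hij]
  exact (hasSymbol_symmetrization h1 ha).mul (hasSymbol_symmetrization h2 hb)

/-- Lower-degree terms have zero symbol of degree n, so the symbol of Ψ P is the value at ξ of the
part of degree n. Since every ξ is the differential of some f, that part vanishes. -/
theorem mem_degreeLT_of_hasSymbol {Ψ : SymmetricAlgebra ℂ V →ₗ[ℂ] Module.End ℂ A}
    (hΨ : PreservesSymbol ev L Ψ) {n : ℕ} {P : SymmetricAlgebra ℂ V}
    (hP : P ∈ degreeLT ((⊤ : Submodule ℂ V).map (ι ℂ V)) (n + 1))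
    (h : ∀ f, ev f = 0 → HasSymbol ev f (Ψ P) n 0) :
    P ∈ degreeLT ((⊤ : Submodule ℂ V).map (ι ℂ V)) n := by
  rw [degreeLT_succ] at hP
  obtain ⟨a, ha, b, hb, rfl⟩ := Submodule.mem_sup.1 hP
  have hb0 : b = 0 := by
    refine SymmetricAlgebra.eq_zero_of_lift_eq_zero b fun ξ => ?_
    obtain ⟨f, hf, hξ⟩ := F.exists_dual ξ
    have h1 : HasSymbol ev f (Ψ a) n 0 := by
      refine (?_ : _ ≤ (symbolKernel ev f n).comap Ψ) ha
      exact iSup₂_le fun k hk Q hQ => (hΨ f hf ξ hξ k Q hQ).of_lt hf hk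
    have h2 := h1.add (hΨ f hf ξ hξ n b hb)
    rw [← map_add, zero_add] at h2
    exact h2.unique (h f hf)
  rwa [hb0, add_zero]

theorem injective_of_preservesSymbol {Ψ : SymmetricAlgebra ℂ V →ₗ[ℂ] Module.End ℂ A}
    (hΨ : PreservesSymbol ev L Ψ) : Function.Injective Ψ := by
  rw [injective_iff_map_eq_zero]
  intro P hP
  obtain ⟨n, hn⟩ := SymmetricAlgebra.exists_mem_degreeLT P
  induction n with
  | zero => simpa [degreeLT_zero] using hn
  | succ n ih =>
    exact ih (F.mem_degreeLT_of_hasSymbol hΨ hn fun f _ => hP ▸ HasSymbol.zero n)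

variable [FiniteDimensional ℂ V]

theorem inf_le_map_degreeLT (k : ℕ) :
    diffOpsLE A k ⊓ Subalgebra.toSubmodule C ≤
      (degreeLT ((⊤ : Submodule ℂ V).map (ι ℂ V)) (k + 1)).map (symmetrization L) := by
  rintro u ⟨h1, h2⟩
  exact F.exists_symmetrization_eq h2 h1

/-- One inclusion holds because operators of order k are symmetrizations of degree at most k.
Conversely, on a homogeneous P of degree n the two maps differ by some λ(P') with zero symbol of
degree n, so P' has degree less than n and induction applies. -/
theorem map_degreeLT_eq {Ψ : SymmetricAlgebra ℂ V →ₗ[ℂ] Module.End ℂ A}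
    (hΨ : PreservesSymbol ev L Ψ)
    (hΨ' : ∀ k, ∀ P ∈ ((⊤ : Submodule ℂ V).map (ι ℂ V)) ^ k,
      Ψ P ∈ diffOpsLE A k ⊓ Subalgebra.toSubmodule C) (n : ℕ) :
    (degreeLT ((⊤ : Submodule ℂ V).map (ι ℂ V)) n).map Ψ =
      (degreeLT ((⊤ : Submodule ℂ V).map (ι ℂ V)) n).map (symmetrization L) := by
  have hle : ∀ n, (degreeLT ((⊤ : Submodule ℂ V).map (ι ℂ V)) n).map Ψ ≤
      (degreeLT ((⊤ : Submodule ℂ V).map (ι ℂ V)) n).map (symmetrization L) := fun n => by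
    rw [Submodule.map_le_iff_le_comap]
    exact iSup₂_le fun k hk P hP =>
      Submodule.map_mono (degreeLT_mono hk) (F.inf_le_map_degreeLT k (hΨ' k P hP))
  refine le_antisymm (hle n) ?_
  induction n with
  | zero => simp [degreeLT_zero]
  | succ n ih =>
    rw [degreeLT_succ, Submodule.map_sup, Submodule.map_sup]
    refine sup_le (ih.trans le_sup_left) ?_
    rintro _ ⟨P, hP, rfl⟩
    have h1 : symmetrization L P - Ψ P ∈ diffOpsLE A n ⊓ Subalgebra.toSubmodule C :=
      Submodule.sub_mem _ (symmetrization_mem (fun v => ⟨F.isDiffOp v, F.mem v⟩) hP)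
        (hΨ' n P hP)
    obtain ⟨P', hP', h2⟩ := F.inf_le_map_degreeLT n h1
    have h3 : P' ∈ degreeLT ((⊤ : Submodule ℂ V).map (ι ℂ V)) n := by
      refine F.mem_degreeLT_of_hasSymbol F.preservesSymbol_symmetrization hP' fun f hf => ?_
      let ξ : Module.Dual ℂ V :=
        { toFun := fun v => ev (L v f)
          map_add' := fun v w => by simp
          map_smul' := fun c v => by simp }
      have h4 := (F.preservesSymbol_symmetrization f hf ξ (fun _ => rfl) n P hP).sub
        (hΨ f hf ξ (fun _ => rfl) n P hP)
      rwa [sub_self, ← h2] at h4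
    rw [← sub_add_cancel (symmetrization L P) (Ψ P)]
    exact Submodule.add_mem_sup (ih (h2 ▸ Submodule.mem_map_of_mem h3))
      (Submodule.mem_map_of_mem hP)

/-- The decomposition of the algebra of invariant differential operators, with respect to
complementary subspaces `M`, `N` of `V` and a linear form `χ` for which the space of the
operators `L v + χ v`, for `v` in `N`, is closed under commutators. -/
theorem decomposition {M N : Submodule ℂ V} (hMN : IsCompl M N) (χ : V →ₗ[ℂ] ℂ)
    {W : Submodule ℂ (Module.End ℂ A)} (hW : W = N.map (L + χ.smulRight 1))
    (hWW : ∀ a ∈ W, ∀ b ∈ W, a * b - b * a ∈ W)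
    {D : Submodule ℂ (Module.End ℂ A)} (hD : ∀ u, u ∈ D ↔ (∃ k, IsDiffOp k u) ∧ u ∈ C) :
    (∀ m : ℕ,
      (degreeLT ((⊤ : Submodule ℂ V).map (ι ℂ V)) (m + 1)).map (symmetrization L) =
        (degreeLT ((⊤ : Submodule ℂ V).map (ι ℂ V)) m).map (symmetrization L) * W ⊔
          (degreeLT (M.map (ι ℂ V)) (m + 1)).map (symmetrization L) ∧
      Disjoint ((degreeLT ((⊤ : Submodule ℂ V).map (ι ℂ V)) m).map (symmetrization L) * W)
        ((degreeLT (M.map (ι ℂ V)) (m + 1)).map (symmetrization L))) ∧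
    (D = D * W ⊔ (⨆ k : ℕ, (M.map (ι ℂ V)) ^ k).map (symmetrization L) ∧
      Disjoint (D * W) ((⨆ k : ℕ, (M.map (ι ℂ V)) ^ k).map (symmetrization L))) := by
  have hφ1 : ∀ v, IsDiffOp 1 ((L + χ.smulRight 1 : V →ₗ[ℂ] Module.End ℂ A) v) ∧
      (L + χ.smulRight 1 : V →ₗ[ℂ] Module.End ℂ A) v ∈ C := fun v => by
    refine ⟨(F.isDiffOp v).add ?_, C.add_mem (F.mem v) (C.smul_mem C.one_mem _)⟩
    exact IsDiffOp.smul (IsDiffOp.mono zero_le_one ⟨1, by ext; simp⟩) _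
  have hL1 : ∀ v, IsDiffOp 1 (L v) ∧ L v ∈ C := fun v => ⟨F.isDiffOp v, F.mem v⟩
  let p : V →ₗ[ℂ] V := M.subtype ∘ₗ M.projectionOnto N hMN
  let q : V →ₗ[ℂ] V := LinearMap.id - p
  have hpM : ∀ v ∈ M, p v = v := fun v hv => by
    simpa [p] using congrArg Subtype.val (Submodule.projectionOnto_apply_left hMN ⟨v, hv⟩)
  have hpN : ∀ v ∈ N, p v = 0 := fun v hv => by
    simpa [p] using hv
  have hqM : ∀ v ∈ M, q v = 0 := fun v hv => by simp [q, hpM v hv]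
  have hqN : ∀ v ∈ N, q v = v := fun v hv => by simp [q, hpN v hv]
  have hmul : ∀ i j, ∀ u ∈ diffOpsLE A i ⊓ Subalgebra.toSubmodule C,
      ∀ v ∈ diffOpsLE A j ⊓ Subalgebra.toSubmodule C,
      u * v ∈ diffOpsLE A (i + j) ⊓ Subalgebra.toSubmodule C :=
    fun i j u hu v hv => ⟨IsDiffOp.mul hu.1 hv.1, C.mul_mem hu.2 hv.2⟩
  have hsymb := F.preservesSymbol_orderedSymmetrization χ hMN.sup_eq_top hpM hqM hpN hqN
  refine filtered_decomposition hMN.sup_eq_top hpM hqM hpN hqN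
    (fun k => diffOpsLE A k ⊓ Subalgebra.toSubmodule C) ⟨⟨1, by ext; simp⟩, C.one_mem⟩ hmul
    (fun k P hP => symmetrization_mem hL1 hP) hφ1 F.inf_le_map_degreeLT
    (F.injective_of_preservesSymbol hsymb) (F.map_degreeLT_eq hsymb fun k P hP => ?_) hW hWW
    fun u => ?_
  · refine map_ι_top_pow_le hMN.sup_eq_top k ((diffOpsLE A k ⊓ Subalgebra.toSubmodule C).comap
      (orderedSymmetrization L (L + χ.smulRight 1) p q)) (fun i j hij a ha b hb => ?_) hP
    rw [Submodule.mem_comap, orderedSymmetrization_mul hpM hqM hpN hqN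
      (Submodule.mem_iSup_of_mem i ha) (Submodule.mem_iSup_of_mem j hb), ← hij]
    exact hmul _ _ _ (symmetrization_mem hL1 ha) _ (symmetrization_mem hφ1 hb)
  · rw [hD]
    exact ⟨fun ⟨⟨k, hk⟩, hu⟩ => ⟨k, hk, hu⟩, fun ⟨k, hk, hu⟩ => ⟨⟨k, hk⟩, hu⟩⟩

end IsInvariantFrame

/-! ### Hadamard's lemma -/

section Hadamard

variable {E : Type*} [NormedAddCommGroup E] [NormedSpace ℝ E]
  {F : Type*} [NormedAddCommGroup F] [NormedSpace ℝ F]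

-- The integral is the value at 0 of the convolution of the indicator of (0, 1] with s ↦ β(-s) g(x,
-- -s). The bump β is 1 on [-1, 1], so it changes nothing there, and it supplies the compact support
-- needed for smoothness in the parameter.
open MeasureTheory Convolution in
theorem ContDiff.parametric_intervalIntegral_zero_one {g : E → ℝ → F}
    (hg : ContDiff ℝ ∞ (Function.uncurry g)) :
    ContDiff ℝ ∞ fun x => ∫ t in (0 : ℝ)..1, g x t := by
  let β : ContDiffBump (0 : ℝ) := ⟨1, 2, one_pos, one_lt_two⟩
  let k : E → ℝ → F := fun x s => β (-s) • g x (-s)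
  have hk : ContDiff ℝ ∞ (Function.HasUncurry.uncurry k) := by
    have h1 : ContDiff ℝ ∞ fun p : E × ℝ => β (-p.2) := β.contDiff.comp contDiff_snd.neg
    have h2 : ContDiff ℝ ∞ fun p : E × ℝ => g p.1 (-p.2) :=
      hg.comp (contDiff_fst.prodMk contDiff_snd.neg)
    exact h1.smul h2
  have hf : LocallyIntegrable (Set.indicator (Set.Ioc (0 : ℝ) 1) fun _ => (1 : ℝ)) volume :=
    ((integrable_indicator_iff measurableSet_Ioc).2 (by simp)).locallyIntegrable
  have hsupp : ∀ (p : E) (x : ℝ), p ∈ Set.univ → x ∉ Metric.closedBall (0 : ℝ) 2 → k p x = 0 := by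
    intro p x _ hx
    have : β (-x) = 0 := β.zero_of_le_dist (by
      rw [Metric.mem_closedBall, not_le] at hx
      simpa using hx.le)
    simp [k, this]
  have h := contDiffOn_convolution_right_with_param (n := ⊤) (ContinuousLinearMap.lsmul ℝ ℝ)
    isOpen_univ (isCompact_closedBall (0 : ℝ) 2) hsupp hf hk.contDiffOn
  rw [Set.univ_prod_univ, contDiffOn_univ] at h
  have h3 := h.comp (contDiff_id.prodMk (contDiff_const (c := (0 : ℝ))))
  convert! h3 using 2 with x
  rw [intervalIntegral.integral_of_le zero_le_one, ← integral_indicator measurableSet_Ioc]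
  refine integral_congr_ae (Filter.Eventually.of_forall fun t => ?_)
  by_cases ht : t ∈ Set.Ioc (0 : ℝ) 1
  · have : β t = 1 := β.one_of_mem_closedBall (by
      simp only [β, Metric.mem_closedBall, Real.dist_eq, sub_zero]
      exact abs_le.2 ⟨by linarith [ht.1], ht.2⟩)
    simp [k, ht, this]
  · simp [ht]

theorem ContDiff.exists_hadamard [CompleteSpace F] {f : E → F} (hf : ContDiff ℝ ∞ f) (c : E) :
    ∃ g : E → E →L[ℝ] F, ContDiff ℝ ∞ g ∧ g c = fderiv ℝ f c ∧
      ∀ x, f x = f c + g x (x - c) := by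
  have hdf : ContDiff ℝ ∞ (fderiv ℝ f) := hf.fderiv_right (by simp)
  refine ⟨fun x => ∫ t in (0 : ℝ)..1, fderiv ℝ f (c + t • (x - c)), ?_, by simp, fun x => ?_⟩
  · exact ContDiff.parametric_intervalIntegral_zero_one
      (g := fun (x : E) (t : ℝ) => fderiv ℝ f (c + t • (x - c)))
      (hdf.comp (contDiff_const.add (contDiff_snd.smul (contDiff_fst.sub contDiff_const))))
  · have hcont : Continuous fun t : ℝ => fderiv ℝ f (c + t • (x - c)) :=
      hdf.continuous.comp (by fun_prop)
    rw [ContinuousLinearMap.intervalIntegral_apply (hcont.intervalIntegrable _ _),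
      intervalIntegral.integral_eq_sub_of_hasDerivAt (f := fun t : ℝ => f (c + t • (x - c)))]
    · simp
    · intro t _
      have h1 : HasDerivAt (fun t : ℝ => c + t • (x - c)) (x - c) t := by
        simpa using ((hasDerivAt_id t).smul_const (x - c)).const_add c
      exact ((hf.differentiable (by simp)) _).hasFDerivAt.comp_hasDerivAt t h1
    · exact (hcont.clm_apply continuous_const).intervalIntegrable _ _

end Hadamard

/-! ### Left invariant vector fields satisfy the abstract axioms -/

section LieGroupFrame

open Filter Topology

variable {E : Type*} [NormedAddCommGroup E] [NormedSpace ℝ E]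
  {G : Type*} [TopologicalSpace G] [ChartedSpace E G]

theorem leftInvariantDeriv_apply [Group G] [LieGroup 𝓘(ℝ, E) ∞ G]
    (X : GroupLieAlgebra 𝓘(ℝ, E) G) (f : smoothFunctions E G) (g : G) :
    (leftInvariantDeriv X f).1 g =
      (mfderiv 𝓘(ℝ, E) 𝓘(ℝ, ℂ) f.1 g (mulInvariantVectorField X g) : ℂ) := rfl

theorem leftInvariantDeriv_mul [Group G] [LieGroup 𝓘(ℝ, E) ∞ G]
    (X : GroupLieAlgebra 𝓘(ℝ, E) G) (a b : smoothFunctions E G) :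
    leftInvariantDeriv X (a * b) = a * leftInvariantDeriv X b + b * leftInvariantDeriv X a := by
  ext g
  have h := ((smoothFunctions_mdifferentiableAt a g).hasMFDerivAt.mul
    (smoothFunctions_mdifferentiableAt b g).hasMFDerivAt).mfderiv
  exact congrArg (fun L => (L (mulInvariantVectorField X g) : ℂ)) h

theorem mulInvariantVectorField_one [Group G] [LieGroup 𝓘(ℝ, E) ∞ G]
    (X : GroupLieAlgebra 𝓘(ℝ, E) G) : mulInvariantVectorField X (1 : G) = X := by
  have h : HasMFDerivAt 𝓘(ℝ, E) 𝓘(ℝ, E) (fun g : G => 1 * g) 1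
      (ContinuousLinearMap.id ℝ (TangentSpace 𝓘(ℝ, E) (1 : G))) :=
    (hasMFDerivAt_id (1 : G)).congr_of_eventuallyEq
      (Filter.Eventually.of_forall fun g => one_mul g)
  exact congrArg (fun L => L X) h.mfderiv

theorem hasMFDerivAt_mul_left [Group G] [LieGroup 𝓘(ℝ, E) ∞ G] (g x : G) :
    HasMFDerivAt 𝓘(ℝ, E) 𝓘(ℝ, E) (fun y => g * y) x (mfderiv 𝓘(ℝ, E) 𝓘(ℝ, E) (fun y => g * y) x) :=
  ((contMDiff_mul_left (I := 𝓘(ℝ, E)) (n := ∞) (a := g)).mdifferentiable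
    (by simp) x).hasMFDerivAt

theorem mfderiv_mul_left_mulInvariantVectorField [Group G] [LieGroup 𝓘(ℝ, E) ∞ G]
    (X : GroupLieAlgebra 𝓘(ℝ, E) G) (g x : G) :
    mfderiv 𝓘(ℝ, E) 𝓘(ℝ, E) (fun y => g * y) x (mulInvariantVectorField X x) =
      mulInvariantVectorField X (g * x) := by
  have h0 : HasMFDerivAt 𝓘(ℝ, E) 𝓘(ℝ, E) (fun y => g * y) (x * 1)
      (mfderiv 𝓘(ℝ, E) 𝓘(ℝ, E) (fun y => g * y) x) := by
    rw [mul_one]; exact hasMFDerivAt_mul_left g x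
  have h := (h0.comp (1 : G) (hasMFDerivAt_mul_left x 1)).mfderiv
  have h2 : (fun y => g * y) ∘ (fun y => x * y) = fun y => g * x * y := by
    ext y; simp [mul_assoc]
  rw [h2] at h
  exact (congrArg (fun L => L X) h).symm

theorem leftInvariantDeriv_leftTranslate [Group G] [LieGroup 𝓘(ℝ, E) ∞ G]
    (X : GroupLieAlgebra 𝓘(ℝ, E) G) (g : G) :
    leftInvariantDeriv X * leftTranslate g = leftTranslate g * leftInvariantDeriv X := by
  ext f x
  have h := ((smoothFunctions_mdifferentiableAt f (g * x)).hasMFDerivAt.comp x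
    (hasMFDerivAt_mul_left g x)).mfderiv
  have h2 := congrArg (fun L => (L (mulInvariantVectorField X x) : ℂ)) h
  refine h2.trans ?_
  exact congrArg (mfderiv 𝓘(ℝ, E) 𝓘(ℝ, ℂ) f.1 (g * x))
    (mfderiv_mul_left_mulInvariantVectorField X g x)

variable (E G) in
/-- Evaluation of smooth functions at the unit element. -/
def evalOne [One G] : smoothFunctions E G →ₐ[ℂ] ℂ :=
  (Pi.evalAlgHom ℂ (fun _ : G => ℂ) 1).comp (smoothFunctions E G).val

theorem evalOne_apply [One G] (f : smoothFunctions E G) : evalOne E G f = f.1 1 := rfl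

variable (E G) in
/-- The algebra of all operators on `C^∞(G)` which commute with left translations. -/
def leftInvariantOps [Group G] [LieGroup 𝓘(ℝ, E) ∞ G] :
    Subalgebra ℂ (Module.End ℂ (smoothFunctions E G)) where
  carrier := {D | ∀ g : G, D * leftTranslate g = leftTranslate g * D}
  mul_mem' {D D'} h h' g := by rw [mul_assoc, h' g, ← mul_assoc, h g, mul_assoc]
  add_mem' {D D'} h h' g := by rw [add_mul, mul_add, h g, h' g]
  algebraMap_mem' c g := Algebra.commutes c _

/-- By invariance (Df)(g) is the value at 1 of D applied to the left translate of f by g. -/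
theorem eq_zero_of_leftInvariant [Group G] [LieGroup 𝓘(ℝ, E) ∞ G]
    {D : Module.End ℂ (smoothFunctions E G)}
    (hD : D ∈ leftInvariantOps E G) (h : ∀ f, evalOne E G (D f) = 0) : D = 0 := by
  ext f g
  have h1 := h (leftTranslate g f)
  have h2 := LinearMap.congr_fun (hD g) f
  rw [Module.End.mul_apply, Module.End.mul_apply] at h2
  rw [h2] at h1
  have h3 : (D f).1 (g * 1) = 0 := h1
  simpa using h3

/-! ### Local functions -/

section Bump

variable [IsManifold 𝓘(ℝ, E) ∞ G]

theorem contMDiffOn_comp_extChartAt (g : G) {F : E → ℂ} (hF : ContDiff ℝ ∞ F) :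
    ContMDiffOn 𝓘(ℝ, E) 𝓘(ℝ, ℂ) ∞ (fun x => F (extChartAt 𝓘(ℝ, E) g x)) (chartAt E g).source :=
  hF.contMDiff.comp_contMDiffOn (contMDiffOn_extChartAt (x := g))

variable [FiniteDimensional ℝ E] [T2Space G]

/-- A function given on a coordinate neighbourhood of `g`, multiplied by a bump function. -/
def bumpMul {g : G} (ψ : SmoothBumpFunction 𝓘(ℝ, E) g) (F : G → ℂ)
    (hF : ContMDiffOn 𝓘(ℝ, E) 𝓘(ℝ, ℂ) ∞ F (chartAt E g).source) : smoothFunctions E G :=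
  ⟨fun x => ψ x • F x, ψ.contMDiff_smul hF⟩

theorem bumpMul_apply {g : G} (ψ : SmoothBumpFunction 𝓘(ℝ, E) g) (F : G → ℂ)
    (hF : ContMDiffOn 𝓘(ℝ, E) 𝓘(ℝ, ℂ) ∞ F (chartAt E g).source) (x : G) :
    (bumpMul ψ F hF).1 x = ψ x • F x := rfl

theorem mfderiv_bumpMul_comp_extChartAt {g : G} (ψ : SmoothBumpFunction 𝓘(ℝ, E) g) {F : E → ℂ}
    (hF : ContDiff ℝ ∞ F) :
    mfderiv 𝓘(ℝ, E) 𝓘(ℝ, ℂ) (bumpMul ψ _ (contMDiffOn_comp_extChartAt g hF)).1 g =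
      fderiv ℝ F (extChartAt 𝓘(ℝ, E) g g) := by
  rw [(smoothFunctions_mdifferentiableAt _ g).mfderiv]
  have h : writtenInExtChartAt 𝓘(ℝ, E) 𝓘(ℝ, ℂ) g
      (bumpMul ψ _ (contMDiffOn_comp_extChartAt g hF)).1 =ᶠ[𝓝 (extChartAt 𝓘(ℝ, E) g g)] F := by
    have h1 : ∀ᶠ y in 𝓝 (extChartAt 𝓘(ℝ, E) g g), y ∈ (extChartAt 𝓘(ℝ, E) g).target :=
      extChartAt_target_mem_nhds g
    have h2 : ∀ᶠ y in 𝓝 (extChartAt 𝓘(ℝ, E) g g), ψ ((extChartAt 𝓘(ℝ, E) g).symm y) = 1 := by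
      have h3 := (continuousAt_extChartAt_symm (I := 𝓘(ℝ, E)) g).tendsto
      rw [extChartAt_to_inv] at h3
      exact h3.eventually ψ.eventuallyEq_one
    filter_upwards [h1, h2] with y hy1 hy2
    simp only [writtenInExtChartAt, Function.comp_apply, bumpMul_apply, hy2, one_smul,
      (extChartAt 𝓘(ℝ, E) g).right_inv hy1]
    rfl
  rw [show Set.range 𝓘(ℝ, E) = Set.univ by simp, fderivWithin_univ]
  exact h.fderiv_eq

end Bump

variable [Group G] [LieGroup 𝓘(ℝ, E) ∞ G]

theorem liftBaseChange_leftInvariantDeriv_tmul (a : ℂ) (X : GroupLieAlgebra 𝓘(ℝ, E) G) :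
    (leftInvariantDerivLinear E G).liftBaseChange ℂ (a ⊗ₜ X) = a • leftInvariantDeriv X := by
  rw [LinearMap.liftBaseChange_tmul]
  rfl

theorem leftInvariantDeriv_mem (X : GroupLieAlgebra 𝓘(ℝ, E) G) :
    leftInvariantDeriv X ∈ leftInvariantOps E G :=
  fun g => leftInvariantDeriv_leftTranslate X g

variable [FiniteDimensional ℝ E] [T2Space G]

/-- The linear form, in a chart centred at 1, is made global by a bump function equal to 1 near 1.
-/
theorem exists_smoothFunction_mfderiv_one_eq (l : E →L[ℝ] ℂ) :
    ∃ f : smoothFunctions E G, f.1 1 = 0 ∧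
      ∀ X : GroupLieAlgebra 𝓘(ℝ, E) G, (leftInvariantDeriv X f).1 1 = l X := by
  let ψ : SmoothBumpFunction 𝓘(ℝ, E) (1 : G) := Classical.arbitrary _
  let c := extChartAt 𝓘(ℝ, E) (1 : G) 1
  have hF : ContDiff ℝ ∞ fun y => l (y - c) := l.contDiff.comp (contDiff_id.sub contDiff_const)
  refine ⟨bumpMul ψ _ (contMDiffOn_comp_extChartAt 1 hF), ?_, fun X => ?_⟩
  · simp [bumpMul_apply, c]
  · rw [leftInvariantDeriv_apply, mulInvariantVectorField_one]
    have h : HasFDerivAt (fun y => l (y - c)) l c :=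
      l.hasFDerivAt.comp c ((hasFDerivAt_id c).sub_const c)
    exact congrArg (fun L => (L X : ℂ)) ((mfderiv_bumpMul_comp_extChartAt ψ hF).trans h.fderiv)

/-- With a cutoff u satisfying u(1) = 1, write f = (1 - u)f + uf. The first term is a product of two
functions vanishing at 1; Hadamard's lemma in a chart makes uf a sum of such products. -/
theorem mem_ker_evalOne_sq {f : smoothFunctions E G} (hf : f.1 1 = 0)
    (hf' : ∀ X : GroupLieAlgebra 𝓘(ℝ, E) G, (leftInvariantDeriv X f).1 1 = 0) :
    f ∈ (RingHom.ker (evalOne E G)) ^ 2 := by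
  let e := extChartAt 𝓘(ℝ, E) (1 : G)
  let c := e 1
  have htarget : e.target ∈ 𝓝 c := extChartAt_target_mem_nhds 1
  obtain ⟨r, hr, hball⟩ := Metric.nhds_basis_closedBall.mem_iff.1 htarget
  let β : ContDiffBump c := ⟨r / 2, r, half_pos hr, half_lt_self hr⟩
  -- The bump, supported in a closed ball inside the chart target, makes the coordinate expression
  -- of f smooth on all of E, as the global form of Hadamard's lemma requires.
  let F : E → ℂ := fun y => β y • f.1 (e.symm y)
  have hfe : ContDiffOn ℝ ∞ (fun y => f.1 (e.symm y)) e.target := by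
    rw [← contMDiffOn_iff_contDiffOn]
    exact ContMDiff.comp_contMDiffOn f.2 (contMDiffOn_extChartAt_symm 1)
  have hopen : IsOpen e.target := isOpen_extChartAt_target 1
  have hF : ContDiff ℝ ∞ F := by
    rw [contDiff_iff_contDiffAt]
    intro y
    by_cases hy : y ∈ e.target
    · exact β.contDiff.contDiffAt.smul (hfe.contDiffAt (hopen.mem_nhds hy))
    · have hy' : y ∉ tsupport β := fun h => hy (hball (β.tsupport_eq ▸ h))
      have h0 : F =ᶠ[𝓝 y] fun _ => 0 := by
        filter_upwards [notMem_tsupport_iff_eventuallyEq.1 hy'] with z hz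
        simp only [F, hz, Pi.zero_apply, zero_smul]
      exact contDiffAt_const.congr_of_eventuallyEq h0
  have hc1 : e.symm c = 1 := extChartAt_to_inv 1
  have hFc : F c = 0 := by simp [F, hc1, hf]
  have hdf : mfderiv 𝓘(ℝ, E) 𝓘(ℝ, ℂ) f.1 (1 : G) = 0 := by
    ext X
    have h := hf' X
    rw [leftInvariantDeriv_apply, mulInvariantVectorField_one] at h
    exact h
  have hdF : fderiv ℝ F c = 0 := by
    rw [(smoothFunctions_mdifferentiableAt f 1).mfderiv, show Set.range 𝓘(ℝ, E) = Set.univ by simp,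
      fderivWithin_univ] at hdf
    refine Eq.trans (Filter.EventuallyEq.fderiv_eq ?_) hdf
    filter_upwards [β.eventuallyEq_one] with y hy
    simp only [F, hy, Pi.one_apply, one_smul]
    rfl
  obtain ⟨γ, hγ, hγc, hγF⟩ := hF.exists_hadamard c
  rw [hFc] at hγF
  let ψ : SmoothBumpFunction 𝓘(ℝ, E) (1 : G) := Classical.arbitrary _
  let b := Module.finBasis ℝ E
  let x : Fin (Module.finrank ℝ E) → smoothFunctions E G := fun i =>
    bumpMul ψ _ (contMDiffOn_comp_extChartAt 1
      (F := fun y => (((b.coord i).toContinuousLinearMap (y - c) : ℝ) : ℂ))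
      (Complex.ofRealCLM.contDiff.comp
        ((b.coord i).toContinuousLinearMap.contDiff.comp (contDiff_id.sub contDiff_const))))
  let z : Fin (Module.finrank ℝ E) → smoothFunctions E G := fun i =>
    bumpMul ψ _ (contMDiffOn_comp_extChartAt 1 (F := fun y => γ y (b i))
      (hγ.clm_apply contDiff_const))
  -- The cutoff is ψ² · (β ∘ e): the two factors ψ match those in x i * z i, and β matches the one
  -- in F.
  let u : smoothFunctions E G :=
    bumpMul ψ _ (contMDiffOn_comp_extChartAt 1 (F := fun _ => 1) contDiff_const) *
    bumpMul ψ _ (contMDiffOn_comp_extChartAt 1 (F := fun y => ((β y : ℝ) : ℂ))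
      (Complex.ofRealCLM.contDiff.comp β.contDiff))
  have hu1 : u.1 1 = 1 := by
    change (ψ 1 • (1 : ℂ)) * (ψ 1 • ((β (e 1) : ℝ) : ℂ)) = 1
    have : β (e 1) = 1 := β.eventuallyEq_one.self_of_nhds
    simp [this]
  have hx : ∀ i, x i ∈ RingHom.ker (evalOne E G) := fun i => by
    rw [RingHom.mem_ker, evalOne_apply]
    simp only [x, bumpMul_apply]
    simp [c, e]
  have hz : ∀ i, z i ∈ RingHom.ker (evalOne E G) := fun i => by
    rw [RingHom.mem_ker, evalOne_apply]
    simp only [z, bumpMul_apply]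
    rw [show extChartAt 𝓘(ℝ, E) (1 : G) 1 = c from rfl, hγc, hdF]
    simp
  have huf : u * f = ∑ i, x i * z i := by
    ext g
    have h1 : ((∑ i, x i * z i : smoothFunctions E G) : G → ℂ) g =
        ∑ i, (ψ g • (((b.coord i) (e g - c) : ℝ) : ℂ)) * (ψ g • γ (e g) (b i)) := by
      rw [AddSubmonoidClass.coe_finsetSum, Finset.sum_apply]
      rfl
    have h2 : ((u * f : smoothFunctions E G) : G → ℂ) g =
      (ψ g • (1 : ℂ)) * (ψ g • ((β (e g) : ℝ) : ℂ)) * f.1 g := rfl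
    rw [h1, h2]
    by_cases hg : g ∈ (chartAt E (1 : G)).source
    · have h3 : F (e g) = ∑ i, (((b.coord i) (e g - c) : ℝ) : ℂ) * γ (e g) (b i) := by
        rw [hγF, zero_add]
        conv_lhs => rw [← b.sum_repr (e g - c)]
        rw [map_sum]
        simp
      have h4 : F (e g) = ((β (e g) : ℝ) : ℂ) * f.1 g := by
        simp only [F]
        rw [show e.symm (e g) = g from (extChartAt 𝓘(ℝ, E) (1 : G)).left_inv (by simpa using hg)]
        simp
      have h5 : (ψ g • (1 : ℂ)) * (ψ g • ((β (e g) : ℝ) : ℂ)) * f.1 g =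
          (ψ g : ℂ) * (ψ g : ℂ) * F (e g) := by
        rw [h4]; simp; ring
      rw [h5, h3, Finset.mul_sum]
      refine Finset.sum_congr rfl fun i _ => ?_
      simp only [Complex.real_smul]
      ring
    · have : ψ g = 0 := by
        by_contra h
        exact hg (ψ.support_subset_source h)
      simp [this]
  rw [show f = (1 - u) * f + u * f by ring, huf, sq]
  refine Ideal.add_mem _ (Ideal.mul_mem_mul ?_ hf)
    (Ideal.sum_mem _ fun i _ => Ideal.mul_mem_mul (hx i) (hz i))
  rw [RingHom.mem_ker, map_sub, map_one, evalOne_apply, hu1, sub_self]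

variable (E G) in
theorem isInvariantFrame_leftInvariantDeriv :
    IsInvariantFrame (evalOne E G) ((leftInvariantDerivLinear E G).liftBaseChange ℂ)
      (leftInvariantOps E G) where
  leibniz v a b := by
    induction v using TensorProduct.induction_on with
    | zero => simp
    | tmul c X =>
      simp only [liftBaseChange_leftInvariantDeriv_tmul, LinearMap.smul_apply,
        leftInvariantDeriv_mul, smul_add, mul_smul_comm]
    | add v w hv hw =>
      simp only [map_add, LinearMap.add_apply, hv, hw]
      ring
  mem v := by
    induction v using TensorProduct.induction_on with
    | zero => rw [map_zero]; exact Subalgebra.zero_mem _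
    | tmul c X =>
      rw [liftBaseChange_leftInvariantDeriv_tmul]
      exact Subalgebra.smul_mem _ (leftInvariantDeriv_mem X) c
    | add v w hv hw => rw [map_add]; exact Subalgebra.add_mem _ hv hw
  eq_zero D hD h := eq_zero_of_leftInvariant hD h
  exists_dual ξ := by
    have : FiniteDimensional ℝ (GroupLieAlgebra 𝓘(ℝ, E) G) := inferInstanceAs (FiniteDimensional ℝ E)
    let l : E →ₗ[ℝ] ℂ := (ξ.restrictScalars ℝ) ∘ₗ
      (TensorProduct.mk ℝ ℂ (GroupLieAlgebra 𝓘(ℝ, E) G) 1)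
    obtain ⟨f, hf, hf'⟩ := exists_smoothFunction_mfderiv_one_eq (G := G) l.toContinuousLinearMap
    refine ⟨f, hf, fun v => ?_⟩
    induction v using TensorProduct.induction_on with
    | zero => simp
    | tmul c X =>
      rw [liftBaseChange_leftInvariantDeriv_tmul, LinearMap.smul_apply, map_smul, evalOne_apply,
        hf' X]
      have h : l X = ξ (1 ⊗ₜ X) := rfl
      rw [LinearMap.coe_toContinuousLinearMap', h, ← map_smul, TensorProduct.smul_tmul', smul_eq_mul,
        mul_one]
    | add v w hv hw => rw [map_add, LinearMap.add_apply, map_add, hv, hw, map_add]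
  hadamard f hf h := by
    refine mem_ker_evalOne_sq hf fun X => ?_
    have h1 := h (1 ⊗ₜ X)
    rwa [liftBaseChange_leftInvariantDeriv_tmul, one_smul] at h1

end LieGroupFrame

/-! ### One-parameter subgroups -/

section OneParameter

open Filter Topology

variable {E : Type*} [NormedAddCommGroup E] [NormedSpace ℝ E]
  {G : Type*} [TopologicalSpace G] [ChartedSpace E G] [Group G] [LieGroup 𝓘(ℝ, E) ∞ G]

theorem isManifold_one_of_lieGroup : IsManifold 𝓘(ℝ, E) 1 G := IsManifold.of_le (n := ∞) (by simp)

theorem IsMIntegralCurveOn.mul_left {X : GroupLieAlgebra 𝓘(ℝ, E) G} {γ : ℝ → G} {s : Set ℝ}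
    (hγ : IsMIntegralCurveOn γ (mulInvariantVectorField X) s) (g : G) :
    IsMIntegralCurveOn (fun t => g * γ t) (mulInvariantVectorField X) s := by
  intro t ht
  have h := (hasMFDerivAt_mul_left (E := E) g (γ t)).comp_hasMFDerivWithinAt t (hγ t ht)
  have h2 : (mfderiv 𝓘(ℝ, E) 𝓘(ℝ, E) (fun y => g * y) (γ t)).comp
      ((1 : ℝ →L[ℝ] ℝ).smulRight (mulInvariantVectorField X (γ t))) =
      (1 : ℝ →L[ℝ] ℝ).smulRight (mulInvariantVectorField X (g * γ t)) := by
    rw [← mfderiv_mul_left_mulInvariantVectorField]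
    exact ContinuousLinearMap.ext fun r => map_smul
      (mfderiv 𝓘(ℝ, E) 𝓘(ℝ, E) (fun y => g * y) (γ t)) r (mulInvariantVectorField X (γ t))
  rw [← h2]
  exact h

theorem IsMIntegralCurve.mul_left {X : GroupLieAlgebra 𝓘(ℝ, E) G} {γ : ℝ → G}
    (hγ : IsMIntegralCurve γ (mulInvariantVectorField X)) (g : G) :
    IsMIntegralCurve (fun t => g * γ t) (mulInvariantVectorField X) :=
  isMIntegralCurve_iff_isMIntegralCurveOn.2 ((hγ.isMIntegralCurveOn _).mul_left g)

theorem HasMFDerivAt.hasDerivAt_of_smulRight {F : Type*} [NormedAddCommGroup F] [NormedSpace ℝ F]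
    {f : ℝ → F} {c : F} {t : ℝ}
    (h : HasMFDerivAt 𝓘(ℝ, ℝ) 𝓘(ℝ, F) f t ((1 : ℝ →L[ℝ] ℝ).smulRight c)) : HasDerivAt f c t := by
  have h1 : HasFDerivAt f ((1 : ℝ →L[ℝ] ℝ).smulRight c) t := hasMFDerivAt_iff_hasFDerivAt.1 h
  simpa using h1.hasDerivAt

theorem IsMIntegralCurve.hasDerivAt_smoothFunction {X : GroupLieAlgebra 𝓘(ℝ, E) G} {γ : ℝ → G}
    (hγ : IsMIntegralCurve γ (mulInvariantVectorField X)) (f : smoothFunctions E G) (t : ℝ) :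
    HasDerivAt (fun t => f.1 (γ t)) ((leftInvariantDeriv X f).1 (γ t)) t := by
  have h : HasMFDerivAt 𝓘(ℝ, ℝ) 𝓘(ℝ, ℂ) (fun t => f.1 (γ t)) t
      ((1 : ℝ →L[ℝ] ℝ).smulRight ((leftInvariantDeriv X f).1 (γ t))) := by
    have h1 := (smoothFunctions_mdifferentiableAt f (γ t)).hasMFDerivAt.comp t (hγ t)
    have h2 : (mfderiv 𝓘(ℝ, E) 𝓘(ℝ, ℂ) f.1 (γ t)).comp
        ((1 : ℝ →L[ℝ] ℝ).smulRight (mulInvariantVectorField X (γ t))) =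
        (1 : ℝ →L[ℝ] ℝ).smulRight ((leftInvariantDeriv X f).1 (γ t)) :=
      ContinuousLinearMap.ext fun r => map_smul
        (mfderiv 𝓘(ℝ, E) 𝓘(ℝ, ℂ) f.1 (γ t)) r (mulInvariantVectorField X (γ t))
    exact h2 ▸ h1
  exact h.hasDerivAt_of_smulRight

/-- Bootstrapping: the derivative of f ∘ γ is (X̃f) ∘ γ, a function of the same kind. -/
theorem IsMIntegralCurve.contDiff_smoothFunction {X : GroupLieAlgebra 𝓘(ℝ, E) G} {γ : ℝ → G}
    (hγ : IsMIntegralCurve γ (mulInvariantVectorField X)) (f : smoothFunctions E G) :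
    ContDiff ℝ ∞ fun t => f.1 (γ t) := by
  rw [contDiff_infty]
  intro n
  induction n generalizing f with
  | zero =>
    exact contDiff_zero.2 (continuous_iff_continuousAt.2 fun t =>
      (hγ.hasDerivAt_smoothFunction f t).continuousAt)
  | succ n ih =>
    push_cast
    refine (contDiff_succ_iff_deriv (n := (n : WithTop ℕ∞))).2
      ⟨fun t => (hγ.hasDerivAt_smoothFunction f t).differentiableAt, by simp, ?_⟩
    rw [show deriv (fun t => f.1 (γ t)) = fun t => (leftInvariantDeriv X f).1 (γ t) from
      funext fun t => (hγ.hasDerivAt_smoothFunction f t).deriv]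
    exact ih _

theorem IsOneParameterSubgroup.hasDerivAt_zero {X : GroupLieAlgebra 𝓘(ℝ, E) G} {γ : ℝ → G}
    (hγ : IsOneParameterSubgroup X γ) (f : smoothFunctions E G) :
    HasDerivAt (fun t => f.1 (γ t)) ((leftInvariantDeriv X f).1 1) 0 := by
  have h := hγ.2.hasDerivAt_smoothFunction f 0
  rwa [hγ.1] at h

/-- Since γ s = γ t * γ (s - t), the velocity at t is the left translate of the velocity at 0. -/
theorem isOneParameterSubgroup_of_map_add {Z : GroupLieAlgebra 𝓘(ℝ, E) G} {γ : ℝ → G}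
    (h0 : γ 0 = 1) (hadd : ∀ s t, γ (s + t) = γ s * γ t)
    (hZ : HasMFDerivAt 𝓘(ℝ, ℝ) 𝓘(ℝ, E) γ 0 ((1 : ℝ →L[ℝ] ℝ).smulRight Z)) :
    IsOneParameterSubgroup Z γ := by
  refine ⟨h0, fun t => ?_⟩
  have h1 : HasMFDerivAt 𝓘(ℝ, ℝ) 𝓘(ℝ, ℝ) (fun s : ℝ => s - t) t (ContinuousLinearMap.id ℝ ℝ) :=
    ((hasFDerivAt_id t).sub_const t).hasMFDerivAt
  have h2 : HasMFDerivAt 𝓘(ℝ, ℝ) 𝓘(ℝ, E) γ (t - t) ((1 : ℝ →L[ℝ] ℝ).smulRight Z) := by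
    rw [sub_self]; exact hZ
  have h3 : HasMFDerivAt 𝓘(ℝ, E) 𝓘(ℝ, E) (fun y => γ t * y) (γ (t - t))
      (mfderiv 𝓘(ℝ, E) 𝓘(ℝ, E) (fun y => γ t * y) (1 : G)) := by
    rw [sub_self, h0]; exact hasMFDerivAt_mul_left _ _
  have h4 := h3.comp t (HasMFDerivAt.comp (f := fun s => s - t) t h2 h1)
  have h5 : (fun y => γ t * y) ∘ γ ∘ (fun s => s - t) = γ := by
    ext s
    simp [← hadd]
  rw [h5] at h4
  have h6 : (mfderiv 𝓘(ℝ, E) 𝓘(ℝ, E) (fun y => γ t * y) (1 : G)).comp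
      (((1 : ℝ →L[ℝ] ℝ).smulRight Z).comp (ContinuousLinearMap.id ℝ ℝ)) =
      (1 : ℝ →L[ℝ] ℝ).smulRight (mulInvariantVectorField Z (γ t)) :=
    ContinuousLinearMap.ext fun r => map_smul
      (mfderiv 𝓘(ℝ, E) 𝓘(ℝ, E) (fun y => γ t * y) (1 : G)) r Z
  exact h6 ▸ h4

variable [T2Space G]

theorem IsMIntegralCurve.eq_of_eq {X : GroupLieAlgebra 𝓘(ℝ, E) G} {γ γ' : ℝ → G}
    (hγ : IsMIntegralCurve γ (mulInvariantVectorField X))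
    (hγ' : IsMIntegralCurve γ' (mulInvariantVectorField X)) (h : γ 0 = γ' 0) : γ = γ' := by
  have := isManifold_one_of_lieGroup (E := E) (G := G)
  exact isMIntegralCurve_Ioo_eq_of_contMDiff_boundaryless (t₀ := 0)
    ((contMDiff_mulInvariantField X).of_le (by simp)) hγ hγ' h

/-- Left translates of one local integral curve through 1 exist for the same time ε at every point,
so the field is complete. -/
theorem exists_isOneParameterSubgroup [CompleteSpace E] (X : GroupLieAlgebra 𝓘(ℝ, E) G) :
    ∃ γ : ℝ → G, IsOneParameterSubgroup X γ := by
  have := isManifold_one_of_lieGroup (E := E) (G := G)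
  have hv : ContMDiff 𝓘(ℝ, E) 𝓘(ℝ, E).tangent 1
      (fun g : G => (⟨g, mulInvariantVectorField X g⟩ : TangentBundle 𝓘(ℝ, E) G)) :=
    (contMDiff_mulInvariantField X).of_le (by simp)
  obtain ⟨γ, h0, hγ⟩ := exists_isMIntegralCurveAt_of_contMDiffAt_boundaryless 0
    (hv.contMDiffAt (x := (1 : G)))
  obtain ⟨ε, hε, hγ⟩ := isMIntegralCurveAt_iff'.1 hγ
  rw [Real.ball_eq_Ioo, zero_sub, zero_add] at hγ
  exact exists_isMIntegralCurve_of_isMIntegralCurveOn hv hε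
    (fun g => ⟨fun t => g * γ t, by simp [h0], hγ.mul_left g⟩) 1

namespace IsOneParameterSubgroup

variable {X : GroupLieAlgebra 𝓘(ℝ, E) G} {γ γ' : ℝ → G}

theorem unique (hγ : IsOneParameterSubgroup X γ) (hγ' : IsOneParameterSubgroup X γ') : γ = γ' :=
  hγ.2.eq_of_eq hγ'.2 (hγ.1.trans hγ'.1.symm)

theorem map_add (hγ : IsOneParameterSubgroup X γ) (s t : ℝ) : γ (s + t) = γ s * γ t := by
  have h := (hγ.2.comp_add s).eq_of_eq (hγ.2.mul_left (γ s)) (by simp [hγ.1])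
  have h2 := congrFun h t
  rw [add_comm]
  exact h2

theorem map_neg (hγ : IsOneParameterSubgroup X γ) (t : ℝ) : γ (-t) = (γ t)⁻¹ := by
  rw [eq_inv_iff_mul_eq_one, ← hγ.map_add, neg_add_cancel, hγ.1]

omit [LieGroup 𝓘(ℝ, E) ∞ G] [T2Space G] in
theorem smul (hγ : IsOneParameterSubgroup X γ) (r : ℝ) :
    IsOneParameterSubgroup (r • X) fun t => γ (t * r) := by
  refine ⟨by simp [hγ.1], ?_⟩
  have h := hγ.2.comp_mul r
  have h2 : mulInvariantVectorField (r • X) = r • mulInvariantVectorField (I := 𝓘(ℝ, E)) X :=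
    funext fun g => _root_.map_smul _ r X
  rw [h2]
  exact h

/-- Each coordinate of γ is locally f ∘ γ for a cut-off coordinate function f on G, and such
compositions are smooth. -/
theorem contMDiff [FiniteDimensional ℝ E] (hγ : IsOneParameterSubgroup X γ) :
    ContMDiff 𝓘(ℝ, ℝ) 𝓘(ℝ, E) ∞ γ := by
  intro t₀
  rw [contMDiffAt_iff_target]
  refine ⟨hγ.2.continuous.continuousAt, ?_⟩
  rw [contMDiffAt_iff_contDiffAt]
  let ψ : SmoothBumpFunction 𝓘(ℝ, E) (γ t₀) := Classical.arbitrary _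
  let b := Module.finBasis ℝ E
  have h1 : extChartAt 𝓘(ℝ, E) (γ t₀) ∘ γ =
      fun t => ∑ i, b.coord i (extChartAt 𝓘(ℝ, E) (γ t₀) (γ t)) • b i :=
    funext fun t => (b.sum_repr _).symm
  rw [h1]
  refine ContDiffAt.sum fun i _ => ContDiffAt.smul ?_ contDiffAt_const
  let f : smoothFunctions E G := bumpMul ψ _ (contMDiffOn_comp_extChartAt (γ t₀)
    (F := fun y => (((b.coord i).toContinuousLinearMap y : ℝ) : ℂ))
    (Complex.ofRealCLM.contDiff.comp (b.coord i).toContinuousLinearMap.contDiff))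
  have h2 : ContDiff ℝ ∞ fun t => (f.1 (γ t)).re :=
    Complex.reCLM.contDiff.comp (hγ.2.contDiff_smoothFunction f)
  refine h2.contDiffAt.congr_of_eventuallyEq ?_
  have h3 := hγ.2.continuous.continuousAt.eventually ψ.eventuallyEq_one
  filter_upwards [h3] with t ht
  have h4 : f.1 (γ t) = ψ (γ t) • ((b.coord i (extChartAt 𝓘(ℝ, E) (γ t₀) (γ t)) : ℝ) : ℂ) := rfl
  rw [h4, ht]
  simp

end IsOneParameterSubgroup

end OneParameter

/-! ### The product formula -/

section Parametric

open Filter Topology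

variable {E' : Type*} [NormedAddCommGroup E'] [NormedSpace ℝ E'] {H' : Type*} [TopologicalSpace H']
  {J : ModelWithCorners ℝ E' H'} {P : Type*} [TopologicalSpace P] [ChartedSpace H' P]
  [IsManifold J 1 P]

theorem continuous_deriv_of_contMDiff {Φ : P → ℝ → ℂ}
    (hΦ : ContMDiff (J.prod 𝓘(ℝ, ℝ)) 𝓘(ℝ, ℂ) ∞ (Function.uncurry Φ)) :
    Continuous fun q : ℝ × P => deriv (Φ q.2) q.1 := by
  rw [continuous_iff_continuousAt]
  intro q₀
  have h1 : ContMDiff ((𝓘(ℝ, ℝ).prod J).prod 𝓘(ℝ, ℝ)) 𝓘(ℝ, ℂ) ∞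
      (Function.uncurry fun (q : ℝ × P) (h : ℝ) => Φ q.2 h) :=
    hΦ.comp ((contMDiff_snd.comp contMDiff_fst).prodMk contMDiff_snd)
  have h2 := ContMDiffAt.mfderiv (m := 0) (x₀ := q₀) (fun (q : ℝ × P) (h : ℝ) => Φ q.2 h)
    (fun q => q.1) h1.contMDiffAt contMDiff_fst.contMDiffAt (by simp)
  have h4 : inTangentCoordinates 𝓘(ℝ, ℝ) 𝓘(ℝ, ℂ) (fun q : ℝ × P => q.1) (fun q => Φ q.2 q.1)
      (fun q => mfderiv 𝓘(ℝ, ℝ) 𝓘(ℝ, ℂ) (fun h => Φ q.2 h) q.1) q₀ =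
      fun q : ℝ × P => fderiv ℝ (Φ q.2) q.1 := by
    have h5 := inTangentCoordinates_model_space (I := 𝓘(ℝ, ℝ)) (I' := 𝓘(ℝ, ℂ))
      (fun q : ℝ × P => q.1) (fun q => Φ q.2 q.1)
      (fun q => mfderiv 𝓘(ℝ, ℝ) 𝓘(ℝ, ℂ) (fun h => Φ q.2 h) q.1) q₀
    refine h5.trans (funext fun q => ?_)
    exact mfderiv_eq_fderiv
  have h3 : ContinuousAt (fun q : ℝ × P => fderiv ℝ (Φ q.2) q.1) q₀ := h4 ▸ h2.continuousAt
  exact h3.clm_apply continuousAt_const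

/-- The derivative is jointly continuous, hence small near h = 0 uniformly on the compact set; the
mean value inequality does the rest. -/
theorem exists_forall_norm_le_mul_of_deriv_eq_zero {Φ : P → ℝ → ℂ}
    (hΦ : ContMDiff (J.prod 𝓘(ℝ, ℝ)) 𝓘(ℝ, ℂ) ∞ (Function.uncurry Φ)) (h0 : ∀ p, Φ p 0 = 0)
    (h0' : ∀ p, deriv (Φ p) 0 = 0) {K : Set P} (hK : IsCompact K) {ε : ℝ} (hε : 0 < ε) :
    ∃ δ > 0, ∀ h : ℝ, |h| < δ → ∀ p ∈ K, ‖Φ p h‖ ≤ ε * |h| := by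
  have h1 : ∀ᶠ h in 𝓝 (0 : ℝ), ∀ p ∈ K, ‖deriv (Φ p) h‖ < ε := by
    refine hK.eventually_forall_of_forall_eventually fun p _ => ?_
    refine (continuous_deriv_of_contMDiff hΦ).norm.continuousAt.eventually_lt continuousAt_const ?_
    simpa [h0' p] using hε
  obtain ⟨δ, hδ, hball⟩ := Metric.eventually_nhds_iff_ball.1 h1
  refine ⟨δ, hδ, fun h hh p hp => ?_⟩
  have h2 : Differentiable ℝ (Φ p) := by
    have h3 : ContMDiff 𝓘(ℝ, ℝ) 𝓘(ℝ, ℂ) ∞ (Φ p) :=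
      hΦ.comp (contMDiff_const.prodMk contMDiff_id)
    exact h3.contDiff.differentiable (by simp)
  have h3 := (convex_ball (0 : ℝ) δ).norm_image_sub_le_of_norm_deriv_le (𝕜 := ℝ) (f := Φ p)
    (fun x _ => h2 x) (fun x hx => (hball x hx p hp).le) (Metric.mem_ball_self hδ)
    (by simpa using hh : h ∈ Metric.ball (0 : ℝ) δ)
  simpa [h0 p] using h3

end Parametric

section ProductFormula

open Filter Topology

variable {E : Type*} [NormedAddCommGroup E] [NormedSpace ℝ E]
  {G : Type*} [TopologicalSpace G] [ChartedSpace E G] [Group G] [LieGroup 𝓘(ℝ, E) ∞ G]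

/-- The smooth function `y ↦ f (x * y * z)`. -/
def twoSidedTranslate (x z : G) (f : smoothFunctions E G) : smoothFunctions E G :=
  ⟨fun y => f.1 (x * y * z), ContMDiff.comp f.2
    ((contMDiff_const.mul contMDiff_id).mul contMDiff_const)⟩

theorem leftInvariantDeriv_add (X Y : GroupLieAlgebra 𝓘(ℝ, E) G) :
    leftInvariantDeriv (X + Y) = leftInvariantDeriv X + leftInvariantDeriv Y :=
  map_add (leftInvariantDerivLinear E G) X Y

variable [FiniteDimensional ℝ E] [T2Space G] {X Y : GroupLieAlgebra 𝓘(ℝ, E) G} {α β γ : ℝ → G}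

theorem IsOneParameterSubgroup.hasDerivAt_mul (hα : IsOneParameterSubgroup X α)
    (hβ : IsOneParameterSubgroup Y β) (f : smoothFunctions E G) :
    HasDerivAt (fun h => f.1 (α h * β h))
      ((leftInvariantDeriv X f).1 1 + (leftInvariantDeriv Y f).1 1) 0 := by
  let k : ℝ × ℝ → ℂ := fun p => f.1 (α p.1 * β p.2)
  have hk : ContDiff ℝ ∞ k := by
    rw [← contMDiff_iff_contDiff]
    refine ContMDiff.comp f.2 ?_
    exact (hα.contMDiff.comp contDiff_fst.contMDiff).mul (hβ.contMDiff.comp contDiff_snd.contMDiff)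
  have hk' : HasFDerivAt k (fderiv ℝ k (0, 0)) (0, 0) :=
    ((hk.differentiable (by simp)) _).hasFDerivAt
  have h1 : HasDerivAt (fun h => k (h, 0)) (fderiv ℝ k (0, 0) (1, 0)) 0 :=
    HasFDerivAt.comp_hasDerivAt (f := fun h : ℝ => (h, (0 : ℝ))) (0 : ℝ) hk'
      ((hasDerivAt_id (0 : ℝ)).prodMk (hasDerivAt_const (0 : ℝ) (0 : ℝ)))
  have h2 : HasDerivAt (fun h => k (0, h)) (fderiv ℝ k (0, 0) (0, 1)) 0 :=
    hk'.comp_hasDerivAt (0 : ℝ) ((hasDerivAt_const (0 : ℝ) (0 : ℝ)).prodMk (hasDerivAt_id (0 : ℝ)))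
  have h3 : HasDerivAt (fun h => k (h, h)) (fderiv ℝ k (0, 0) (1, 1)) 0 :=
    HasFDerivAt.comp_hasDerivAt (f := fun h : ℝ => (h, h)) (0 : ℝ) hk'
      ((hasDerivAt_id (0 : ℝ)).prodMk (hasDerivAt_id (0 : ℝ)))
  have h1' : fderiv ℝ k (0, 0) (1, 0) = (leftInvariantDeriv X f).1 1 :=
    h1.unique (by simpa [k, hβ.1] using hα.hasDerivAt_zero f)
  have h2' : fderiv ℝ k (0, 0) (0, 1) = (leftInvariantDeriv Y f).1 1 :=
    h2.unique (by simpa [k, hα.1] using hβ.hasDerivAt_zero f)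
  rw [← h1', ← h2', ← _root_.map_add]
  simpa using h3

/-- The curves h ↦ α h * β h and γ are tangent at 0. Uniformity in all x comes from compact support:
outside the compact set S both terms vanish. -/
theorem IsOneParameterSubgroup.exists_forall_norm_sub_le (hα : IsOneParameterSubgroup X α)
    (hβ : IsOneParameterSubgroup Y β) (hγ : IsOneParameterSubgroup (X + Y) γ)
    {f : smoothFunctions E G} (hf : HasCompactSupport f.1) (T : ℝ) {ε : ℝ} (hε : 0 < ε) :
    ∃ δ > 0, ∀ h : ℝ, |h| < δ → ∀ s ∈ Set.Icc (-T) T, ∀ x : G,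
      ‖f.1 (x * (α h * β h) * γ s) - f.1 (x * γ h * γ s)‖ ≤ ε * |h| := by
  have : IsTopologicalGroup G := topologicalGroup_of_lieGroup 𝓘(ℝ, E) ∞
  have := isManifold_one_of_lieGroup (E := E) (G := G)
  let Φ : ℝ × G → ℝ → ℂ := fun p h =>
    f.1 (p.2 * (α h * β h) * γ p.1) - f.1 (p.2 * γ h * γ p.1)
  have hΦ : ContMDiff ((𝓘(ℝ, ℝ).prod 𝓘(ℝ, E)).prod 𝓘(ℝ, ℝ)) 𝓘(ℝ, ℂ) ∞
      (Function.uncurry Φ) := by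
    have hx : ContMDiff ((𝓘(ℝ, ℝ).prod 𝓘(ℝ, E)).prod 𝓘(ℝ, ℝ)) 𝓘(ℝ, E) ∞
        fun q : (ℝ × G) × ℝ => q.1.2 := contMDiff_snd.comp contMDiff_fst
    have hs : ContMDiff ((𝓘(ℝ, ℝ).prod 𝓘(ℝ, E)).prod 𝓘(ℝ, ℝ)) 𝓘(ℝ, ℝ) ∞
        fun q : (ℝ × G) × ℝ => q.1.1 := contMDiff_fst.comp contMDiff_fst
    have hh : ContMDiff ((𝓘(ℝ, ℝ).prod 𝓘(ℝ, E)).prod 𝓘(ℝ, ℝ)) 𝓘(ℝ, ℝ) ∞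
        fun q : (ℝ × G) × ℝ => q.2 := contMDiff_snd
    refine ContMDiff.sub (ContMDiff.comp f.2 ?_) (ContMDiff.comp f.2 ?_)
    · exact (hx.mul ((hα.contMDiff.comp hh).mul (hβ.contMDiff.comp hh))).mul (hγ.contMDiff.comp hs)
    · exact (hx.mul (hγ.contMDiff.comp hh)).mul (hγ.contMDiff.comp hs)
  have h0 : ∀ p, Φ p 0 = 0 := fun p => by simp [Φ, hα.1, hβ.1, hγ.1]
  have h0' : ∀ p, deriv (Φ p) 0 = 0 := fun p => by
    have h1 := hα.hasDerivAt_mul hβ (twoSidedTranslate p.2 (γ p.1) f)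
    have h2 := hγ.hasDerivAt_zero (twoSidedTranslate p.2 (γ p.1) f)
    have h3 := h1.sub h2
    have h4 : (leftInvariantDeriv X (twoSidedTranslate p.2 (γ p.1) f)).1 1 +
        (leftInvariantDeriv Y (twoSidedTranslate p.2 (γ p.1) f)).1 1 -
        (leftInvariantDeriv (X + Y) (twoSidedTranslate p.2 (γ p.1) f)).1 1 = 0 := by
      rw [leftInvariantDeriv_add]
      exact sub_self _
    rw [h4] at h3
    exact h3.deriv
  let I : Set (ℝ × ℝ) := Set.Icc (-1) 1 ×ˢ Set.Icc (-T) T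
  have hI : IsCompact I := isCompact_Icc.prod isCompact_Icc
  have hαc := hα.2.continuous
  have hβc := hβ.2.continuous
  have hγc := hγ.2.continuous
  let C : Set G := (fun p : ℝ × ℝ => (α p.1 * β p.1) * γ p.2) '' I ∪
    (fun p : ℝ × ℝ => γ p.1 * γ p.2) '' I
  have hC : IsCompact C := (hI.image (by fun_prop)).union (hI.image (by fun_prop))
  let S : Set G := (fun p : G × G => p.1 * p.2⁻¹) '' (tsupport f.1 ×ˢ C)
  have hS : IsCompact S := (hf.isCompact.prod hC).image (by fun_prop)
  obtain ⟨δ, hδ, hδ'⟩ := exists_forall_norm_le_mul_of_deriv_eq_zero hΦ h0 h0'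
    ((isCompact_Icc (a := -T) (b := T)).prod hS) hε
  refine ⟨min δ 1, lt_min hδ one_pos, fun h hh s hs x => ?_⟩
  by_cases hx : x ∈ S
  · exact hδ' h (hh.trans_le (min_le_left _ _)) (s, x) ⟨hs, hx⟩
  · have hI' : (h, s) ∈ I := ⟨abs_le.1 (hh.trans_le (min_le_right _ _)).le, hs⟩
    have hzero : ∀ c ∈ C, f.1 (x * c) = 0 := by
      intro c hc
      by_contra hne
      exact hx ⟨(x * c, c), ⟨subset_tsupport _ hne, hc⟩, by simp⟩
    have e1 : f.1 (x * (α h * β h) * γ s) = 0 := by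
      rw [mul_assoc]
      exact hzero _ (Or.inl ⟨(h, s), hI', rfl⟩)
    have e2 : f.1 (x * γ h * γ s) = 0 := by
      rw [mul_assoc]
      exact hzero _ (Or.inr ⟨(h, s), hI', rfl⟩)
    rw [e1, e2]
    simp only [sub_self, norm_zero]
    positivity

theorem IsOneParameterSubgroup.tendsto_smoothFunction_pow (hα : IsOneParameterSubgroup X α)
    (hβ : IsOneParameterSubgroup Y β) (hγ : IsOneParameterSubgroup (X + Y) γ)
    {f : smoothFunctions E G} (hf : HasCompactSupport f.1) (t : ℝ) :
    Tendsto (fun n : ℕ => f.1 ((α (t / n) * β (t / n)) ^ n)) atTop (𝓝 (f.1 (γ t))) := by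
  rw [Metric.tendsto_atTop]
  intro ε hε
  have ht : 0 < |t| + 1 := by positivity
  obtain ⟨δ, hδ, hδ'⟩ := hα.exists_forall_norm_sub_le hβ hγ hf |t| (div_pos hε ht)
  obtain ⟨N, hN⟩ := exists_nat_gt (|t| / δ)
  refine ⟨N + 1, fun n hn => ?_⟩
  have hn0 : (0 : ℝ) < n := by
    have : 0 < n := by omega
    exact_mod_cast this
  have hnN : (N : ℝ) < n := by exact_mod_cast (by omega : N < n)
  set h := t / n with hh
  have hhδ : |h| < δ := by
    rw [hh, abs_div, abs_of_pos hn0, div_lt_iff₀ hn0]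
    rw [div_lt_iff₀ hδ] at hN
    nlinarith
  have hnh : n * h = t := by rw [hh]; field_simp
  -- u interpolates between f (γ t) at k = 0 and f ((α h * β h) ^ n) at k = n; each of the n steps
  -- replaces one γ h by α h * β h and costs at most ε |h| / (|t| + 1).
  let u : ℕ → ℂ := fun k => f.1 ((α h * β h) ^ k * γ ((n - k : ℝ) * h))
  have hu : f.1 ((α h * β h) ^ n) - f.1 (γ t) = ∑ k ∈ Finset.range n, (u (k + 1) - u k) := by
    rw [Finset.sum_range_sub]
    simp [u, hγ.1, hnh]
  have hstep : ∀ k ∈ Finset.range n, ‖u (k + 1) - u k‖ ≤ ε / (|t| + 1) * |h| := by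
    intro k hk
    have hkn : (k : ℝ) + 1 ≤ n := by exact_mod_cast Finset.mem_range.1 hk
    have hs : ((n - (k + 1) : ℝ) * h) ∈ Set.Icc (-|t|) |t| := by
      rw [Set.mem_Icc, ← abs_le, abs_mul, ← hnh, abs_mul]
      refine mul_le_mul_of_nonneg_right ?_ (abs_nonneg h)
      rw [abs_of_nonneg (by linarith), abs_of_pos hn0]
      have : (0 : ℝ) ≤ k := k.cast_nonneg
      linarith
    have h1 := hδ' h hhδ _ hs ((α h * β h) ^ k)
    have h2 : u (k + 1) = f.1 ((α h * β h) ^ k * (α h * β h) * γ ((n - (k + 1) : ℝ) * h)) := by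
      simp only [u, pow_succ, Nat.cast_add, Nat.cast_one]
    have h3 : u k = f.1 ((α h * β h) ^ k * γ h * γ ((n - (k + 1) : ℝ) * h)) := by
      simp only [u]
      rw [show (n - k : ℝ) * h = h + (n - (k + 1)) * h by ring, hγ.map_add, ← mul_assoc]
    rw [h2, h3]
    exact h1
  rw [dist_eq_norm, hu]
  calc ‖∑ k ∈ Finset.range n, (u (k + 1) - u k)‖
      ≤ ∑ k ∈ Finset.range n, ε / (|t| + 1) * |h| := norm_sum_le_of_le _ hstep
    _ = ε / (|t| + 1) * |t| := by
      rw [Finset.sum_const, Finset.card_range, nsmul_eq_mul, ← hnh, abs_mul, abs_of_pos hn0]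
      ring
    _ < ε := by
      rw [div_mul_eq_mul_div, div_lt_iff₀ ht]
      nlinarith

/-- The product formula `exp (t (X + Y)) = lim (exp (t X / n) exp (t Y / n)) ^ n`. -/
theorem IsOneParameterSubgroup.tendsto_pow (hα : IsOneParameterSubgroup X α)
    (hβ : IsOneParameterSubgroup Y β) (hγ : IsOneParameterSubgroup (X + Y) γ) (t : ℝ) :
    Tendsto (fun n : ℕ => (α (t / n) * β (t / n)) ^ n) atTop (𝓝 (γ t)) := by
  -- Supports of bump functions form a neighbourhood basis, so convergence of f along the sequence
  -- for compactly supported smooth f gives convergence in G.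
  rw [(SmoothBumpFunction.nhds_basis_support (I := 𝓘(ℝ, E)) (c := γ t) univ_mem).tendsto_right_iff]
  intro ψ _
  have h1 : ContMDiff 𝓘(ℝ, E) 𝓘(ℝ, ℂ) ∞ fun x => ((ψ x : ℝ) : ℂ) :=
    Complex.ofRealCLM.contDiff.contMDiff.comp ψ.contMDiff
  let f : smoothFunctions E G := ⟨fun x => ((ψ x : ℝ) : ℂ), h1⟩
  have hf : HasCompactSupport f.1 :=
    ψ.hasCompactSupport.comp_left (g := fun r : ℝ => (r : ℂ)) Complex.ofReal_zero
  have h2 := hα.tendsto_smoothFunction_pow hβ hγ hf t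
  have h3 : f.1 (γ t) ≠ 0 := by
    change ((ψ (γ t) : ℝ) : ℂ) ≠ 0
    rw [ψ.eq_one]
    simp
  filter_upwards [h2.eventually_ne h3] with n hn
  intro h0
  exact hn (by simp only [f]; exact_mod_cast h0)

end ProductFormula

/-! ### Homomorphisms from the real line to the complex numbers -/

section ExponentialHom

open Filter Topology intervalIntegral

variable {φ : ℝ → ℂ}

theorem eq_exp_of_hasDerivAt {c : ℂ} (h0 : φ 0 = 1) (hadd : ∀ s t, φ (s + t) = φ s * φ t)
    (hc : HasDerivAt φ c 0) (t : ℝ) : φ t = Complex.exp (t * c) := by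
  have h1 : ∀ t, HasDerivAt φ (φ t * c) t := fun t => by
    have h2 : HasDerivAt (fun s => φ t * φ (s - t)) (φ t * c) t :=
      (HasDerivAt.comp_sub_const t t (by rwa [sub_self])).const_mul (φ t)
    refine h2.congr_of_eventuallyEq (Eventually.of_forall fun s => ?_)
    change φ s = φ t * φ (s - t)
    rw [← hadd, add_sub_cancel]
  have h2 : ∀ t, HasDerivAt (fun t : ℝ => φ t * Complex.exp (-(t * c))) 0 t := fun t => by
    have h3 : HasDerivAt (fun t : ℝ => Complex.exp (-(t * c)))
        (Complex.exp (-(t * c)) * (-(1 * c))) t :=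
      ((Complex.ofRealCLM.hasDerivAt (x := t)).mul_const c).neg.cexp
    exact ((h1 t).mul h3).congr_deriv (by ring)
  have h3 := is_const_of_deriv_eq_zero (fun t => (h2 t).differentiableAt) (fun t => (h2 t).deriv) t 0
  have h4 : φ t * Complex.exp (-(t * c)) = 1 := by simpa [h0] using h3
  rw [Complex.exp_neg] at h4
  exact (div_eq_one_iff_eq (Complex.exp_ne_zero _)).1 h4

/-- Integrating the functional equation gives φ(t) Φ(a) = Φ(t + a) - Φ(t) for the primitive Φ, whose
right side is differentiable; a with Φ(a) ≠ 0 exists because Φ'(0) = φ(0) = 1. -/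
theorem exists_hasDerivAt_of_continuous (hφ : Continuous φ) (h0 : φ 0 = 1)
    (hadd : ∀ s t, φ (s + t) = φ s * φ t) : ∃ c, HasDerivAt φ c 0 := by
  let Φ : ℝ → ℂ := fun x => ∫ s in (0 : ℝ)..x, φ s
  have hΦ : ∀ x, HasDerivAt Φ (φ x) x := fun x => hφ.integral_hasStrictDerivAt 0 x |>.hasDerivAt
  obtain ⟨a, ha⟩ : ∃ a, Φ a ≠ 0 := by
    by_contra! h
    have h1 : HasDerivAt Φ 0 0 := by
      rw [show Φ = fun _ => 0 from funext h]
      exact hasDerivAt_const _ _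
    have h2 := (hΦ 0).unique h1
    rw [h0] at h2
    exact one_ne_zero h2
  have h1 : φ = fun t => (Φ (t + a) - Φ t) / Φ a := by
    funext t
    rw [eq_div_iff ha]
    have h2 : Φ (t + a) - Φ t = ∫ s in t..(t + a), φ s :=
      integral_interval_sub_left (hφ.intervalIntegrable _ _) (hφ.intervalIntegrable _ _)
    rw [h2]
    have h3 : ∫ s in (0 : ℝ)..a, φ (t + s) = ∫ s in t..(t + a), φ s := by
      rw [integral_comp_add_left (fun s => φ s) t, add_zero]
    rw [← h3]
    simp only [hadd, Φ]
    rw [integral_const_mul]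
  rw [h1]
  exact ⟨_, (((hΦ (0 + a)).comp_add_const 0 a).sub (hΦ 0)).div_const _⟩

end ExponentialHom

/-! ### The differential of a character -/

section CharacterDifferential

open Filter Topology

variable {E : Type*} [NormedAddCommGroup E] [NormedSpace ℝ E]
  {G : Type*} [TopologicalSpace G] [T2Space G] [ChartedSpace E G] [Group G]
  [LieGroup 𝓘(ℝ, E) ∞ G] {H : Subgroup G} {χ : H →* ℂˣ}
  {X Y : GroupLieAlgebra 𝓘(ℝ, E) G} {a b : ℂ} {γ : ℝ → G}

/-- The pointwise formula χ(exp tX) = exp(ta), unlike the derivative at 0, passes to limits and to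
conjugates. -/
theorem IsOneParameterSubgroup.isCharacterDifferential_iff (hγ : IsOneParameterSubgroup X γ) :
    IsCharacterDifferential χ X a ↔
      ∀ t : ℝ, ∃ h : γ t ∈ H, (χ ⟨γ t, h⟩ : ℂ) = Complex.exp (t * a) := by
  constructor
  · rintro ⟨γ', hH, hγ', hd⟩ t
    obtain rfl := hγ.unique hγ'
    refine ⟨hH t, eq_exp_of_hasDerivAt (φ := fun t => (χ ⟨γ t, hH t⟩ : ℂ)) ?_ ?_ hd t⟩
    · have h1 : (⟨γ 0, hH 0⟩ : H) = 1 := Subtype.ext hγ.1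
      simp [h1]
    · intro s t
      have h1 : (⟨γ (s + t), hH (s + t)⟩ : H) = ⟨γ s, hH s⟩ * ⟨γ t, hH t⟩ :=
        Subtype.ext (hγ.map_add s t)
      change (χ ⟨γ (s + t), hH (s + t)⟩ : ℂ) = χ ⟨γ s, hH s⟩ * χ ⟨γ t, hH t⟩
      rw [h1, map_mul, Units.val_mul]
  · intro h
    refine ⟨γ, fun t => (h t).1, hγ, ?_⟩
    rw [show (fun t => (χ ⟨γ t, (h t).1⟩ : ℂ)) = fun t : ℝ => Complex.exp (t * a) from
      funext fun t => (h t).2]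
    have h3 := ((Complex.ofRealCLM.hasDerivAt (x := 0)).mul_const a).cexp
    simpa using h3

theorem IsCharacterDifferential.unique (ha : IsCharacterDifferential χ X a)
    (hb : IsCharacterDifferential χ X b) : a = b := by
  obtain ⟨γ, hH, hγ, hd⟩ := ha
  obtain ⟨γ', hH', hγ', hd'⟩ := hb
  obtain rfl := hγ.unique hγ'
  exact hd.unique hd'

theorem IsCharacterDifferential.smul (ha : IsCharacterDifferential χ X a) (r : ℝ) :
    IsCharacterDifferential χ (r • X) (r * a) := by
  obtain ⟨γ, hH, hγ, hd⟩ := id ha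
  rw [(hγ.smul r).isCharacterDifferential_iff]
  intro t
  obtain ⟨h, h'⟩ := hγ.isCharacterDifferential_iff.1 ha (t * r)
  refine ⟨h, h'.trans ?_⟩
  push_cast
  rw [mul_assoc]

theorem IsOneParameterSubgroup.exists_isCharacterDifferential (hχ : Continuous χ)
    (hγ : IsOneParameterSubgroup X γ) (hH : ∀ t, γ t ∈ H) :
    ∃ c, IsCharacterDifferential χ X c := by
  obtain ⟨c, hc⟩ := exists_hasDerivAt_of_continuous (φ := fun t => (χ ⟨γ t, hH t⟩ : ℂ))
    (Units.continuous_val.comp (hχ.comp (hγ.2.continuous.subtype_mk hH)))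
    (by
      have h1 : (⟨γ 0, hH 0⟩ : H) = 1 := Subtype.ext hγ.1
      simp [h1])
    (fun s t => by
      have h1 : (⟨γ (s + t), hH (s + t)⟩ : H) = ⟨γ s, hH s⟩ * ⟨γ t, hH t⟩ :=
        Subtype.ext (hγ.map_add s t)
      change (χ ⟨γ (s + t), hH (s + t)⟩ : ℂ) = χ ⟨γ s, hH s⟩ * χ ⟨γ t, hH t⟩
      rw [h1, map_mul, Units.val_mul])
  exact ⟨c, γ, hH, hγ, hc⟩

variable [FiniteDimensional ℝ E]

/-- Apply χ to the product formula: H is closed, so the limit stays in H, and (exp(ta/n) exp(tb/n))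
^ n = exp(t(a + b)) for n ≠ 0. -/
theorem IsCharacterDifferential.add (hH : IsClosed (H : Set G)) (hχ : Continuous χ)
    (ha : IsCharacterDifferential χ X a) (hb : IsCharacterDifferential χ Y b) :
    IsCharacterDifferential χ (X + Y) (a + b) := by
  obtain ⟨α, hαH, hα, -⟩ := id ha
  obtain ⟨β, hβH, hβ, -⟩ := id hb
  have : CompleteSpace E := FiniteDimensional.complete ℝ E
  obtain ⟨γ, hγ⟩ := exists_isOneParameterSubgroup (X + Y)
  rw [hα.isCharacterDifferential_iff] at ha
  rw [hβ.isCharacterDifferential_iff] at hb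
  rw [hγ.isCharacterDifferential_iff]
  intro t
  let u : ℕ → H := fun n => (⟨α (t / n), hαH _⟩ * ⟨β (t / n), hβH _⟩) ^ n
  have h1 : Tendsto (fun n => (u n : G)) atTop (𝓝 (γ t)) := hα.tendsto_pow hβ hγ t
  have h2 : γ t ∈ H := hH.mem_of_tendsto h1 (Eventually.of_forall fun n => (u n).2)
  refine ⟨h2, ?_⟩
  have h3 : Tendsto u atTop (𝓝 ⟨γ t, h2⟩) := tendsto_subtype_rng.2 h1
  have h4 : Tendsto (fun n => (χ (u n) : ℂ)) atTop (𝓝 (χ ⟨γ t, h2⟩)) :=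
    ((Units.continuous_val.comp hχ).tendsto _).comp h3
  refine tendsto_nhds_unique h4 (tendsto_const_nhds.congr' ?_)
  filter_upwards [eventually_ne_atTop 0] with n hn
  have hn' : (n : ℂ) ≠ 0 := Nat.cast_ne_zero.2 hn
  simp only [u, map_pow, map_mul, Units.val_pow_eq_pow_val, Units.val_mul]
  rw [(ha (t / n)).2, (hb (t / n)).2, ← Complex.exp_add, ← Complex.exp_nat_mul]
  congr 1
  push_cast
  field_simp

theorem mem_subgroupLieAlgebra_iff (hH : IsClosed (H : Set G)) (hχ : Continuous χ) :
    X ∈ subgroupLieAlgebra E H ↔ ∃ c, IsCharacterDifferential χ X c := by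
  constructor
  · intro h
    induction h using Submodule.span_induction with
    | mem X hX =>
      obtain ⟨γ, hγ, hγH⟩ := hX
      exact hγ.exists_isCharacterDifferential hχ hγH
    | zero =>
      have : CompleteSpace E := FiniteDimensional.complete ℝ E
      have h0 : IsOneParameterSubgroup (0 : GroupLieAlgebra 𝓘(ℝ, E) G) fun _ => 1 := by
        obtain ⟨γ, hγ⟩ := exists_isOneParameterSubgroup (0 : GroupLieAlgebra 𝓘(ℝ, E) G)
        simpa [hγ.1] using hγ.smul 0
      exact h0.exists_isCharacterDifferential hχ fun _ => H.one_mem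
    | add X Y _ _ hX hY =>
      obtain ⟨a, ha⟩ := hX
      obtain ⟨b, hb⟩ := hY
      exact ⟨_, ha.add hH hχ hb⟩
    | smul r X _ hX =>
      obtain ⟨a, ha⟩ := hX
      exact ⟨_, ha.smul r⟩
  · rintro ⟨c, γ, hγH, hγ, -⟩
    exact Submodule.subset_span ⟨γ, hγ, hγH⟩

theorem exists_linearMap_isCharacterDifferential (hH : IsClosed (H : Set G)) (hχ : Continuous χ) :
    ∃ d : GroupLieAlgebra 𝓘(ℝ, E) G →ₗ[ℝ] ℂ, ∀ X ∈ subgroupLieAlgebra E H,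
      IsCharacterDifferential χ X (d X) := by
  choose d hd using fun X : subgroupLieAlgebra E H => (mem_subgroupLieAlgebra_iff hH hχ).1 X.2
  let d' : subgroupLieAlgebra E H →ₗ[ℝ] ℂ :=
    { toFun := d
      map_add' := fun X Y => (hd (X + Y)).unique ((hd X).add hH hχ (hd Y))
      map_smul' := fun r X => (hd (r • X)).unique (by simpa using (hd X).smul r) }
  -- The extension from 𝔥 to 𝔤 is arbitrary; only its values on 𝔥 are used afterwards.
  obtain ⟨g, hg⟩ := LinearMap.exists_extend d'
  refine ⟨g, fun X hX => ?_⟩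
  have h := LinearMap.congr_fun hg ⟨X, hX⟩
  have h' : g X = d ⟨X, hX⟩ := h
  rw [h']
  exact hd ⟨X, hX⟩

/-- χ has commutative target, so it takes the same values on β and on its conjugate by an element of
H. -/
theorem IsCharacterDifferential.conj {β : ℝ → G} (hβ : IsOneParameterSubgroup Y β)
    (hb : IsCharacterDifferential χ Y b) {h : G} (hh : h ∈ H) :
    ∃ Z : GroupLieAlgebra 𝓘(ℝ, E) G, IsCharacterDifferential χ Z b ∧
      IsOneParameterSubgroup Z fun t => h * β t * h⁻¹ := by
  let δ : ℝ → G := fun t => h * β t * h⁻¹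
  have hδ : ContMDiff 𝓘(ℝ, ℝ) 𝓘(ℝ, E) ∞ δ :=
    (contMDiff_const.mul hβ.contMDiff).mul contMDiff_const
  have hδ0 : δ 0 = 1 := by simp [δ, hβ.1]
  let Z : GroupLieAlgebra 𝓘(ℝ, E) G := (mfderiv 𝓘(ℝ, ℝ) 𝓘(ℝ, E) δ 0 (1 : ℝ) : E)
  have h1 : HasMFDerivAt 𝓘(ℝ, ℝ) 𝓘(ℝ, E) δ 0 (mfderiv 𝓘(ℝ, ℝ) 𝓘(ℝ, E) δ 0) :=
    ((hδ.mdifferentiable (by simp)) 0).hasMFDerivAt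
  have h2 : (mfderiv 𝓘(ℝ, ℝ) 𝓘(ℝ, E) δ 0 : ℝ →L[ℝ] E) =
      (1 : ℝ →L[ℝ] ℝ).smulRight (Z : E) := by
    refine ContinuousLinearMap.ext_ring ?_
    exact (one_smul ℝ (Z : E)).symm
  have hZ : IsOneParameterSubgroup Z δ := by
    refine isOneParameterSubgroup_of_map_add hδ0 (fun s t => ?_) (h2 ▸ h1)
    simp only [δ, hβ.map_add]
    group
  refine ⟨Z, ?_, hZ⟩
  rw [hZ.isCharacterDifferential_iff]
  intro t
  obtain ⟨ht, ht'⟩ := hβ.isCharacterDifferential_iff.1 hb t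
  refine ⟨H.mul_mem (H.mul_mem hh ht) (H.inv_mem hh), ?_⟩
  have h3 : (⟨δ t, H.mul_mem (H.mul_mem hh ht) (H.inv_mem hh)⟩ : H) =
      ⟨h, hh⟩ * ⟨β t, ht⟩ * ⟨h, hh⟩⁻¹ := rfl
  rw [h3, map_mul, map_mul, map_inv, mul_right_comm, mul_inv_cancel, one_mul, ht']

end CharacterDifferential

/-! ### Commutators of left invariant vector fields -/

section Commutator

variable {E : Type*} [NormedAddCommGroup E] [NormedSpace ℝ E] [FiniteDimensional ℝ E]
  {G : Type*} [TopologicalSpace G] [T2Space G] [ChartedSpace E G] [Group G]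
  [LieGroup 𝓘(ℝ, E) ∞ G] {X Y : GroupLieAlgebra 𝓘(ℝ, E) G} {α β : ℝ → G}

/-- With K(p₁, p₂, p₃) = f(α p₁ β p₂ α p₃), the derivative sought is the second derivative of K at 0
in the directions (1, 0, -1) and (0, 1, 0), that is K₁₂ - K₃₂. Here K₁₂ = (X̃Ỹf)(1), and by symmetry
K₃₂ = K₂₃ = (ỸX̃f)(1). -/
theorem IsOneParameterSubgroup.hasDerivAt_deriv_conj (hα : IsOneParameterSubgroup X α)
    (hβ : IsOneParameterSubgroup Y β) (f : smoothFunctions E G) :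
    HasDerivAt (fun s => deriv (fun t => f.1 (α s * β t * α (-s))) 0)
      ((leftInvariantDeriv X (leftInvariantDeriv Y f)).1 1 -
        (leftInvariantDeriv Y (leftInvariantDeriv X f)).1 1) 0 := by
  let K : ℝ × ℝ × ℝ → ℂ := fun p => f.1 (α p.1 * β p.2.1 * α p.2.2)
  have hK : ContDiff ℝ ∞ K := by
    rw [← contMDiff_iff_contDiff]
    refine ContMDiff.comp f.2 ?_
    exact ((hα.contMDiff.comp contDiff_fst.contMDiff).mul
      (hβ.contMDiff.comp (contDiff_fst.comp contDiff_snd).contMDiff)).mul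
      (hα.contMDiff.comp (contDiff_snd.comp contDiff_snd).contMDiff)
  have hK1 : ∀ p, HasFDerivAt K (fderiv ℝ K p) p := fun p =>
    (hK.differentiable (by simp) p).hasFDerivAt
  have hK2 : HasFDerivAt (fderiv ℝ K) (fderiv ℝ (fderiv ℝ K) 0) 0 :=
    ((hK.fderiv_right (m := ∞) (by simp)).differentiable (by simp) 0).hasFDerivAt
  have hsymm : IsSymmSndFDerivAt ℝ K 0 :=
    (hK.contDiffAt (x := 0)).isSymmSndFDerivAt (by
      rw [minSmoothness_of_isRCLikeNormedField]
      exact WithTop.coe_le_coe.2 le_top)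
  have hline : ∀ v p : ℝ × ℝ × ℝ, HasDerivAt (fun t : ℝ => p + t • v) v 0 := fun v p => by
    simpa using ((hasDerivAt_id (0 : ℝ)).smul_const v).const_add p
  have h1 : ∀ p v, HasDerivAt (fun t : ℝ => K (p + t • v)) (fderiv ℝ K p v) 0 := fun p v => by
    have h2 : HasFDerivAt K (fderiv ℝ K p) (p + (0 : ℝ) • v) := by simpa using hK1 p
    exact HasFDerivAt.comp_hasDerivAt (f := fun t : ℝ => p + t • v) (0 : ℝ) h2 (hline v p)
  have h2 : ∀ v w, HasDerivAt (fun t : ℝ => fderiv ℝ K (t • v) w)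
      (fderiv ℝ (fderiv ℝ K) 0 v w) 0 := fun v w => by
    have h3 : HasDerivAt (fun t : ℝ => fderiv ℝ K (t • v)) (fderiv ℝ (fderiv ℝ K) 0 v) 0 := by
      have h4 : HasFDerivAt (fderiv ℝ K) (fderiv ℝ (fderiv ℝ K) 0) ((0 : ℝ) • v) := by
        simpa using hK2
      exact HasFDerivAt.comp_hasDerivAt (f := fun t : ℝ => t • v) (0 : ℝ) h4
        (by simpa using hline v 0)
    simpa using h3.clm_apply (hasDerivAt_const (0 : ℝ) w)
  have e1 : fderiv ℝ (fderiv ℝ K) 0 (1, 0, 0) (0, 1, 0) =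
      (leftInvariantDeriv X (leftInvariantDeriv Y f)).1 1 := by
    refine (h2 (1, 0, 0) (0, 1, 0)).unique ((hα.hasDerivAt_zero
      (leftInvariantDeriv Y f)).congr_of_eventuallyEq (.of_forall fun s => ?_))
    refine (h1 (s • (1, 0, 0)) (0, 1, 0)).unique ?_
    have h3 := (hβ.2.mul_left (α s)).hasDerivAt_smoothFunction f 0
    simpa [K, hα.1, hβ.1] using h3
  have e2 : fderiv ℝ (fderiv ℝ K) 0 (0, 1, 0) (0, 0, 1) =
      (leftInvariantDeriv Y (leftInvariantDeriv X f)).1 1 := by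
    refine (h2 (0, 1, 0) (0, 0, 1)).unique ((hβ.hasDerivAt_zero
      (leftInvariantDeriv X f)).congr_of_eventuallyEq (.of_forall fun s => ?_))
    refine (h1 (s • (0, 1, 0)) (0, 0, 1)).unique ?_
    have h3 := (hα.2.mul_left (β s)).hasDerivAt_smoothFunction f 0
    simpa [K, hα.1, hβ.1] using h3
  have h3 := h2 ((1, 0, 0) - (0, 0, 1)) (0, 1, 0)
  rw [map_sub, sub_apply, e1, hsymm (0, 0, 1), e2] at h3
  refine h3.congr_of_eventuallyEq (.of_forall fun s => HasDerivAt.deriv ?_)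
  have h4 := h1 (s • ((1, 0, 0) - (0, 0, 1))) (0, 1, 0)
  simpa [K] using h4

end Commutator

/-! ### The space of operators defined by a character -/

section BaseChange

variable {V : Type*} [AddCommGroup V] [Module ℝ V] {p q : Submodule ℝ V}

theorem Submodule.baseChange_induction {S : Submodule ℂ (ℂ ⊗[ℝ] V)} (h : ∀ x ∈ p, 1 ⊗ₜ x ∈ S) :
    p.baseChange ℂ ≤ S := by
  rw [Submodule.baseChange_eq_span, Submodule.span_le]
  rintro _ ⟨x, hx, rfl⟩
  exact h x hx

theorem IsCompl.baseChange_complex (h : IsCompl p q) :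
    IsCompl (p.baseChange ℂ) (q.baseChange ℂ) := by
  let P : V →ₗ[ℝ] V := p.subtype ∘ₗ p.projectionOnto q h
  have hp : ∀ x ∈ p, P x = x := fun x hx => by
    simpa [P] using congrArg Subtype.val (Submodule.projectionOnto_apply_left h ⟨x, hx⟩)
  have hq : ∀ x ∈ q, P x = 0 := fun x hx => by simpa [P] using hx
  have hp' : p.baseChange ℂ ≤ LinearMap.ker (P.baseChange ℂ - LinearMap.id) :=
    Submodule.baseChange_induction fun x hx => by simp [hp x hx]
  have hq' : q.baseChange ℂ ≤ LinearMap.ker (P.baseChange ℂ) :=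
    Submodule.baseChange_induction fun x hx => by simp [hq x hx]
  refine IsCompl.of_eq ?_ ?_
  · refine (Submodule.eq_bot_iff _).2 fun x hx => ?_
    have h1 : P.baseChange ℂ x - x = 0 := hp' hx.1
    have h2 : P.baseChange ℂ x = 0 := hq' hx.2
    rwa [h2, zero_sub, neg_eq_zero] at h1
  · rw [eq_top_iff, ← Submodule.baseChange_top]
    refine Submodule.baseChange_induction fun x _ => ?_
    obtain ⟨y, hy, z, hz, rfl⟩ := Submodule.mem_sup.1 (h.sup_eq_top ▸ Submodule.mem_top : x ∈ p ⊔ q)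
    rw [TensorProduct.tmul_add]
    exact Submodule.add_mem_sup (Submodule.tmul_mem_baseChange_of_mem _ hy)
      (Submodule.tmul_mem_baseChange_of_mem _ hz)

end BaseChange

/-! ### Commutators as limits of difference quotients -/

section CommutatorLimit

open Filter Topology

variable {A : Type*} [CommRing A] [Algebra ℂ A]

theorem mul_sub_mul_mem_span_of_shift {S : Set (Module.End ℂ A)}
    (h : ∀ u ∈ S, ∀ v ∈ S, ∃ (x y : Module.End ℂ A) (a b : ℂ), u = x + a • 1 ∧ v = y + b • 1 ∧
      x * y - y * x ∈ Submodule.span ℂ S) {u v : Module.End ℂ A}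
    (hu : u ∈ Submodule.span ℂ S) (hv : v ∈ Submodule.span ℂ S) :
    u * v - v * u ∈ Submodule.span ℂ S := by
  induction hu using Submodule.span_induction with
  | zero => simp
  | add u u' _ _ hu hu' =>
    rw [add_mul, mul_add, add_sub_add_comm]
    exact Submodule.add_mem _ hu hu'
  | smul c u _ hu =>
    rw [smul_mul_assoc, mul_smul_comm, ← smul_sub]
    exact Submodule.smul_mem _ _ hu
  | mem u hu =>
    induction hv using Submodule.span_induction with
    | zero => simp
    | add v v' _ _ hv hv' =>
      rw [add_mul, mul_add, add_sub_add_comm]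
      exact Submodule.add_mem _ hv hv'
    | smul c v _ hv =>
      rw [smul_mul_assoc, mul_smul_comm, ← smul_sub]
      exact Submodule.smul_mem _ _ hv
    | mem v hv =>
      obtain ⟨x, y, a, b, rfl, rfl, hxy⟩ := h u hu v hv
      convert hxy using 1
      simp only [add_mul, mul_add, smul_mul_assoc, mul_smul_comm, one_mul, mul_one, smul_add]
      rw [smul_comm a b]
      abel

/-- The functional `f ↦ ev (D f)` attached to an operator `D`. -/
def evalFunctional (ev : A →ₐ[ℂ] ℂ) : Module.End ℂ A →ₗ[ℂ] (A → ℂ) where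
  toFun D f := ev (D f)
  map_add' D D' := by ext f; simp
  map_smul' c D := by ext f; simp

/-- The scalar b cancels in z s - y, so the difference quotients stay in W. Their functionals at
`ev` converge pointwise to that of the commutator, and the limit is the functional of some w in W;
an element of C is determined by its functional. -/
theorem mul_sub_mul_mem_of_hasDerivAt {ev : A →ₐ[ℂ] ℂ} {C : Subalgebra ℂ (Module.End ℂ A)}
    (hC : ∀ D ∈ C, (∀ f, ev (D f) = 0) → D = 0) {W : Submodule ℂ (Module.End ℂ A)}
    [Module.Finite ℂ W] (hWC : ∀ w ∈ W, w ∈ C) {x y : Module.End ℂ A} (hx : x ∈ C) (hy : y ∈ C)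
    {z : ℝ → Module.End ℂ A} {b : ℂ} (hz : ∀ s, z s + b • 1 ∈ W) (hyW : y + b • 1 ∈ W)
    (hz0 : ∀ f, ev (z 0 f) = ev (y f))
    (hd : ∀ f, HasDerivAt (fun s => ev (z s f)) (ev (x (y f)) - ev (y (x f))) 0) :
    x * y - y * x ∈ W := by
  -- For the topology of pointwise convergence on A → ℂ, finite-dimensional subspaces are closed.
  have hT : IsClosed (W.map (evalFunctional ev) : Set (A → ℂ)) :=
    (W.map (evalFunctional ev)).closed_of_finiteDimensional
  have hlim : Tendsto (fun s : ℝ => evalFunctional ev ((s⁻¹ : ℂ) • (z s - y))) (𝓝[≠] 0)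
      (𝓝 (evalFunctional ev (x * y - y * x))) := by
    rw [tendsto_pi_nhds]
    intro f
    have h1 := (hd f).tendsto_slope_zero
    rw [show evalFunctional ev (x * y - y * x) f = ev (x (y f)) - ev (y (x f)) from
      map_sub ev _ _]
    refine h1.congr fun s => ?_
    rw [zero_add, hz0, ← map_sub, Complex.real_smul, Complex.ofReal_inv]
    exact (map_smul ev _ _).symm
  obtain ⟨w, hw, hw'⟩ := hT.mem_of_tendsto hlim (Eventually.of_forall fun s => by
    refine Submodule.mem_map_of_mem (W.smul_mem _ ?_)
    simpa using W.sub_mem (hz s) hyW)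
  have h0 : w - (x * y - y * x) = 0 := by
    refine hC _ (C.sub_mem (hWC w hw) (C.sub_mem (C.mul_mem hx hy) (C.mul_mem hy hx))) fun f => ?_
    rw [LinearMap.sub_apply, map_sub, sub_eq_zero]
    exact congrFun hw' f
  rw [← sub_eq_zero.1 h0]
  exact hw

end CommutatorLimit

/-! ### Closure of 𝔥^χ under commutators -/

section CharacterShift

open Filter Topology

variable {E : Type*} [NormedAddCommGroup E] [NormedSpace ℝ E] [FiniteDimensional ℝ E]
  {G : Type*} [TopologicalSpace G] [T2Space G] [ChartedSpace E G] [Group G]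
  [LieGroup 𝓘(ℝ, E) ∞ G] {H : Subgroup G} {χ : H →* ℂˣ}

theorem characterShift_eq_map (hH : IsClosed (H : Set G)) (hχ : Continuous χ)
    {d : GroupLieAlgebra 𝓘(ℝ, E) G →ₗ[ℝ] ℂ}
    (hd : ∀ X ∈ subgroupLieAlgebra E H, IsCharacterDifferential χ X (d X)) :
    characterShift E χ = ((subgroupLieAlgebra E H).baseChange ℂ).map
      ((leftInvariantDerivLinear E G).liftBaseChange ℂ + (d.liftBaseChange ℂ).smulRight 1) := by
  have h1 : ∀ X : GroupLieAlgebra 𝓘(ℝ, E) G,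
      ((leftInvariantDerivLinear E G).liftBaseChange ℂ + (d.liftBaseChange ℂ).smulRight 1 :
        ℂ ⊗[ℝ] GroupLieAlgebra 𝓘(ℝ, E) G →ₗ[ℂ] Module.End ℂ (smoothFunctions E G)) (1 ⊗ₜ X) = leftInvariantDeriv X + d X • 1 := fun X => by
    rw [LinearMap.add_apply, liftBaseChange_leftInvariantDeriv_tmul, one_smul,
      LinearMap.smulRight_apply, LinearMap.liftBaseChange_tmul, one_smul]
  refine le_antisymm (Submodule.span_le.2 ?_) ?_
  · rintro _ ⟨X, c, hc, rfl⟩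
    have hX := (mem_subgroupLieAlgebra_iff hH hχ).2 ⟨c, hc⟩
    rw [hc.unique (hd X hX), ← h1]
    exact Submodule.mem_map_of_mem (Submodule.tmul_mem_baseChange_of_mem _ hX)
  · rw [Submodule.map_le_iff_le_comap]
    refine Submodule.baseChange_induction fun X hX => ?_
    rw [Submodule.mem_comap, h1]
    exact Submodule.subset_span ⟨X, d X, hd X hX, rfl⟩

omit [FiniteDimensional ℝ E] [T2Space G] in
theorem characterShift_le : characterShift E χ ≤ Subalgebra.toSubmodule (leftInvariantOps E G) := by
  refine Submodule.span_le.2 ?_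
  rintro _ ⟨X, c, -, rfl⟩
  exact Subalgebra.add_mem _ (leftInvariantDeriv_mem X)
    (Subalgebra.smul_mem _ (Subalgebra.one_mem _) c)

/-- Z s generates the conjugate of β by α s and has the same differential b, so Z̃(s) + b traces a
curve in 𝔥^χ whose derivative at s = 0 is the commutator. -/
theorem commutator_mem_characterShift [Module.Finite ℂ (characterShift E χ)]
    {X Y : GroupLieAlgebra 𝓘(ℝ, E) G} {a b : ℂ}
    (ha : IsCharacterDifferential χ X a) (hb : IsCharacterDifferential χ Y b) :
    leftInvariantDeriv X * leftInvariantDeriv Y - leftInvariantDeriv Y * leftInvariantDeriv X ∈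
      characterShift E χ := by
  obtain ⟨α, hαH, hα, -⟩ := id ha
  obtain ⟨β, -, hβ, -⟩ := id hb
  choose Z hZ hZ' using fun s : ℝ => hb.conj hβ (hαH s)
  have h1 : ∀ f : smoothFunctions E G, ∀ s,
      deriv (fun t => f.1 (α s * β t * α (-s))) 0 = (leftInvariantDeriv (Z s) f).1 1 :=
    fun f s => by
      have h2 := (hZ' s).hasDerivAt_zero f
      rw [← hα.map_neg] at h2
      exact h2.deriv
  refine mul_sub_mul_mem_of_hasDerivAt (ev := evalOne E G) (C := leftInvariantOps E G)
    (z := fun s => leftInvariantDeriv (Z s)) (b := b)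
    (fun D hD h => eq_zero_of_leftInvariant hD h) (fun w hw => characterShift_le hw)
    (leftInvariantDeriv_mem X) (leftInvariantDeriv_mem Y)
    (fun s => Submodule.subset_span ⟨Z s, b, hZ s, rfl⟩) (Submodule.subset_span ⟨Y, b, hb, rfl⟩)
    (fun f => ?_) (fun f => ?_)
  · rw [evalOne_apply, evalOne_apply, ← h1]
    simpa [hα.1] using (hβ.hasDerivAt_zero f).deriv
  · have h2 := hα.hasDerivAt_deriv_conj hβ f
    simp only [h1] at h2
    exact h2

theorem mul_sub_mul_mem_characterShift [Module.Finite ℂ (characterShift E χ)]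
    {u v : Module.End ℂ (smoothFunctions E G)} (hu : u ∈ characterShift E χ)
    (hv : v ∈ characterShift E χ) : u * v - v * u ∈ characterShift E χ := by
  refine mul_sub_mul_mem_span_of_shift ?_ hu hv
  rintro _ ⟨X, a, ha, rfl⟩ _ ⟨Y, b, hb, rfl⟩
  exact ⟨leftInvariantDeriv X, leftInvariantDeriv Y, a, b, rfl, rfl,
    commutator_mem_characterShift ha hb⟩

end CharacterShift

end

/-- The products of spaces of operators are the linear spans of the products of their elements. -/
theorem proposition2p3
    {E : Type*} [NormedAddCommGroup E] [NormedSpace ℝ E] [FiniteDimensional ℝ E]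
    {G : Type*} [TopologicalSpace G] [T2Space G] [ChartedSpace E G] [Group G]
    [LieGroup 𝓘(ℝ, E) ∞ G]
    (H : Subgroup G) (hH : IsClosed (H : Set G))
    (χ : H →* ℂˣ) (hχ : Continuous χ)
    (𝔪 : Submodule ℝ (GroupLieAlgebra 𝓘(ℝ, E) G))
    (h𝔪 : IsCompl (subgroupLieAlgebra E H) 𝔪) :
    (∀ m : ℕ,
      (symDegreeLE (⊤ : Submodule ℝ (GroupLieAlgebra 𝓘(ℝ, E) G)) m).map (lieSymmetrization E G) =
        (symDegreeLE (⊤ : Submodule ℝ (GroupLieAlgebra 𝓘(ℝ, E) G)) ((m : ℤ) - 1)).map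
            (lieSymmetrization E G) * characterShift E χ ⊔
          (symDegreeLE 𝔪 m).map (lieSymmetrization E G) ∧
      Disjoint
        ((symDegreeLE (⊤ : Submodule ℝ (GroupLieAlgebra 𝓘(ℝ, E) G)) ((m : ℤ) - 1)).map
          (lieSymmetrization E G) * characterShift E χ)
        ((symDegreeLE 𝔪 m).map (lieSymmetrization E G))) ∧
    (Subalgebra.toSubmodule (invariantDiffOps E G) =
        Subalgebra.toSubmodule (invariantDiffOps E G) * characterShift E χ ⊔
          (symAll 𝔪).map (lieSymmetrization E G) ∧
      Disjoint (Subalgebra.toSubmodule (invariantDiffOps E G) * characterShift E χ)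
        ((symAll 𝔪).map (lieSymmetrization E G))) := by

  have : FiniteDimensional ℝ (GroupLieAlgebra 𝓘(ℝ, E) G) := inferInstanceAs (FiniteDimensional ℝ E)
  obtain ⟨d, hd⟩ := exists_linearMap_isCharacterDifferential (E := E) hH hχ
  have hW := characterShift_eq_map hH hχ hd
  have : Module.Finite ℂ (characterShift E χ) := by
    rw [hW]
    infer_instance
  -- Here M and N are the complexifications of 𝔪 and 𝔥, in this order, hence the `symm`.
  have h := (isInvariantFrame_leftInvariantDeriv E G).decomposition
    h𝔪.symm.baseChange_complex (d.liftBaseChange ℂ) hW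
    (fun _ ha _ hb => mul_sub_mul_mem_characterShift ha hb)
    (D := Subalgebra.toSubmodule (invariantDiffOps E G)) (fun _ => Iff.rfl)
  simp only [symDegreeLE_eq_degreeLT, symDegreeLE_sub_one_eq_degreeLT, Submodule.baseChange_top]
  exact h
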